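/- Let $\mathbb T=\mathbb R/\mathbb Z$ and identify functions on $\mathbb T$ with $1$-periodic functions on $\mathbb R$. For $\varphi_0\in C^2(\mathbb T)$ consider the problem $$\partial_t\varphi+\partial_x(u\varphi)=\partial_x^2\varphi,\qquad \partial_x u=\|\varphi(t,\cdot)\|_{L^2(\mathbb T)}^2-\varphi^2,\qquad u(t,0)=0,\qquad \varphi(0,\cdot)=\varphi_0 .$$ A solution on $[0,T)$ is a pair $(\varphi,u)$ of $1$-periodic functions such that $\varphi$ is continuous on $[0,T)\times\mathbb T$, the derivatives $\partial_t\varphi,\partial_x\varphi,\partial_x^2\varphi$ exist and are continuous on $(0,T)\times\mathbb T$, and the problem is satisfied pointwise for $0<t<T$. For every $V_0>0$ there is a constant $C>0$, depending only on $V_0$, with the following property. Let $\varphi_0\in C^2(\mathbb T)$ be non-negative, even, non-increasing on $[0,\tfrac12]$ and not identically zero, with mass and second moment $$M=\int_{-1/2}^{1/2}\varphi_0(x)\,dx,\qquad V(0)=\int_{-1/2}^{1/2}x^2\varphi_0(x)\,dx=V_0 .$$ If $M>C\,V(0)$, then the solution with initial value $\varphi_0$ blows up in finite time: there are a finite $T>0$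 and a solution $(\varphi,u)$ on $[0,T)$ such that every solution with initial value $\varphi_0$ is the restriction of $(\varphi,u)$ to some $[0,T')$ with $T'\le T$, and $\sup_{0\le t<T}\|\varphi(t,\cdot)\|_{L^\infty(\mathbb T)}=\infty$. -/

import Mathlib

open Set

/-- The total mass `∫_{-1/2}^{1/2} f` of a 1-periodic function. -/
noncomputable def mass (f : ℝ → ℝ) : ℝ := ∫ x in (-1 / 2 : ℝ)..(1 / 2), f x

/-- The second moment `∫_{-1/2}^{1/2} x² f(x) dx` of a 1-periodic function. -/
noncomputable def secondMoment (f : ℝ → ℝ) : ℝ := ∫ x in (-1 / 2 : ℝ)..(1 / 2), x ^ 2 * f x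

/-- `(φ, u)` is a classical solution on `[0, T) × 𝕋`, with `𝕋 = ℝ / ℤ`, of
`∂ₜφ + ∂ₓ(uφ) = ∂ₓ²φ`, `∂ₓu = ‖φ‖²_{L²(𝕋)} - φ²`, `u(t, 0) = 0`, `φ(0, ·) = φ₀`.
Functions on `𝕋` are 1-periodic functions on `ℝ`, the first argument is time. The density `φ` is
continuous up to `t = 0`, and `∂ₜφ`, `∂ₓφ`, `∂ₓ²φ` exist and are continuous for `0 < t < T`. -/
structure IsSolution (φ₀ : ℝ → ℝ) (T : ℝ) (φ u : ℝ → ℝ → ℝ) : Prop where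
  periodic : ∀ t ∈ Ico 0 T, Function.Periodic (φ t) 1
  periodic_velocity : ∀ t ∈ Ioo 0 T, Function.Periodic (u t) 1
  continuousOn : ContinuousOn (fun p : ℝ × ℝ => φ p.1 p.2) (Ico 0 T ×ˢ univ)
  initial : ∀ x, φ 0 x = φ₀ x
  differentiableAt_time : ∀ t ∈ Ioo 0 T, ∀ x, DifferentiableAt ℝ (fun s => φ s x) t
  contDiff_space : ∀ t ∈ Ioo 0 T, ContDiff ℝ 2 (φ t)
  continuousOn_deriv_time :
    ContinuousOn (fun p : ℝ × ℝ => deriv (fun s => φ s p.2) p.1) (Ioo 0 T ×ˢ univ)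
  continuousOn_deriv_space :
    ContinuousOn (fun p : ℝ × ℝ => deriv (φ p.1) p.2) (Ioo 0 T ×ˢ univ)
  continuousOn_deriv_space_two :
    ContinuousOn (fun p : ℝ × ℝ => iteratedDeriv 2 (φ p.1) p.2) (Ioo 0 T ×ˢ univ)
  velocity_zero : ∀ t ∈ Ioo 0 T, u t 0 = 0
  velocity_deriv : ∀ t ∈ Ioo 0 T, ∀ x,
    HasDerivAt (u t) ((∫ y in (-1 / 2 : ℝ)..(1 / 2), φ t y ^ 2) - φ t x ^ 2) x
  equation : ∀ t ∈ Ioo 0 T, ∀ x,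
    deriv (fun s => φ s x) t + deriv (fun y => u t y * φ t y) x = iteratedDeriv 2 (φ t) x

/-- `(φ, u)` on `[0, T)` is *the* maximal solution with initial value `φ₀`: every solution with
this initial value is a restriction of it. -/
structure IsMaximalSolution (φ₀ : ℝ → ℝ) (T : ℝ) (φ u : ℝ → ℝ → ℝ) : Prop where
  isSolution : IsSolution φ₀ T φ u
  maximal : ∀ (T' : ℝ) (φ' u' : ℝ → ℝ → ℝ), IsSolution φ₀ T' φ' u' →
    T' ≤ T ∧ (∀ t ∈ Ico 0 T', ∀ x, φ' t x = φ t x) ∧ ∀ t ∈ Ioo 0 T', ∀ x, u' t x = u t x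

/-- The solution with initial value `φ₀` blows up in finite time: its maximal time of existence
`T` is finite, and its supremum norm is unbounded on `[0, T)`. -/
def BlowsUpInFiniteTime (φ₀ : ℝ → ℝ) : Prop :=
  ∃ T : ℝ, 0 < T ∧ ∃ φ u : ℝ → ℝ → ℝ, IsMaximalSolution φ₀ T φ u ∧
    ∀ K : ℝ, ∃ t ∈ Ico 0 T, ∃ x, K < |φ t x|

/-!
For an even profile that decreases on `[0, 1/2]`, the velocity points towards the origin. With
`A x = ∫₀ˣ φ` and the half mass `m = A (1/2)`, monotonicity gives `-x u ≥ A² - 2xmA` on the half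
period (`integral_mul_velocity_le`). Hence the half second moment `h = ∫₀^{1/2} x² φ` satisfies
`h' ≤ 2m - m³/3 + 12 m² h`, where `m` is conserved. If `m` is large compared with the initial value
of `h`, the right-hand side is negative at first and stays so because `h` decreases; as `h ≥ 0`, the
lifespan of every solution is bounded (`IsSolution.lifespan_le`). Symmetry is inherited from the
data by uniqueness, which is an `L²` energy estimate (`IsSolution.density_unique`); sign and
monotonicity are preserved by a maximum principle, in the case of monotonicity for the difference
`φ(t, x) - φ(t, y)` of two points.

Solutions for even data are constructed as `∑ₖ aₖ(t) cos(2πkx)`, `k ∈ ℤ`, with real symmetric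
coefficients. The coefficients solve `aₖ' = -(2πk)² aₖ - 2πk Nₖ`, with `N` a threefold convolution
of `a`, in which integrating `∂ₓu` supplies the factors `1/(2πk)`. In the norm `∑ₖ sup_t |aₖ(t)|`
convolution is bounded and the Duhamel operator, derivative included, has norm at most `√τ` on
`[0, τ]`. The contraction principle therefore applies on a time interval that depends only on the
`ℓ¹` norm of the data (`exists_modes`). Multiplying the coefficients by `t` and by `t²` yields the
summability needed to differentiate the series for `t > 0` (`exists_smooth_majorant`,
`isClassicalOn_tsum`).

For a bounded solution, monotonicity bounds `∂ₓφ` in `L¹`, so the Fourier coefficients of `∂ₓ(uφ)`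
are bounded, and those of `φ` are `O(k⁻²)` uniformly in time. The solution can thus be restarted
with a uniform time of existence and continued (`IsSolution.exists_extension`). The supremum of all
lifespans is finite, the solutions glue to a maximal one (`exists_isMaximalSolution`), and this one
cannot be bounded.
-/

open MeasureTheory Filter Topology

/-! ### Calculus tools -/

theorem hasDerivAt_integral_of_continuousOn_deriv {F F' : ℝ → ℝ → ℝ} {S : Set ℝ} (hS : IsOpen S)
    (hF : ∀ t ∈ S, Continuous (F t))
    (hd : ∀ t ∈ S, ∀ x, HasDerivAt (fun s => F s x) (F' t x) t)
    (hc : ContinuousOn (fun p : ℝ × ℝ => F' p.1 p.2) (S ×ˢ univ)) (a b : ℝ) {t : ℝ} (ht : t ∈ S) :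
    HasDerivAt (fun s => ∫ x in a..b, F s x) (∫ x in a..b, F' t x) t := by
  obtain ⟨ε, hε, hball⟩ := Metric.nhds_basis_closedBall.mem_iff.1 (hS.mem_nhds ht)
  have hK : IsCompact (Metric.closedBall t ε ×ˢ uIcc a b) :=
    (isCompact_closedBall t ε).prod isCompact_uIcc
  obtain ⟨B, hB⟩ := hK.exists_bound_of_continuousOn
    (hc.mono (prod_mono hball (subset_univ _)))
  refine (intervalIntegral.hasDerivAt_integral_of_dominated_loc_of_deriv_le
    (bound := fun _ => B) (F' := F') (Metric.closedBall_mem_nhds t hε) ?_ ?_ ?_ ?_ ?_ ?_).2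
  · filter_upwards [hS.mem_nhds ht] with s hs
    exact (hF s hs).aestronglyMeasurable
  · exact (hF t ht).intervalIntegrable _ _
  · refine Continuous.aestronglyMeasurable ?_
    exact hc.comp_continuous (f := fun x : ℝ => (t, x)) (by fun_prop) fun x => ⟨ht, mem_univ _⟩
  · refine Eventually.of_forall fun x hx s hs => ?_
    exact hB (s, x) ⟨hs, uIoc_subset_uIcc hx⟩
  · exact intervalIntegrable_const
  · exact Eventually.of_forall fun x _ s hs => hd s (hball hs) x

theorem continuousOn_integral_of_continuousOn {F : ℝ → ℝ → ℝ} {T : ℝ}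
    (hF : ContinuousOn (fun p : ℝ × ℝ => F p.1 p.2) (Ico 0 T ×ˢ univ)) (a b : ℝ) :
    ContinuousOn (fun t => ∫ x in a..b, F t x) (Ico 0 T) := by
  intro t ht
  obtain ⟨T₁, h1, h2⟩ := exists_between ht.2
  have h0 : (0 : ℝ) ≤ T₁ := ht.1.trans h1.le
  -- Clamping the time to `[0, T₁]` makes the integrand globally continuous.
  have hG : Continuous fun p : ℝ × ℝ => F (projIcc 0 T₁ h0 p.1) p.2 := by
    refine hF.comp_continuous (f := fun p : ℝ × ℝ => ((projIcc 0 T₁ h0 p.1 : ℝ), p.2)) ?_ ?_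
    · fun_prop
    · intro p
      exact ⟨⟨(projIcc 0 T₁ h0 p.1).2.1, (projIcc 0 T₁ h0 p.1).2.2.trans_lt h2⟩, mem_univ _⟩
  have hI : Continuous fun s : ℝ => ∫ x in a..b, F (projIcc 0 T₁ h0 s) x :=
    intervalIntegral.continuous_parametric_intervalIntegral_of_continuous'
      (f := fun s x => F (projIcc 0 T₁ h0 s) x) hG a b
  refine (hI.continuousAt.continuousWithinAt (s := Ico 0 T)).congr_of_eventuallyEq ?_ ?_
  · filter_upwards [self_mem_nhdsWithin, mem_nhdsWithin_of_mem_nhds (Iio_mem_nhds h1)] with s hs hs'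
    rw [projIcc_of_mem h0 ⟨hs.1, le_of_lt hs'⟩]
  · rw [projIcc_of_mem h0 ⟨ht.1, h1.le⟩]

/-- Grönwall's inequality in the form used here: the derivative need not exist at the initial
time. -/
theorem le_mul_exp_of_deriv_le {g g' : ℝ → ℝ} {a b κ : ℝ} (hc : ContinuousOn g (Ico a b))
    (hd : ∀ t ∈ Ioo a b, HasDerivAt g (g' t) t) (hle : ∀ t ∈ Ioo a b, g' t ≤ κ * g t) :
    ∀ t ∈ Ico a b, g t ≤ g a * Real.exp (κ * (t - a)) := by
  intro t ht
  have hE : ∀ s, HasDerivAt (fun s => Real.exp (-(κ * (s - a))))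
      (Real.exp (-(κ * (s - a))) * (-(κ * 1))) s := fun s =>
    ((((hasDerivAt_id s).sub_const a).const_mul κ).neg).exp
  have hanti : AntitoneOn (fun s => g s * Real.exp (-(κ * (s - a)))) (Ico a b) := by
    refine antitoneOn_of_hasDerivWithinAt_nonpos (convex_Ico a b) (hc.mul (by fun_prop))
      (f' := fun s => g' s * Real.exp (-(κ * (s - a))) +
        g s * (Real.exp (-(κ * (s - a))) * (-(κ * 1)))) ?_ ?_
    · intro s hs
      rw [interior_Ico] at hs
      exact ((hd s hs).mul (hE s)).hasDerivWithinAt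
    · intro s hs
      rw [interior_Ico] at hs
      have := hle s hs
      have he := Real.exp_pos (-(κ * (s - a)))
      nlinarith
  have h := hanti (left_mem_Ico.2 (ht.1.trans_lt ht.2)) ht ht.1
  simp only [sub_self, mul_zero, neg_zero, Real.exp_zero, mul_one] at h
  rw [Real.exp_neg, ← div_eq_mul_inv, div_le_iff₀ (Real.exp_pos _)] at h
  exact h

theorem le_of_deriv_le_const {g g' : ℝ → ℝ} {a b c : ℝ} (hc : ContinuousOn g (Ico a b))
    (hd : ∀ t ∈ Ioo a b, HasDerivAt g (g' t) t) (hle : ∀ t ∈ Ioo a b, g' t ≤ c) :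
    ∀ t ∈ Ico a b, g t ≤ g a + c * (t - a) := by
  intro t ht
  have h := le_mul_exp_of_deriv_le (g := fun s => g s - c * (s - a)) (g' := fun s => g' s - c * 1)
    (κ := 0) (hc.sub (by fun_prop))
    (fun s hs => (hd s hs).sub (((hasDerivAt_id s).sub_const a).const_mul c))
    (fun s hs => by have := hle s hs; linarith) t ht
  simp at h
  linarith

/-- A damped linear equation `y' = -λ y + f` keeps `|y|` below its initial value plus
`sup |f| / λ`. -/
theorem abs_le_of_deriv_eq_neg_mul_add {y f : ℝ → ℝ} {a b lam F : ℝ} (hlam : 0 < lam)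
    (hc : ContinuousOn y (Ico a b))
    (hd : ∀ t ∈ Ioo a b, HasDerivAt y (-lam * y t + f t) t)
    (hf : ∀ t ∈ Ioo a b, |f t| ≤ F) :
    ∀ t ∈ Ico a b, |y t| ≤ |y a| + F / lam := by
  -- The one-sided bound is applied to `y` and to `-y`.
  have key : ∀ z g : ℝ → ℝ, ContinuousOn z (Ico a b) →
      (∀ t ∈ Ioo a b, HasDerivAt z (-lam * z t + g t) t) → (∀ t ∈ Ioo a b, g t ≤ F) →
      0 ≤ F → ∀ t ∈ Ico a b, z t ≤ |z a| + F / lam := by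
    intro z g hz hzd hg hF t ht
    have h := le_mul_exp_of_deriv_le (g := fun s => z s - F / lam)
      (g' := fun s => -lam * z s + g s) (κ := -lam) (hz.sub continuousOn_const)
      (fun s hs => (hzd s hs).sub_const _)
      (fun s hs => by
        have := hg s hs
        have e : -lam * (z s - F / lam) = -lam * z s + F := by field_simp; ring
        linarith) t ht
    have he : Real.exp (-lam * (t - a)) ≤ 1 :=
      Real.exp_le_one_iff.2 (by nlinarith [ht.1])
    have he0 := Real.exp_pos (-lam * (t - a))
    have hFl : 0 ≤ F / lam := div_nonneg hF hlam.le
    have hb : (z a - F / lam) * Real.exp (-lam * (t - a)) ≤ |z a| := by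
      have h1 : (z a - F / lam) * Real.exp (-lam * (t - a)) ≤
          |z a| * Real.exp (-lam * (t - a)) :=
        mul_le_mul_of_nonneg_right (by linarith [le_abs_self (z a)]) he0.le
      nlinarith [abs_nonneg (z a)]
    linarith
  intro t ht
  rcases ht.1.eq_or_lt with rfl | hat
  · have hmid : (a + b) / 2 ∈ Ioo a b := ⟨by linarith [ht.2], by linarith [ht.2]⟩
    have : 0 ≤ F / lam := div_nonneg ((abs_nonneg _).trans (hf _ hmid)) hlam.le
    linarith
  have hF : 0 ≤ F := (abs_nonneg _).trans (hf t ⟨hat, ht.2⟩)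
  refine abs_le.2 ⟨?_, key y f hc hd (fun s hs => (le_abs_self _).trans (hf s hs)) hF t ht⟩
  have := key (fun s => -y s) (fun s => -f s) hc.neg
    (fun s hs => (hd s hs).neg.congr_deriv (by ring))
    (fun s hs => (neg_le_abs _).trans (hf s hs)) hF t ht
  simp only [abs_neg] at this
  linarith

theorem deriv_deriv_nonpos_of_isLocalMax {f : ℝ → ℝ} {x : ℝ} (hf : ContDiff ℝ 2 f)
    (h : IsLocalMax f x) : iteratedDeriv 2 f x ≤ 0 := by
  rw [iteratedDeriv_succ, iteratedDeriv_one]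
  by_contra! hpos
  have hmin := isLocalMin_of_deriv_deriv_pos hpos h.deriv_eq_zero hf.continuous.continuousAt
  -- A point that is both a local minimum and a local maximum is a point of local constancy.
  have hconst : f =ᶠ[𝓝 x] fun _ => f x := by
    filter_upwards [h, hmin] with y h1 h2 using le_antisymm h1 h2
  have h1 : deriv f =ᶠ[𝓝 x] fun _ => 0 := by
    have := hconst.deriv
    simpa using this
  have := h1.deriv_eq
  simp at this
  linarith

theorem deriv_deriv_nonneg_of_isLocalMin {f : ℝ → ℝ} {x : ℝ} (hf : ContDiff ℝ 2 f)
    (h : IsLocalMin f x) : 0 ≤ iteratedDeriv 2 f x := by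
  have := deriv_deriv_nonpos_of_isLocalMax hf.neg h.neg
  rw [iteratedDeriv_fun_neg] at this
  linarith

theorem deriv_nonneg_of_forall_le {f : ℝ → ℝ} {f' a b : ℝ} (hab : a < b) (hf : HasDerivAt f f' b)
    (h : ∀ t ∈ Icc a b, f t ≤ f b) : 0 ≤ f' := by
  have hs := (hasDerivAt_iff_tendsto_slope_left_right.1 hf).1
  refine ge_of_tendsto hs ?_
  filter_upwards [Ioo_mem_nhdsLT hab] with t ht
  rw [slope_def_field]
  exact div_nonneg_of_nonpos (by linarith [h t ⟨ht.1.le, ht.2.le⟩]) (by linarith [ht.2])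

/-- Abstract parabolic maximum principle: if `F ≤ 0` initially, and `∂ₜF ≤ κ F` at every
point where `F(t, ·)` attains a positive maximum, then `F ≤ 0`. -/
theorem nonpos_of_deriv_le_at_max {Z : Type*} [TopologicalSpace Z] {K : Set Z} (hK : IsCompact K)
    {F F' : ℝ → Z → ℝ} {T κ : ℝ}
    (hc : ContinuousOn (fun p : ℝ × Z => F p.1 p.2) (Icc 0 T ×ˢ K))
    (h0 : ∀ z ∈ K, F 0 z ≤ 0)
    (hd : ∀ t ∈ Ioc 0 T, ∀ z ∈ K, HasDerivAt (fun s => F s z) (F' t z) t)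
    (hmax : ∀ t ∈ Ioc 0 T, ∀ z ∈ K, 0 < F t z → (∀ w ∈ K, F t w ≤ F t z) →
      F' t z ≤ κ * F t z) :
    ∀ t ∈ Icc 0 T, ∀ z ∈ K, F t z ≤ 0 := by
  intro t₀ ht₀ z₀ hz₀
  by_contra! hpos
  -- The factor `exp (-(κ + 1) t)` makes the differential inequality strict.
  set G : ℝ × Z → ℝ := fun p => F p.1 p.2 * Real.exp (-(κ + 1) * p.1) with hG
  have hGc : ContinuousOn G (Icc 0 T ×ˢ K) := by
    refine hc.mul (Continuous.continuousOn ?_)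
    fun_prop
  obtain ⟨⟨t, z⟩, ⟨ht, hz⟩, hm⟩ := (isCompact_Icc.prod hK).exists_isMaxOn
    ⟨(t₀, z₀), ht₀, hz₀⟩ hGc
  have hm' : ∀ s ∈ Icc 0 T, ∀ w ∈ K, F s w * Real.exp (-(κ + 1) * s) ≤
      F t z * Real.exp (-(κ + 1) * t) := fun s hs w hw => hm (show (s, w) ∈ _ from ⟨hs, hw⟩)
  have hFpos : 0 < F t z := by
    have h1 := hm' t₀ ht₀ z₀ hz₀
    have h2 := mul_pos hpos (Real.exp_pos (-(κ + 1) * t₀))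
    exact pos_of_mul_pos_left (h2.trans_le h1) (Real.exp_pos _).le
  have htpos : 0 < t := by
    rcases ht.1.eq_or_lt with h | h
    · subst h
      exact absurd hFpos (not_lt.2 (h0 z hz))
    · exact h
  have hloc : ∀ w ∈ K, F t w ≤ F t z := fun w hw =>
    le_of_mul_le_mul_right (hm' t ht w hw) (Real.exp_pos _)
  have h1 := hmax t ⟨htpos, ht.2⟩ z hz hFpos hloc
  have hE : HasDerivAt (fun s => Real.exp (-(κ + 1) * s))
      (Real.exp (-(κ + 1) * t) * (-(κ + 1) * 1)) t :=
    ((hasDerivAt_id t).const_mul (-(κ + 1))).exp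
  have h2 := deriv_nonneg_of_forall_le htpos ((hd t ⟨htpos, ht.2⟩ z hz).mul hE)
    (fun s hs => hm' s ⟨hs.1, hs.2.trans ht.2⟩ z hz)
  have he := Real.exp_pos (-(κ + 1) * t)
  have h3 : F' t z * Real.exp (-(κ + 1) * t) ≤ κ * F t z * Real.exp (-(κ + 1) * t) :=
    mul_le_mul_of_nonneg_right h1 he.le
  have h4 := mul_pos hFpos he
  nlinarith

/-! ### Classical solutions on open sets of times -/

/-- `(φ, u)` solves the system classically at all times in `S`, with no initial condition.
For `S = (0, T)` these are the interior conditions of `IsSolution`; being local in time, they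
can be restricted, shifted and glued. -/
structure IsClassicalOn (S : Set ℝ) (φ u : ℝ → ℝ → ℝ) : Prop where
  periodic : ∀ t ∈ S, Function.Periodic (φ t) 1
  periodic_velocity : ∀ t ∈ S, Function.Periodic (u t) 1
  continuousOn : ContinuousOn (fun p : ℝ × ℝ => φ p.1 p.2) (S ×ˢ univ)
  differentiableAt_time : ∀ t ∈ S, ∀ x, DifferentiableAt ℝ (fun s => φ s x) t
  contDiff_space : ∀ t ∈ S, ContDiff ℝ 2 (φ t)
  continuousOn_deriv_time :
    ContinuousOn (fun p : ℝ × ℝ => deriv (fun s => φ s p.2) p.1) (S ×ˢ univ)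
  continuousOn_deriv_space :
    ContinuousOn (fun p : ℝ × ℝ => deriv (φ p.1) p.2) (S ×ˢ univ)
  continuousOn_deriv_space_two :
    ContinuousOn (fun p : ℝ × ℝ => iteratedDeriv 2 (φ p.1) p.2) (S ×ˢ univ)
  velocity_zero : ∀ t ∈ S, u t 0 = 0
  velocity_deriv : ∀ t ∈ S, ∀ x,
    HasDerivAt (u t) ((∫ y in (-1 / 2 : ℝ)..(1 / 2), φ t y ^ 2) - φ t x ^ 2) x
  equation : ∀ t ∈ S, ∀ x,
    deriv (fun s => φ s x) t + deriv (fun y => u t y * φ t y) x = iteratedDeriv 2 (φ t) x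

namespace IsSolution

variable {φ₀ : ℝ → ℝ} {T T' : ℝ} {φ u : ℝ → ℝ → ℝ}

theorem isClassicalOn (h : IsSolution φ₀ T φ u) : IsClassicalOn (Ioo 0 T) φ u where
  periodic t ht := h.periodic t (Ioo_subset_Ico_self ht)
  periodic_velocity := h.periodic_velocity
  continuousOn := h.continuousOn.mono (prod_mono Ioo_subset_Ico_self Subset.rfl)
  differentiableAt_time := h.differentiableAt_time
  contDiff_space := h.contDiff_space
  continuousOn_deriv_time := h.continuousOn_deriv_time
  continuousOn_deriv_space := h.continuousOn_deriv_space
  continuousOn_deriv_space_two := h.continuousOn_deriv_space_two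
  velocity_zero := h.velocity_zero
  velocity_deriv := h.velocity_deriv
  equation := h.equation

theorem of_isClassicalOn (hcl : IsClassicalOn (Ioo 0 T) φ u) (h0 : ∀ x, φ 0 x = φ₀ x)
    (hper : Function.Periodic (φ 0) 1)
    (hc : ContinuousOn (fun p : ℝ × ℝ => φ p.1 p.2) (Ico 0 T ×ˢ univ)) :
    IsSolution φ₀ T φ u where
  periodic t ht := by
    rcases ht.1.eq_or_lt with rfl | h
    · exact hper
    · exact hcl.periodic t ⟨h, ht.2⟩
  periodic_velocity := hcl.periodic_velocity
  continuousOn := hc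
  initial := h0
  differentiableAt_time := hcl.differentiableAt_time
  contDiff_space := hcl.contDiff_space
  continuousOn_deriv_time := hcl.continuousOn_deriv_time
  continuousOn_deriv_space := hcl.continuousOn_deriv_space
  continuousOn_deriv_space_two := hcl.continuousOn_deriv_space_two
  velocity_zero := hcl.velocity_zero
  velocity_deriv := hcl.velocity_deriv
  equation := hcl.equation

end IsSolution

namespace IsClassicalOn

variable {S S' : Set ℝ} {φ u ψ v : ℝ → ℝ → ℝ}

theorem mono (h : IsClassicalOn S φ u) (hS : S' ⊆ S) : IsClassicalOn S' φ u where
  periodic t ht := h.periodic t (hS ht)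
  periodic_velocity t ht := h.periodic_velocity t (hS ht)
  continuousOn := h.continuousOn.mono (prod_mono hS Subset.rfl)
  differentiableAt_time t ht := h.differentiableAt_time t (hS ht)
  contDiff_space t ht := h.contDiff_space t (hS ht)
  continuousOn_deriv_time := h.continuousOn_deriv_time.mono (prod_mono hS Subset.rfl)
  continuousOn_deriv_space := h.continuousOn_deriv_space.mono (prod_mono hS Subset.rfl)
  continuousOn_deriv_space_two := h.continuousOn_deriv_space_two.mono (prod_mono hS Subset.rfl)
  velocity_zero t ht := h.velocity_zero t (hS ht)
  velocity_deriv t ht := h.velocity_deriv t (hS ht)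
  equation t ht := h.equation t (hS ht)

theorem of_local (h : ∀ t ∈ S, ∃ S', IsOpen S' ∧ t ∈ S' ∧ IsClassicalOn S' φ u) :
    IsClassicalOn S φ u := by
  have key : ∀ g : ℝ × ℝ → ℝ,
      (∀ S', IsOpen S' → IsClassicalOn S' φ u → ContinuousOn g (S' ×ˢ univ)) →
      ContinuousOn g (S ×ˢ univ) := by
    intro g hg p hp
    obtain ⟨S', hS', ht, hcl⟩ := h p.1 hp.1
    exact ((hg S' hS' hcl).continuousAt
      ((hS'.prod isOpen_univ).mem_nhds ⟨ht, mem_univ _⟩)).continuousWithinAt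
  refine ⟨?_, ?_, key _ fun _ _ h => h.continuousOn, ?_, ?_,
    key _ fun _ _ h => h.continuousOn_deriv_time, key _ fun _ _ h => h.continuousOn_deriv_space,
    key _ fun _ _ h => h.continuousOn_deriv_space_two, ?_, ?_, ?_⟩ <;> intro t ht <;>
    obtain ⟨S', hS', hmem, hcl⟩ := h t ht
  · exact hcl.periodic t hmem
  · exact hcl.periodic_velocity t hmem
  · exact hcl.differentiableAt_time t hmem
  · exact hcl.contDiff_space t hmem
  · exact hcl.velocity_zero t hmem
  · exact hcl.velocity_deriv t hmem
  · exact hcl.equation t hmem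

theorem congr (h : IsClassicalOn S φ u) (hS : IsOpen S) (hφ : ∀ t ∈ S, ψ t = φ t)
    (hu : ∀ t ∈ S, v t = u t) : IsClassicalOn S ψ v := by
  have hev : ∀ t ∈ S, ∀ x, (fun s => ψ s x) =ᶠ[𝓝 t] fun s => φ s x := fun t ht x => by
    filter_upwards [hS.mem_nhds ht] with s hs
    rw [hφ s hs]
  refine ⟨?_, ?_, ?_, ?_, ?_, ?_, ?_, ?_, ?_, ?_, ?_⟩
  · intro t ht
    rw [hφ t ht]
    exact h.periodic t ht
  · intro t ht
    rw [hu t ht]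
    exact h.periodic_velocity t ht
  · exact h.continuousOn.congr fun p hp => by simp only [hφ p.1 hp.1]
  · exact fun t ht x => (h.differentiableAt_time t ht x).congr_of_eventuallyEq (hev t ht x)
  · intro t ht
    rw [hφ t ht]
    exact h.contDiff_space t ht
  · exact h.continuousOn_deriv_time.congr fun p hp => (hev p.1 hp.1 p.2).deriv_eq
  · exact h.continuousOn_deriv_space.congr fun p hp => by simp only [hφ p.1 hp.1]
  · exact h.continuousOn_deriv_space_two.congr fun p hp => by simp only [hφ p.1 hp.1]
  · intro t ht
    rw [hu t ht]
    exact h.velocity_zero t ht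
  · intro t ht x
    rw [hu t ht, hφ t ht]
    exact h.velocity_deriv t ht x
  · intro t ht x
    rw [(hev t ht x).deriv_eq, hu t ht, hφ t ht]
    exact h.equation t ht x

theorem comp_add (h : IsClassicalOn S φ u) (s : ℝ) :
    IsClassicalOn ((fun t => s + t) ⁻¹' S) (fun t => φ (s + t)) (fun t => u (s + t)) := by
  have key : ∀ g : ℝ × ℝ → ℝ, ContinuousOn g (S ×ˢ univ) →
      ContinuousOn (fun p : ℝ × ℝ => g (s + p.1, p.2)) (((fun t => s + t) ⁻¹' S) ×ˢ univ) :=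
    fun g hg => hg.comp (f := fun p : ℝ × ℝ => (s + p.1, p.2)) (by fun_prop)
      fun p hp => ⟨hp.1, mem_univ _⟩
  have hdt : ∀ t x, deriv (fun r => φ (s + r) x) t = deriv (fun r => φ r x) (s + t) :=
    fun t x => deriv_comp_const_add (f := fun r => φ r x) s t
  refine ⟨fun t ht => h.periodic _ ht, fun t ht => h.periodic_velocity _ ht,
    key _ h.continuousOn, fun t ht x => ?_, fun t ht => h.contDiff_space _ ht, ?_,
    key _ h.continuousOn_deriv_space, key _ h.continuousOn_deriv_space_two,
    fun t ht => h.velocity_zero _ ht, fun t ht => h.velocity_deriv _ ht, fun t ht x => ?_⟩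
  · exact (h.differentiableAt_time _ ht x).comp t (by fun_prop)
  · simp only [hdt]
    exact key _ h.continuousOn_deriv_time
  · rw [hdt]
    exact h.equation _ ht x

/-- The system is invariant under the reflection `x ↦ -x`, `u ↦ -u`. -/
theorem reflect (h : IsClassicalOn S φ u) :
    IsClassicalOn S (fun t x => φ t (-x)) (fun t x => -u t (-x)) := by
  have key : ∀ g : ℝ × ℝ → ℝ, ContinuousOn g (S ×ˢ univ) →
      ContinuousOn (fun p : ℝ × ℝ => g (p.1, -p.2)) (S ×ˢ univ) :=
    fun g hg => hg.comp (f := fun p : ℝ × ℝ => (p.1, -p.2)) (by fun_prop)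
      fun p hp => ⟨hp.1, mem_univ _⟩
  have h1 : ∀ t x, deriv (fun y => φ t (-y)) x = -deriv (φ t) (-x) := fun t x =>
    deriv_comp_neg (φ t) x
  have h2 : ∀ t x, iteratedDeriv 2 (fun y => φ t (-y)) x = iteratedDeriv 2 (φ t) (-x) := by
    intro t x
    rw [iteratedDeriv_comp_neg]
    simp
  have hint : ∀ t, (∫ y in (-1 / 2 : ℝ)..(1 / 2), φ t (-y) ^ 2) =
      ∫ y in (-1 / 2 : ℝ)..(1 / 2), φ t y ^ 2 := fun t => by
    rw [intervalIntegral.integral_comp_neg (fun y => φ t y ^ 2)]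
    norm_num
  refine ⟨fun t ht x => ?_, fun t ht x => ?_, key _ h.continuousOn,
    fun t ht x => h.differentiableAt_time t ht (-x),
    fun t ht => (h.contDiff_space t ht).comp contDiff_neg,
    key _ h.continuousOn_deriv_time, ?_, ?_, ?_, ?_, ?_⟩
  · rw [neg_add, ← sub_eq_add_neg]
    exact (h.periodic t ht).sub_eq (-x)
  · rw [neg_add, ← sub_eq_add_neg, (h.periodic_velocity t ht).sub_eq (-x)]
  · simp only [h1]
    exact (key _ h.continuousOn_deriv_space).neg
  · simp only [h2]
    exact key _ h.continuousOn_deriv_space_two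
  · intro t ht
    simp [h.velocity_zero t ht]
  · intro t ht x
    rw [hint]
    have := ((h.velocity_deriv t ht (-x)).comp x (hasDerivAt_neg x)).neg
    exact this.congr_deriv (by ring)
  · intro t ht x
    have hd : deriv (fun y => -u t (-y) * φ t (-y)) x =
        deriv (fun y => u t y * φ t y) (-x) := by
      have e : (fun y => -u t (-y) * φ t (-y)) = -fun y => (fun z => u t z * φ t z) (-y) := by
        funext y; simp
      rw [e, deriv.neg, deriv_comp_neg (fun z => u t z * φ t z), neg_neg]
    rw [h2, hd]
    exact h.equation t ht (-x)

variable {t : ℝ}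

theorem hasDerivAt_time (h : IsClassicalOn S φ u) (ht : t ∈ S) (x : ℝ) :
    HasDerivAt (fun s => φ s x) (deriv (fun s => φ s x) t) t :=
  (h.differentiableAt_time t ht x).hasDerivAt

theorem hasDerivAt_space (h : IsClassicalOn S φ u) (ht : t ∈ S) (x : ℝ) :
    HasDerivAt (φ t) (deriv (φ t) x) x :=
  ((h.contDiff_space t ht).differentiable (by norm_num) x).hasDerivAt

theorem hasDerivAt_deriv_space (h : IsClassicalOn S φ u) (ht : t ∈ S) (x : ℝ) :
    HasDerivAt (deriv (φ t)) (iteratedDeriv 2 (φ t) x) x := by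
  rw [iteratedDeriv_succ, iteratedDeriv_one]
  have : ContDiff ℝ 1 (deriv (φ t)) := by
    have h2 : ContDiff ℝ (1 + 1) (φ t) := by
      have := h.contDiff_space t ht
      norm_num
      exact this
    exact (contDiff_succ_iff_deriv.1 h2).2.2
  exact (this.differentiable (by norm_num) x).hasDerivAt

theorem continuous_density (h : IsClassicalOn S φ u) (ht : t ∈ S) : Continuous (φ t) :=
  (h.contDiff_space t ht).continuous

theorem continuous_deriv_space (h : IsClassicalOn S φ u) (ht : t ∈ S) :
    Continuous (deriv (φ t)) :=
  (h.contDiff_space t ht).continuous_deriv (by norm_num)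

theorem continuous_deriv_time (h : IsClassicalOn S φ u) (ht : t ∈ S) :
    Continuous fun x => deriv (fun s => φ s x) t :=
  h.continuousOn_deriv_time.comp_continuous (f := fun x : ℝ => (t, x)) (by fun_prop)
    fun _ => ⟨ht, mem_univ _⟩

theorem continuous_deriv_space_two (h : IsClassicalOn S φ u) (ht : t ∈ S) :
    Continuous (iteratedDeriv 2 (φ t)) :=
  h.continuousOn_deriv_space_two.comp_continuous (f := fun x : ℝ => (t, x)) (by fun_prop)
    fun _ => ⟨ht, mem_univ _⟩

theorem continuous_velocity (h : IsClassicalOn S φ u) (ht : t ∈ S) : Continuous (u t) :=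
  continuous_iff_continuousAt.2 fun x => (h.velocity_deriv t ht x).continuousAt

theorem hasDerivAt_transport (h : IsClassicalOn S φ u) (ht : t ∈ S) (x : ℝ) :
    HasDerivAt (fun y => u t y * φ t y)
      (((∫ y in (-1 / 2 : ℝ)..(1 / 2), φ t y ^ 2) - φ t x ^ 2) * φ t x
        + u t x * deriv (φ t) x) x :=
  (h.velocity_deriv t ht x).mul (h.hasDerivAt_space ht x)

/-- The equation in divergence form: `∂ₜφ` is the derivative of the flux `∂ₓφ - uφ`. -/
theorem hasDerivAt_flux (h : IsClassicalOn S φ u) (ht : t ∈ S) (x : ℝ) :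
    HasDerivAt (fun y => deriv (φ t) y - u t y * φ t y) (deriv (fun s => φ s x) t) x := by
  have h1 := h.hasDerivAt_transport ht x
  refine ((h.hasDerivAt_deriv_space ht x).sub h1).congr_deriv ?_
  rw [← h1.deriv, ← h.equation t ht x]
  ring

theorem deriv_time_eq (h : IsClassicalOn S φ u) (ht : t ∈ S) (x : ℝ) :
    deriv (fun s => φ s x) t = iteratedDeriv 2 (φ t) x -
      (((∫ y in (-1 / 2 : ℝ)..(1 / 2), φ t y ^ 2) - φ t x ^ 2) * φ t x
        + u t x * deriv (φ t) x) := by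
  rw [← (h.hasDerivAt_transport ht x).deriv, ← h.equation t ht x]
  ring

theorem integral_sq_mem_Icc (h : IsClassicalOn S φ u) (ht : t ∈ S) {K : ℝ}
    (hK : ∀ x, |φ t x| ≤ K) : (∫ y in (-1 / 2 : ℝ)..(1 / 2), φ t y ^ 2) ∈ Icc 0 (K ^ 2) := by
  constructor
  · exact intervalIntegral.integral_nonneg (by norm_num) fun x _ => sq_nonneg _
  · have := intervalIntegral.integral_mono_on (a := -1 / 2) (b := 1 / 2) (by norm_num)
      (((h.continuous_density ht).pow 2).intervalIntegrable _ _)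
      (intervalIntegrable_const (μ := volume) (c := K ^ 2)) (fun x _ => sq_le_sq' (abs_le.1 (hK x)).1
        (abs_le.1 (hK x)).2)
    refine this.trans_eq ?_
    rw [intervalIntegral.integral_const]
    norm_num

theorem abs_deriv_velocity_le (h : IsClassicalOn S φ u) (ht : t ∈ S) {K : ℝ}
    (hK : ∀ x, |φ t x| ≤ K) (x : ℝ) :
    |(∫ y in (-1 / 2 : ℝ)..(1 / 2), φ t y ^ 2) - φ t x ^ 2| ≤ K ^ 2 := by
  have h1 := h.integral_sq_mem_Icc ht hK
  have h2 : φ t x ^ 2 ≤ K ^ 2 := sq_le_sq' (abs_le.1 (hK x)).1 (abs_le.1 (hK x)).2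
  rw [abs_le]
  constructor <;> linarith [h1.1, h1.2, sq_nonneg (φ t x)]

theorem velocity_eq_integral (h : IsClassicalOn S φ u) (ht : t ∈ S) (x : ℝ) :
    u t x = ∫ y in (0 : ℝ)..x, ((∫ y in (-1 / 2 : ℝ)..(1 / 2), φ t y ^ 2) - φ t y ^ 2) := by
  rw [intervalIntegral.integral_eq_sub_of_hasDerivAt (fun y _ => h.velocity_deriv t ht y)
    ((continuous_const.sub ((h.continuous_density ht).pow 2)).intervalIntegrable _ _),
    h.velocity_zero t ht, sub_zero]

theorem abs_velocity_le (h : IsClassicalOn S φ u) (ht : t ∈ S) {K : ℝ}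
    (hK : ∀ x, |φ t x| ≤ K) {x : ℝ} (hx : |x| ≤ 1) : |u t x| ≤ K ^ 2 := by
  rw [h.velocity_eq_integral ht x]
  have := intervalIntegral.norm_integral_le_of_norm_le_const (a := 0) (b := x) (C := K ^ 2)
    (f := fun y => (∫ y in (-1 / 2 : ℝ)..(1 / 2), φ t y ^ 2) - φ t y ^ 2)
    (fun y _ => h.abs_deriv_velocity_le ht hK y)
  rw [sub_zero, Real.norm_eq_abs] at this
  nlinarith [sq_nonneg K]

theorem periodic_deriv (h : IsClassicalOn S φ u) (ht : t ∈ S) :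
    Function.Periodic (deriv (φ t)) 1 := by
  intro x
  rw [← deriv_comp_add_const]
  congr 1
  funext y
  exact h.periodic t ht y

end IsClassicalOn

namespace IsSolution

variable {φ₀ : ℝ → ℝ} {T T' : ℝ} {φ u ψ v : ℝ → ℝ → ℝ}

theorem mono (h : IsSolution φ₀ T φ u) (hT : T' ≤ T) : IsSolution φ₀ T' φ u where
  periodic t ht := h.periodic t (Ico_subset_Ico_right hT ht)
  periodic_velocity t ht := h.periodic_velocity t (Ioo_subset_Ioo_right hT ht)
  continuousOn := h.continuousOn.mono (prod_mono (Ico_subset_Ico_right hT) Subset.rfl)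
  initial := h.initial
  differentiableAt_time t ht := h.differentiableAt_time t (Ioo_subset_Ioo_right hT ht)
  contDiff_space t ht := h.contDiff_space t (Ioo_subset_Ioo_right hT ht)
  continuousOn_deriv_time :=
    h.continuousOn_deriv_time.mono (prod_mono (Ioo_subset_Ioo_right hT) Subset.rfl)
  continuousOn_deriv_space :=
    h.continuousOn_deriv_space.mono (prod_mono (Ioo_subset_Ioo_right hT) Subset.rfl)
  continuousOn_deriv_space_two :=
    h.continuousOn_deriv_space_two.mono (prod_mono (Ioo_subset_Ioo_right hT) Subset.rfl)
  velocity_zero t ht := h.velocity_zero t (Ioo_subset_Ioo_right hT ht)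
  velocity_deriv t ht := h.velocity_deriv t (Ioo_subset_Ioo_right hT ht)
  equation t ht := h.equation t (Ioo_subset_Ioo_right hT ht)

/-- A solution restarted at the time `s`. -/
theorem comp_add (h : IsSolution φ₀ T φ u) {s : ℝ} (hs : 0 ≤ s) (hsT : s < T) :
    IsSolution (φ s) (T - s) (fun t => φ (s + t)) (fun t => u (s + t)) := by
  refine of_isClassicalOn ((h.isClassicalOn.comp_add s).mono fun t ht => ?_) (fun x => by simp)
    (by simpa using h.periodic s ⟨hs, hsT⟩) ?_
  · exact ⟨by linarith [ht.1], by linarith [ht.2]⟩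
  · exact h.continuousOn.comp (f := fun p : ℝ × ℝ => (s + p.1, p.2)) (by fun_prop)
      fun p hp => ⟨⟨by linarith [hp.1.1], by linarith [hp.1.2]⟩, mem_univ _⟩

theorem continuous_density (h : IsSolution φ₀ T φ u) {t : ℝ} (ht : t ∈ Ico 0 T) :
    Continuous (φ t) :=
  h.continuousOn.comp_continuous (f := fun x : ℝ => (t, x)) (by fun_prop)
    fun _ => ⟨ht, mem_univ _⟩

theorem exists_bound (h : IsSolution φ₀ T φ u) {T₁ : ℝ} (hT₁ : T₁ < T) :
    ∃ K, 0 ≤ K ∧ ∀ t ∈ Icc 0 T₁, ∀ x, |φ t x| ≤ K := by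
  have hsub : Icc 0 T₁ ⊆ Ico 0 T := fun t ht => ⟨ht.1, ht.2.trans_lt hT₁⟩
  obtain ⟨K, hK⟩ := ((isCompact_Icc (a := (0 : ℝ)) (b := T₁)).prod
    (isCompact_Icc (a := (0 : ℝ)) (b := 1))).exists_bound_of_continuousOn
      (h.continuousOn.mono (prod_mono hsub (subset_univ _)))
  refine ⟨max K 0, le_max_right _ _, fun t ht x => ?_⟩
  obtain ⟨y, hy, hxy⟩ := (h.periodic t (hsub ht)).exists_mem_Ico₀ one_pos x
  rw [hxy]
  exact (hK (t, y) ⟨ht, hy.1, hy.2.le⟩).trans (le_max_left _ _)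

end IsSolution

/-! ### Uniqueness -/

/-- The Cauchy-Schwarz inequality against the constant function `1`. -/
theorem sq_integral_le_mul_integral_sq {f : ℝ → ℝ} (hf : Continuous f) {a b : ℝ} (hab : a ≤ b) :
    (∫ x in a..b, f x) ^ 2 ≤ (b - a) * ∫ x in a..b, f x ^ 2 := by
  rcases hab.eq_or_lt with rfl | hab'
  · simp
  set m := ∫ x in a..b, f x with hm
  have h : (∫ x in a..b, ((b - a) * f x - m) ^ 2) =
      (b - a) * ((b - a) * (∫ x in a..b, f x ^ 2) - m ^ 2) := by
    have e : ∀ x, ((b - a) * f x - m) ^ 2 =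
        (b - a) ^ 2 * f x ^ 2 - (2 * (b - a) * m * f x - m ^ 2) := fun x => by ring
    simp only [e]
    rw [intervalIntegral.integral_sub (Continuous.intervalIntegrable (by fun_prop) _ _)
      (Continuous.intervalIntegrable (by fun_prop) _ _),
      intervalIntegral.integral_sub (Continuous.intervalIntegrable (by fun_prop) _ _)
      intervalIntegrable_const, intervalIntegral.integral_const_mul,
      intervalIntegral.integral_const_mul, ← hm, intervalIntegral.integral_const, smul_eq_mul]
    ring
  have h0 : 0 ≤ ∫ x in a..b, ((b - a) * f x - m) ^ 2 :=
    intervalIntegral.integral_nonneg hab fun x _ => sq_nonneg _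
  rw [h] at h0
  linarith [nonneg_of_mul_nonneg_right h0 (sub_pos.2 hab')]

theorem eq_of_integral_sub_sq_eq_zero {f g : ℝ → ℝ} (hf : Continuous f) (hg : Continuous g)
    (hfp : Function.Periodic f 1) (hgp : Function.Periodic g 1)
    (h : ∫ x in (-1 / 2 : ℝ)..(1 / 2), (f x - g x) ^ 2 ≤ 0) : f = g := by
  have hon : ∀ x ∈ Icc (-1 / 2 : ℝ) (1 / 2), (f x - g x) ^ 2 = 0 := by
    by_contra! hne
    obtain ⟨x, hx, hne⟩ := hne
    have := intervalIntegral.integral_pos (a := -1 / 2) (b := 1 / 2) (by norm_num)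
      (f := fun x => (f x - g x) ^ 2) (by fun_prop) (fun y _ => sq_nonneg _)
      ⟨x, hx, lt_of_le_of_ne (sq_nonneg _) hne.symm⟩
    linarith
  funext x
  obtain ⟨y, hy, hxy⟩ := (hfp.sub hgp).exists_mem_Ico one_pos x (-1 / 2)
  have := hon y ⟨hy.1, by linarith [hy.2]⟩
  have h2 : f x - g x = 0 := by
    rw [← Pi.sub_apply, hxy, Pi.sub_apply]
    exact pow_eq_zero_iff (by norm_num) |>.1 this
  linarith

namespace IsClassicalOn

variable {S : Set ℝ} {φ u ψ v : ℝ → ℝ → ℝ} {t : ℝ}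

theorem velocity_eq_of_density_eq (h₁ : IsClassicalOn S φ u) (h₂ : IsClassicalOn S ψ v)
    (ht : t ∈ S) (h : φ t = ψ t) : u t = v t := by
  funext x
  rw [h₁.velocity_eq_integral ht, h₂.velocity_eq_integral ht, h]

theorem abs_velocity_sub_le (h₁ : IsClassicalOn S φ u) (h₂ : IsClassicalOn S ψ v)
    (ht : t ∈ S) {K : ℝ} (hK₁ : ∀ x, |φ t x| ≤ K) (hK₂ : ∀ x, |ψ t x| ≤ K) {x : ℝ}
    (hx : x ∈ Icc (-1 / 2 : ℝ) (1 / 2)) :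
    |u t x - v t x| ≤ 4 * K * ∫ y in (-1 / 2 : ℝ)..(1 / 2), |φ t y - ψ t y| := by
  have hK : 0 ≤ K := (abs_nonneg _).trans (hK₁ 0)
  have c₁ := h₁.continuous_density ht
  have c₂ := h₂.continuous_density ht
  set D := ∫ y in (-1 / 2 : ℝ)..(1 / 2), |φ t y - ψ t y| with hD
  have hpt : ∀ y, |φ t y ^ 2 - ψ t y ^ 2| ≤ 2 * K * |φ t y - ψ t y| := by
    intro y
    have e : φ t y ^ 2 - ψ t y ^ 2 = (φ t y + ψ t y) * (φ t y - ψ t y) := by ring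
    rw [e, abs_mul]
    refine mul_le_mul_of_nonneg_right ((abs_add_le _ _).trans ?_) (abs_nonneg _)
    linarith [hK₁ y, hK₂ y]
  have hQ : |(∫ y in (-1 / 2 : ℝ)..(1 / 2), φ t y ^ 2) -
      ∫ y in (-1 / 2 : ℝ)..(1 / 2), ψ t y ^ 2| ≤ 2 * K * D := by
    rw [← intervalIntegral.integral_sub (Continuous.intervalIntegrable (by fun_prop) _ _)
      (Continuous.intervalIntegrable (by fun_prop) _ _), hD, ← intervalIntegral.integral_const_mul]
    refine (intervalIntegral.abs_integral_le_integral_abs (by norm_num)).trans ?_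
    exact intervalIntegral.integral_mono_on (by norm_num)
      (Continuous.intervalIntegrable (by fun_prop) _ _)
      (Continuous.intervalIntegrable (by fun_prop) _ _) fun y _ => hpt y
  set Q₁ := ∫ y in (-1 / 2 : ℝ)..(1 / 2), φ t y ^ 2
  set Q₂ := ∫ y in (-1 / 2 : ℝ)..(1 / 2), ψ t y ^ 2
  have hsub : u t x - v t x = ∫ y in (0 : ℝ)..x, ((Q₁ - Q₂) - (φ t y ^ 2 - ψ t y ^ 2)) := by
    rw [h₁.velocity_eq_integral ht, h₂.velocity_eq_integral ht,
      ← intervalIntegral.integral_sub (Continuous.intervalIntegrable (by fun_prop) _ _)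
      (Continuous.intervalIntegrable (by fun_prop) _ _)]
    congr 1
    funext y
    ring
  have hb : |u t x - v t x| ≤
      |∫ y in (0 : ℝ)..x, (2 * K * D + 2 * K * |φ t y - ψ t y|)| := by
    have hi : IntervalIntegrable (fun y => 2 * K * D + 2 * K * |φ t y - ψ t y|) volume 0 x :=
      Continuous.intervalIntegrable (by fun_prop) _ _
    rw [hsub]
    exact intervalIntegral.norm_integral_le_abs_of_norm_le
      (f := fun y => (Q₁ - Q₂) - (φ t y ^ 2 - ψ t y ^ 2))
      (Eventually.of_forall fun y => (norm_sub_le _ _).trans (add_le_add hQ (hpt y))) hi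
  have hD0 : 0 ≤ D := intervalIntegral.integral_nonneg (by norm_num) fun _ _ => abs_nonneg _
  have hmono : |∫ y in (0 : ℝ)..x, (2 * K * D + 2 * K * |φ t y - ψ t y|)| ≤
      ∫ y in (-1 / 2 : ℝ)..(1 / 2), (2 * K * D + 2 * K * |φ t y - ψ t y|) := by
    refine (intervalIntegral.abs_integral_mono_interval (c := -1 / 2) (d := 1 / 2)
      ?_ (Eventually.of_forall fun y => ?_)
      (Continuous.intervalIntegrable (by fun_prop) _ _)).trans_eq (abs_of_nonneg ?_)
    · intro y hy
      rw [uIoc_of_le (by norm_num)]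
      rcases mem_uIoc.1 hy with hy | hy
      · exact ⟨by linarith [hy.1], by linarith [hy.2, hx.2]⟩
      · exact ⟨by linarith [hy.1, hx.1], by linarith [hy.2]⟩
    · simp only [Pi.zero_apply]; positivity
    · exact intervalIntegral.integral_nonneg (by norm_num) fun y _ => by positivity
  refine hb.trans (hmono.trans_eq ?_)
  rw [intervalIntegral.integral_add intervalIntegrable_const
    (Continuous.intervalIntegrable (by fun_prop) _ _), intervalIntegral.integral_const,
    intervalIntegral.integral_const_mul, ← hD]
  norm_num
  ring

/-- The energy estimate for the difference of two solutions: the viscous term absorbs the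
derivative falling on the difference of the transport terms. -/
theorem integral_sub_mul_deriv_le (h₁ : IsClassicalOn S φ u) (h₂ : IsClassicalOn S ψ v)
    (ht : t ∈ S) {K : ℝ} (hK₁ : ∀ x, |φ t x| ≤ K) (hK₂ : ∀ x, |ψ t x| ≤ K) :
    (∫ x in (-1 / 2 : ℝ)..(1 / 2), 2 * (φ t x - ψ t x) *
      (deriv (fun s => φ s x) t - deriv (fun s => ψ s x) t)) ≤
    17 * K ^ 4 * ∫ x in (-1 / 2 : ℝ)..(1 / 2), (φ t x - ψ t x) ^ 2 := by
  have hK : 0 ≤ K := (abs_nonneg _).trans (hK₁ 0)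
  have c₁ := h₁.continuous_density ht
  have c₂ := h₂.continuous_density ht
  have cd₁ := h₁.continuous_deriv_space ht
  have cd₂ := h₂.continuous_deriv_space ht
  have ct₁ := h₁.continuous_deriv_time ht
  have ct₂ := h₂.continuous_deriv_time ht
  have cu := h₁.continuous_velocity ht
  have cv := h₂.continuous_velocity ht
  set D := ∫ y in (-1 / 2 : ℝ)..(1 / 2), |φ t y - ψ t y|
  set E := ∫ x in (-1 / 2 : ℝ)..(1 / 2), (φ t x - ψ t x) ^ 2 with hE
  have hDE : D ^ 2 ≤ E := by
    have := sq_integral_le_mul_integral_sq (f := fun y => |φ t y - ψ t y|) (by fun_prop)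
      (a := -1 / 2) (b := 1 / 2) (by norm_num)
    simp only [sq_abs] at this
    refine this.trans_eq ?_
    rw [hE]
    norm_num
  have hparts := intervalIntegral.integral_mul_deriv_eq_deriv_mul (a := -1 / 2) (b := 1 / 2)
    (u := fun x => 2 * (φ t x - ψ t x)) (u' := fun x => 2 * (deriv (φ t) x - deriv (ψ t) x))
    (v := fun x => (deriv (φ t) x - u t x * φ t x) - (deriv (ψ t) x - v t x * ψ t x))
    (v' := fun x => deriv (fun s => φ s x) t - deriv (fun s => ψ s x) t)
    (fun x _ => ((h₁.hasDerivAt_space ht x).sub (h₂.hasDerivAt_space ht x)).const_mul 2)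
    (fun x _ => (h₁.hasDerivAt_flux ht x).sub (h₂.hasDerivAt_flux ht x))
    (Continuous.intervalIntegrable (by fun_prop) _ _)
    (Continuous.intervalIntegrable (by fun_prop) _ _)
  have per : ∀ f : ℝ → ℝ, Function.Periodic f 1 → f (1 / 2) = f (-1 / 2) := fun f hf => by
    have := hf (-1 / 2)
    rw [← this]
    norm_num
  rw [hparts, per _ (h₁.periodic t ht), per _ (h₂.periodic t ht),
    per _ (h₁.periodic_velocity t ht), per _ (h₂.periodic_velocity t ht),
    per _ (h₁.periodic_deriv ht), per _ (h₂.periodic_deriv ht), sub_self, zero_sub,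
    ← intervalIntegral.integral_neg]
  have hpt : ∀ x ∈ Icc (-1 / 2 : ℝ) (1 / 2),
      -(2 * (deriv (φ t) x - deriv (ψ t) x) *
        ((deriv (φ t) x - u t x * φ t x) - (deriv (ψ t) x - v t x * ψ t x))) ≤
      K ^ 4 * (φ t x - ψ t x) ^ 2 + 16 * K ^ 4 * E := by
    intro x hx
    have hu := h₁.abs_velocity_le ht hK₁ (x := x) (abs_le.2 ⟨by linarith [hx.1], by linarith [hx.2]⟩)
    have huv := h₁.abs_velocity_sub_le h₂ ht hK₁ hK₂ hx
    have hψ := hK₂ x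
    set p := deriv (φ t) x - deriv (ψ t) x with hp
    set w := φ t x - ψ t x with hw
    have e : (deriv (φ t) x - u t x * φ t x) - (deriv (ψ t) x - v t x * ψ t x) =
        p - (u t x * w + (u t x - v t x) * ψ t x) := by rw [hp, hw]; ring
    rw [e]
    have h1 : (u t x * w) ^ 2 ≤ K ^ 4 * w ^ 2 := by
      rw [mul_pow]
      refine mul_le_mul_of_nonneg_right ?_ (sq_nonneg _)
      rw [← sq_abs]
      calc |u t x| ^ 2 ≤ (K ^ 2) ^ 2 := pow_le_pow_left₀ (abs_nonneg _) hu 2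
        _ = K ^ 4 := by ring
    have h2 : ((u t x - v t x) * ψ t x) ^ 2 ≤ 16 * K ^ 4 * E := by
      have : |(u t x - v t x) * ψ t x| ≤ 4 * K * D * K := by
        rw [abs_mul]
        exact mul_le_mul huv hψ (abs_nonneg _) ((abs_nonneg _).trans huv)
      rw [← sq_abs]
      calc |(u t x - v t x) * ψ t x| ^ 2 ≤ (4 * K * D * K) ^ 2 :=
            pow_le_pow_left₀ (abs_nonneg _) this 2
        _ = 16 * K ^ 4 * D ^ 2 := by ring
        _ ≤ 16 * K ^ 4 * E := mul_le_mul_of_nonneg_left hDE (by positivity)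
    nlinarith [sq_nonneg (2 * p - (u t x * w + (u t x - v t x) * ψ t x)),
      sq_nonneg (u t x * w - (u t x - v t x) * ψ t x)]
  calc _ ≤ ∫ x in (-1 / 2 : ℝ)..(1 / 2), (K ^ 4 * (φ t x - ψ t x) ^ 2 + 16 * K ^ 4 * E) :=
        intervalIntegral.integral_mono_on (by norm_num)
          (Continuous.intervalIntegrable (by fun_prop) _ _)
          (Continuous.intervalIntegrable (by fun_prop) _ _) hpt
    _ = 17 * K ^ 4 * E := by
        rw [intervalIntegral.integral_add (Continuous.intervalIntegrable (by fun_prop) _ _)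
          intervalIntegrable_const, intervalIntegral.integral_const_mul, ← hE,
          intervalIntegral.integral_const]
        norm_num
        ring

end IsClassicalOn

namespace IsSolution

variable {φ₀ : ℝ → ℝ} {T : ℝ} {φ u ψ v : ℝ → ℝ → ℝ}

/-- Uniqueness of the density. Only continuity at `t = 0` is available, which is why the
estimate is made in `L²`, where no spatial derivative of either solution is needed near
`t = 0`. -/
theorem density_unique (h₁ : IsSolution φ₀ T φ u) (h₂ : IsSolution φ₀ T ψ v) :
    ∀ t ∈ Ico 0 T, φ t = ψ t := by
  intro t ht
  obtain ⟨T₁, h1, h2⟩ := exists_between ht.2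
  obtain ⟨K₁, hK₁0, hK₁⟩ := h₁.exists_bound h2
  obtain ⟨K₂, hK₂0, hK₂⟩ := h₂.exists_bound h2
  have hIco : Ico 0 T₁ ⊆ Ico 0 T := Ico_subset_Ico_right h2.le
  have hIoo : Ioo 0 T₁ ⊆ Ioo 0 T := Ioo_subset_Ioo_right h2.le
  have k₁ := h₁.isClassicalOn
  have k₂ := h₂.isClassicalOn
  have hE := le_mul_exp_of_deriv_le (a := 0) (b := T₁) (κ := 17 * (max K₁ K₂) ^ 4)
    (g := fun s => ∫ x in (-1 / 2 : ℝ)..(1 / 2), (φ s x - ψ s x) ^ 2)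
    (g' := fun s => ∫ x in (-1 / 2 : ℝ)..(1 / 2), 2 * (φ s x - ψ s x) *
      (deriv (fun r => φ r x) s - deriv (fun r => ψ r x) s)) ?_ ?_ ?_ t ⟨ht.1, h1⟩
  · refine eq_of_integral_sub_sq_eq_zero (h₁.continuous_density ht) (h₂.continuous_density ht)
      (h₁.periodic t ht) (h₂.periodic t ht) (hE.trans_eq ?_)
    simp [h₁.initial, h₂.initial]
  · refine (continuousOn_integral_of_continuousOn (F := fun s x => (φ s x - ψ s x) ^ 2)
      ((h₁.continuousOn.sub h₂.continuousOn).pow 2) _ _).mono hIco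
  · intro s hs
    refine hasDerivAt_integral_of_continuousOn_deriv (S := Ioo 0 T)
      (F := fun s x => (φ s x - ψ s x) ^ 2)
      (F' := fun s x => 2 * (φ s x - ψ s x) *
        (deriv (fun r => φ r x) s - deriv (fun r => ψ r x) s)) isOpen_Ioo
      (fun r hr => ((k₁.continuous_density hr).sub (k₂.continuous_density hr)).pow 2)
      (fun r hr x => ?_) ?_ _ _ (hIoo hs)
    · have := ((k₁.hasDerivAt_time hr x).sub (k₂.hasDerivAt_time hr x)).pow 2
      exact this.congr_deriv (by simp)
    · exact ((continuousOn_const.mul (k₁.continuousOn.sub k₂.continuousOn))).mul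
        (k₁.continuousOn_deriv_time.sub k₂.continuousOn_deriv_time)
  · intro s hs
    have hs' : s ∈ Icc 0 T₁ := Ioo_subset_Icc_self hs
    exact k₁.integral_sub_mul_deriv_le k₂ (hIoo hs)
      (fun x => (hK₁ s hs' x).trans (le_max_left _ _))
      (fun x => (hK₂ s hs' x).trans (le_max_right _ _))

theorem velocity_unique (h₁ : IsSolution φ₀ T φ u) (h₂ : IsSolution φ₀ T ψ v) :
    ∀ t ∈ Ioo 0 T, u t = v t := fun t ht =>
  h₁.isClassicalOn.velocity_eq_of_density_eq h₂.isClassicalOn ht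
    (h₁.density_unique h₂ t (Ioo_subset_Ico_self ht))

/-- Even initial data produce even densities: the reflected solution has the same data. -/
theorem even (h : IsSolution φ₀ T φ u) (h0 : ∀ x, φ₀ (-x) = φ₀ x) :
    ∀ t ∈ Ico 0 T, ∀ x, φ t (-x) = φ t x := by
  intro t ht x
  have h' : IsSolution φ₀ T (fun t x => φ t (-x)) (fun t x => -u t (-x)) := by
    refine of_isClassicalOn h.isClassicalOn.reflect (fun x => by rw [h.initial, h0]) ?_ ?_
    · intro y
      have := h.periodic 0 ⟨le_rfl, ht.1.trans_lt ht.2⟩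
      change φ 0 (-(y + 1)) = φ 0 (-y)
      rw [neg_add, ← sub_eq_add_neg]
      exact this.sub_eq (-y)
    · exact h.continuousOn.comp (f := fun p : ℝ × ℝ => (p.1, -p.2)) (by fun_prop)
        fun p hp => ⟨hp.1, mem_univ _⟩
  exact congrFun (h'.density_unique h t ht) x

end IsSolution

/-! ### Sign, symmetry and monotonicity -/

namespace IsSolution

variable {φ₀ : ℝ → ℝ} {T : ℝ} {φ u : ℝ → ℝ → ℝ}

theorem nonneg (h : IsSolution φ₀ T φ u) (h0 : ∀ x, 0 ≤ φ₀ x) :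
    ∀ t ∈ Ico 0 T, ∀ x, 0 ≤ φ t x := by
  intro t ht x
  obtain ⟨K, -, hK⟩ := h.exists_bound ht.2
  have hcl := h.isClassicalOn
  have hsub : Icc 0 t ⊆ Ico 0 T := fun s hs => ⟨hs.1, hs.2.trans_lt ht.2⟩
  have hsub' : Ioc 0 t ⊆ Ioo 0 T := fun s hs => ⟨hs.1, hs.2.trans_lt ht.2⟩
  have key := nonpos_of_deriv_le_at_max (isCompact_Icc (a := (0 : ℝ)) (b := 1)) (T := t)
    (F := fun s y => -φ s y) (F' := fun s y => -deriv (fun r => φ r y) s) (κ := K ^ 2)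
    (h.continuousOn.neg.mono (prod_mono hsub (subset_univ _)))
    (fun z _ => by simpa [h.initial] using h0 z)
    (fun s hs y _ => (hcl.hasDerivAt_time (hsub' hs) y).neg) ?_ t ⟨ht.1, le_rfl⟩
  · obtain ⟨y, hy, hxy⟩ := (h.periodic t ht).exists_mem_Ico₀ one_pos x
    rw [hxy]
    linarith [key y ⟨hy.1, hy.2.le⟩]
  · intro s hs y hy hpos hmax
    have hs' := hsub' hs
    have hmin : IsLocalMin (φ s) y := by
      refine Eventually.of_forall fun z => ?_
      obtain ⟨w, hw, hzw⟩ := (hcl.periodic s hs').exists_mem_Ico₀ one_pos z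
      rw [hzw]
      linarith [hmax w ⟨hw.1, hw.2.le⟩]
    have h2 := deriv_deriv_nonneg_of_isLocalMin (hcl.contDiff_space s hs') hmin
    have hQ := hcl.abs_deriv_velocity_le hs' (hK s (Ioc_subset_Icc_self hs)) y
    rw [hcl.deriv_time_eq hs' y, hmin.deriv_eq_zero]
    have h3 := (abs_le.1 hQ).1
    nlinarith

/-- Monotonicity on the half period is preserved. The maximum principle is applied to
`φ(t, x) - φ(t, y)` on the triangle `0 ≤ y ≤ x ≤ 1/2`, so that the equation never has to be
differentiated; by symmetry boundary maxima are interior ones. -/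
theorem antitoneOn (h : IsSolution φ₀ T φ u) (heven : ∀ x, φ₀ (-x) = φ₀ x)
    (hanti : AntitoneOn φ₀ (Icc 0 (1 / 2))) :
    ∀ t ∈ Ico 0 T, AntitoneOn (φ t) (Icc 0 (1 / 2)) := by
  intro t ht y hy x hx hyx
  obtain ⟨K, hK0, hK⟩ := h.exists_bound ht.2
  have hcl := h.isClassicalOn
  have hsub : Icc 0 t ⊆ Ico 0 T := fun s hs => ⟨hs.1, hs.2.trans_lt ht.2⟩
  have hsub' : Ioc 0 t ⊆ Ioo 0 T := fun s hs => ⟨hs.1, hs.2.trans_lt ht.2⟩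
  have hcpt : IsCompact {p : ℝ × ℝ | 0 ≤ p.2 ∧ p.2 ≤ p.1 ∧ p.1 ≤ 1 / 2} := by
    refine (isCompact_Icc.prod isCompact_Icc).of_isClosed_subset (s := Icc (0 : ℝ) (1 / 2) ×ˢ
      Icc (0 : ℝ) (1 / 2)) ?_ ?_
    · exact (isClosed_le continuous_const continuous_snd).inter
        ((isClosed_le continuous_snd continuous_fst).inter
          (isClosed_le continuous_fst continuous_const))
    · rintro p ⟨h1, h2, h3⟩
      exact ⟨⟨h1.trans h2, h3⟩, ⟨h1, h2.trans h3⟩⟩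
  have hcont : ContinuousOn (fun q : ℝ × ℝ × ℝ => φ q.1 q.2.1 - φ q.1 q.2.2)
      (Icc 0 t ×ˢ {p : ℝ × ℝ | 0 ≤ p.2 ∧ p.2 ≤ p.1 ∧ p.1 ≤ 1 / 2}) := by
    refine ContinuousOn.sub ?_ ?_
    · exact h.continuousOn.comp (f := fun q : ℝ × ℝ × ℝ => (q.1, q.2.1)) (by fun_prop)
        fun q hq => ⟨hsub hq.1, mem_univ _⟩
    · exact h.continuousOn.comp (f := fun q : ℝ × ℝ × ℝ => (q.1, q.2.2)) (by fun_prop)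
        fun q hq => ⟨hsub hq.1, mem_univ _⟩
  have key := nonpos_of_deriv_le_at_max hcpt (T := t)
    (F := fun s p => φ s p.1 - φ s p.2)
    (F' := fun s p => deriv (fun r => φ r p.1) s - deriv (fun r => φ r p.2) s) (κ := 3 * K ^ 2)
    hcont ?_
    (fun s hs p _ => (hcl.hasDerivAt_time (hsub' hs) p.1).sub
      (hcl.hasDerivAt_time (hsub' hs) p.2)) ?_ t ⟨ht.1, le_rfl⟩ (x, y) ⟨hy.1, hyx, hx.2⟩
  · linarith
  · rintro ⟨x, y⟩ ⟨h1, h2, h3⟩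
    simp only [h.initial, sub_nonpos]
    exact hanti ⟨h1, h2.trans h3⟩ ⟨h1.trans h2, h3⟩ h2
  · rintro s hs ⟨x, y⟩ ⟨h1, h2, h3⟩ hpos hmax
    simp only at h1 h2 h3 hpos hmax ⊢
    have hs' := hsub' hs
    have hev := h.even heven s (Ioo_subset_Ico_self hs')
    have hrefl : ∀ z, φ s (1 - z) = φ s z := fun z => by
      rw [← hev z, ← hcl.periodic s hs' (-z)]
      ring_nf
    have hyx : y < x := lt_of_le_of_ne h2 (by rintro rfl; simp at hpos)
    have hmx : IsLocalMax (φ s) x := by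
      have e1 : ∀ᶠ z in 𝓝 x, y < z := lt_mem_nhds hyx
      have e2 : ∀ᶠ z in 𝓝 x, z < 1 - y := gt_mem_nhds (by linarith)
      filter_upwards [e1, e2] with z hz1 hz2
      rcases le_total z (1 / 2) with hz | hz
      · linarith [hmax (z, y) ⟨h1, hz1.le, hz⟩]
      · have := hmax (1 - z, y) ⟨h1, by simp only; linarith, by simp only; linarith⟩
        simp only [hrefl] at this
        linarith
    have hmn : IsLocalMin (φ s) y := by
      have e1 : ∀ᶠ z in 𝓝 y, z < x := gt_mem_nhds hyx
      have e2 : ∀ᶠ z in 𝓝 y, -x < z := lt_mem_nhds (by linarith)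
      filter_upwards [e1, e2] with z hz1 hz2
      rcases le_total 0 z with hz | hz
      · linarith [hmax (x, z) ⟨hz, hz1.le, h3⟩]
      · have := hmax (x, -z) ⟨by simp only; linarith, by simp only; linarith, h3⟩
        simp only [hev] at this
        linarith
    have d1 := deriv_deriv_nonpos_of_isLocalMax (hcl.contDiff_space s hs') hmx
    have d2 := deriv_deriv_nonneg_of_isLocalMin (hcl.contDiff_space s hs') hmn
    have hKs := hK s (Ioc_subset_Icc_self hs)
    rw [hcl.deriv_time_eq hs' x, hcl.deriv_time_eq hs' y, hmx.deriv_eq_zero, hmn.deriv_eq_zero]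
    have hQ := (hcl.integral_sq_mem_Icc hs' hKs).1
    set Q := ∫ z in (-1 / 2 : ℝ)..(1 / 2), φ s z ^ 2
    have ha : φ s x ^ 2 ≤ K ^ 2 := sq_le_sq' (abs_le.1 (hKs x)).1 (abs_le.1 (hKs x)).2
    have hb : φ s y ^ 2 ≤ K ^ 2 := sq_le_sq' (abs_le.1 (hKs y)).1 (abs_le.1 (hKs y)).2
    set a := φ s x
    set b := φ s y
    have hle : a ^ 2 + a * b + b ^ 2 - Q ≤ 3 * K ^ 2 := by nlinarith [sq_nonneg (a - b)]
    have := mul_le_mul_of_nonneg_right hle hpos.le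
    nlinarith

end IsSolution

/-! ### Decay of the second moment -/

theorem deriv_zero_of_even {f : ℝ → ℝ} (heven : ∀ x, f (-x) = f x) : deriv f 0 = 0 := by
  have h1 := deriv_comp_neg f 0
  simp only [heven, neg_zero] at h1
  linarith

theorem deriv_half_of_even {f : ℝ → ℝ} (heven : ∀ x, f (-x) = f x) (hper : Function.Periodic f 1) :
    deriv f (1 / 2) = 0 := by
  have h1 := deriv_comp_neg f (1 / 2)
  simp only [heven] at h1
  have h2 : deriv f (-(1 / 2) + 1) = deriv f (-(1 / 2)) := by
    rw [← deriv_comp_add_const]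
    congr 1
    funext y
    exact hper y
  norm_num at h1 h2
  rw [← h2] at h1
  norm_num
  linarith

namespace IsClassicalOn

variable {S : Set ℝ} {φ u : ℝ → ℝ → ℝ} {t : ℝ}

theorem velocity_half_of_even (h : IsClassicalOn S φ u) (ht : t ∈ S)
    (heven : ∀ x, φ t (-x) = φ t x) : u t (1 / 2) = 0 := by
  have hodd : u t (-(1 / 2)) = -u t (1 / 2) := by
    rw [h.velocity_eq_integral ht, h.velocity_eq_integral ht, ← intervalIntegral.integral_symm]
    have := intervalIntegral.integral_comp_neg (a := 0) (b := 1 / 2)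
      (fun y => (∫ y in (-1 / 2 : ℝ)..(1 / 2), φ t y ^ 2) - φ t y ^ 2)
    simp only [heven, neg_zero] at this
    rw [intervalIntegral.integral_symm, ← this, ← intervalIntegral.integral_symm]
  have h2 := h.periodic_velocity t ht (-(1 / 2))
  rw [hodd] at h2
  norm_num at h2 ⊢
  linarith

theorem integral_sq_eq_of_even (h : IsClassicalOn S φ u) (ht : t ∈ S)
    (heven : ∀ x, φ t (-x) = φ t x) :
    (∫ y in (-1 / 2 : ℝ)..(1 / 2), φ t y ^ 2) = 2 * ∫ y in (0 : ℝ)..(1 / 2), φ t y ^ 2 := by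
  have c := h.continuous_density ht
  have h1 := h.velocity_half_of_even ht heven
  rw [h.velocity_eq_integral ht, intervalIntegral.integral_sub intervalIntegrable_const
    (Continuous.intervalIntegrable (by fun_prop) _ _), intervalIntegral.integral_const,
    smul_eq_mul] at h1
  linarith

end IsClassicalOn

/-- The focusing effect of the velocity on a decreasing profile `f`, with mass `m` and second
moment `h` on the half period. With `A x = ∫₀ˣ f`, monotonicity bounds the velocity by
`-(A² - 2xmA) / x`; integrated against `x f = x A'` this is cubic in the mass when the profile
is concentrated. -/
theorem integral_mul_velocity_le {f : ℝ → ℝ} (hf : Continuous f) (hnn : ∀ x, 0 ≤ f x)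
    (hanti : AntitoneOn f (Icc 0 (1 / 2))) :
    (∫ x in (0 : ℝ)..(1 / 2), x * (f x *
      ∫ y in (0 : ℝ)..x, (2 * (∫ z in (0 : ℝ)..(1 / 2), f z ^ 2) - f y ^ 2))) ≤
    -(∫ x in (0 : ℝ)..(1 / 2), f x) ^ 3 / 6 +
      6 * (∫ x in (0 : ℝ)..(1 / 2), f x) ^ 2 * ∫ x in (0 : ℝ)..(1 / 2), x ^ 2 * f x := by
  set m := ∫ x in (0 : ℝ)..(1 / 2), f x with hm
  set N := ∫ z in (0 : ℝ)..(1 / 2), f z ^ 2 with hN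
  have ii : ∀ {g : ℝ → ℝ} (a b : ℝ), Continuous g → IntervalIntegrable g volume a b :=
    fun a b hg => hg.intervalIntegrable a b
  have hm0 : 0 ≤ m := intervalIntegral.integral_nonneg (by norm_num) fun x _ => hnn x
  set A : ℝ → ℝ := fun x => ∫ y in (0 : ℝ)..x, f y with hA
  set P : ℝ → ℝ := fun x => ∫ y in (0 : ℝ)..x, y * f y with hP
  have dA : ∀ x, HasDerivAt A (f x) x := fun x => (hf.integral_hasStrictDerivAt 0 x).hasDerivAt
  have cxf : Continuous fun y => y * f y := by fun_prop
  have dP : ∀ x, HasDerivAt P (x * f x) x := fun x =>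
    (cxf.integral_hasStrictDerivAt 0 x).hasDerivAt
  have cA : Continuous A := continuous_iff_continuousAt.2 fun x => (dA x).continuousAt
  have cu : Continuous fun x => ∫ y in (0 : ℝ)..x, (2 * N - f y ^ 2) := by
    have : Continuous fun y => 2 * N - f y ^ 2 := by fun_prop
    exact continuous_iff_continuousAt.2 fun x =>
      (this.integral_hasStrictDerivAt 0 x).hasDerivAt.continuousAt
  have hpt : ∀ x ∈ Icc (0 : ℝ) (1 / 2), x * (∫ y in (0 : ℝ)..x, (2 * N - f y ^ 2)) ≤
      -(A x ^ 2 - 2 * x * m * A x) := by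
    intro x hx
    set B := ∫ y in (0 : ℝ)..x, f y ^ 2 with hB
    set R := ∫ y in x..(1 / 2), f y ^ 2 with hR
    have hBR : N = B + R := by
      rw [hN, hB, hR, intervalIntegral.integral_add_adjacent_intervals] <;>
        exact ii _ _ (by fun_prop)
    have hAm : m = A x + ∫ y in x..(1 / 2), f y := by
      rw [hm, hA, intervalIntegral.integral_add_adjacent_intervals] <;> exact ii _ _ hf
    have h1 : A x ^ 2 ≤ x * B := by
      have := sq_integral_le_mul_integral_sq hf hx.1
      rwa [sub_zero] at this
    have h2 : R ≤ f x * (m - A x) := by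
      rw [hAm, add_sub_cancel_left, ← intervalIntegral.integral_const_mul]
      refine intervalIntegral.integral_mono_on hx.2 (ii _ _ (by fun_prop))
        (ii _ _ (by fun_prop)) fun y hy => ?_
      rw [sq]
      exact mul_le_mul_of_nonneg_right (hanti hx ⟨hx.1.trans hy.1, hy.2⟩ hy.1) (hnn y)
    have h3 : x * f x ≤ A x := by
      have := intervalIntegral.integral_mono_on hx.1 (intervalIntegrable_const (c := f x))
        (ii _ _ hf) fun y hy => hanti ⟨hy.1, hy.2.trans hx.2⟩ hx hy.2
      rwa [intervalIntegral.integral_const, smul_eq_mul, sub_zero] at this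
    have hmA : 0 ≤ m - A x := by
      rw [hAm, add_sub_cancel_left]
      exact intervalIntegral.integral_nonneg hx.2 fun y _ => hnn y
    have e : (∫ y in (0 : ℝ)..x, (2 * N - f y ^ 2)) = 2 * N * x - B := by
      rw [intervalIntegral.integral_sub intervalIntegrable_const (ii _ _ (by fun_prop)),
        intervalIntegral.integral_const, smul_eq_mul, ← hB]
      ring
    rw [e, hBR]
    have h4 : x * R ≤ A x * (m - A x) :=
      calc x * R ≤ x * (f x * (m - A x)) := mul_le_mul_of_nonneg_left h2 hx.1
        _ = (x * f x) * (m - A x) := by ring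
        _ ≤ A x * (m - A x) := mul_le_mul_of_nonneg_right h3 hmA
    have h5 := mul_le_mul_of_nonneg_left h4 (by linarith [hx.1] : 0 ≤ 2 * x)
    have h6 := mul_le_mul_of_nonneg_left h1 (by linarith [hx.2] : 0 ≤ 1 - 2 * x)
    nlinarith
  -- `H' = A²f - 2xmAf - m(A - m)²`, so `H'` is a lower bound for `f (A² - 2xmA)`.
  have dH : ∀ x, HasDerivAt (fun x => A x ^ 3 / 3 - m * (x * A x ^ 2) + 2 * m ^ 2 * (x * A x)
      - m ^ 3 * x - 2 * m ^ 2 * P x)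
      (f x * (A x ^ 2 - 2 * x * m * A x) - m * (A x - m) ^ 2) x := by
    intro x
    have hx := hasDerivAt_id x
    have := (((((dA x).pow 3).div_const 3).sub ((hx.mul ((dA x).pow 2)).const_mul m)).add
      ((hx.mul (dA x)).const_mul (2 * m ^ 2))).sub (hx.const_mul (m ^ 3)) |>.sub
        ((dP x).const_mul (2 * m ^ 2))
    refine this.congr_deriv ?_
    simp
    ring
  have hFTC := intervalIntegral.integral_eq_sub_of_hasDerivAt (a := 0) (b := 1 / 2)
    (fun x _ => dH x) (ii _ _ (by fun_prop))
  have hA0 : A 0 = 0 := by simp [hA]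
  have hP0 : P 0 = 0 := by simp [hP]
  have hA1 : A (1 / 2) = m := rfl
  rw [hA0, hP0, hA1] at hFTC
  have hP1 : P (1 / 2) ≤ 3 * (∫ x in (0 : ℝ)..(1 / 2), x ^ 2 * f x) + m / 12 := by
    have e : 3 * (∫ x in (0 : ℝ)..(1 / 2), x ^ 2 * f x) + m / 12 =
        ∫ x in (0 : ℝ)..(1 / 2), (3 * (x ^ 2 * f x) + 1 / 12 * f x) := by
      rw [intervalIntegral.integral_add (ii _ _ (by fun_prop)) (ii _ _ (by fun_prop)),
        intervalIntegral.integral_const_mul, intervalIntegral.integral_const_mul, hm]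
      ring
    rw [e]
    refine intervalIntegral.integral_mono_on (by norm_num) (ii _ _ (by fun_prop))
      (ii _ _ (by fun_prop)) fun x _ => ?_
    nlinarith [mul_nonneg (hnn x) (sq_nonneg (x - 1 / 6))]
  have hmono : (∫ x in (0 : ℝ)..(1 / 2), x * (f x * ∫ y in (0 : ℝ)..x, (2 * N - f y ^ 2))) ≤
      ∫ x in (0 : ℝ)..(1 / 2), -(f x * (A x ^ 2 - 2 * x * m * A x) - m * (A x - m) ^ 2) := by
    refine intervalIntegral.integral_mono_on (by norm_num) (ii _ _ (by fun_prop))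
      (ii _ _ (by fun_prop)) fun x hx => ?_
    have h1 := mul_le_mul_of_nonneg_left (hpt x hx) (hnn x)
    have h2 := mul_nonneg hm0 (sq_nonneg (A x - m))
    nlinarith
  rw [intervalIntegral.integral_neg, hFTC] at hmono
  have h1 := mul_le_mul_of_nonneg_left hP1 (by positivity : 0 ≤ 2 * m ^ 2)
  nlinarith

namespace IsClassicalOn

variable {S : Set ℝ} {φ u : ℝ → ℝ → ℝ} {t : ℝ}

theorem integral_deriv_time_of_even (h : IsClassicalOn S φ u) (ht : t ∈ S)
    (heven : ∀ x, φ t (-x) = φ t x) :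
    (∫ x in (0 : ℝ)..(1 / 2), deriv (fun s => φ s x) t) = 0 := by
  rw [intervalIntegral.integral_eq_sub_of_hasDerivAt (fun x _ => h.hasDerivAt_flux ht x)
    ((h.continuous_deriv_time ht).intervalIntegrable _ _), deriv_zero_of_even heven,
    deriv_half_of_even heven (h.periodic t ht), h.velocity_zero t ht, h.velocity_half_of_even ht heven]
  ring

theorem integral_sq_mul_deriv_time_of_even (h : IsClassicalOn S φ u) (ht : t ∈ S)
    (heven : ∀ x, φ t (-x) = φ t x) :
    (∫ x in (0 : ℝ)..(1 / 2), x ^ 2 * deriv (fun s => φ s x) t) =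
      -φ t (1 / 2) + 2 * (∫ x in (0 : ℝ)..(1 / 2), φ t x) +
        2 * ∫ x in (0 : ℝ)..(1 / 2), x * (φ t x * u t x) := by
  have c := h.continuous_density ht
  have cd := h.continuous_deriv_space ht
  have ct := h.continuous_deriv_time ht
  have cu := h.continuous_velocity ht
  have p1 := intervalIntegral.integral_mul_deriv_eq_deriv_mul (a := 0) (b := 1 / 2)
    (u := fun x => x ^ 2) (u' := fun x => 2 * x)
    (v := fun x => deriv (φ t) x - u t x * φ t x)
    (v' := fun x => deriv (fun s => φ s x) t)
    (fun x _ => by simpa using hasDerivAt_pow 2 x)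
    (fun x _ => h.hasDerivAt_flux ht x)
    (Continuous.intervalIntegrable (by fun_prop) _ _)
    (Continuous.intervalIntegrable (by fun_prop) _ _)
  have p2 := intervalIntegral.integral_mul_deriv_eq_deriv_mul (a := 0) (b := 1 / 2)
    (u := fun x => 2 * x) (u' := fun _ => 2)
    (v := fun x => φ t x) (v' := fun x => deriv (φ t) x)
    (fun x _ => by simpa using (hasDerivAt_id x).const_mul 2)
    (fun x _ => h.hasDerivAt_space ht x)
    (Continuous.intervalIntegrable (by fun_prop) _ _)
    (Continuous.intervalIntegrable (by fun_prop) _ _)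
  have e : (∫ x in (0 : ℝ)..(1 / 2), 2 * x * (deriv (φ t) x - u t x * φ t x)) =
      (∫ x in (0 : ℝ)..(1 / 2), 2 * x * deriv (φ t) x) -
        2 * ∫ x in (0 : ℝ)..(1 / 2), x * (φ t x * u t x) := by
    rw [← intervalIntegral.integral_const_mul, ← intervalIntegral.integral_sub
      (Continuous.intervalIntegrable (by fun_prop) _ _)
      (Continuous.intervalIntegrable (by fun_prop) _ _)]
    congr 1
    funext x
    ring
  rw [intervalIntegral.integral_const_mul] at p2
  rw [p1, e, p2, deriv_half_of_even heven (h.periodic t ht), h.velocity_half_of_even ht heven]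
  ring

end IsClassicalOn

namespace IsSolution

variable {φ₀ : ℝ → ℝ} {T : ℝ} {φ u : ℝ → ℝ → ℝ}

theorem half_mass_eq (h : IsSolution φ₀ T φ u) (heven : ∀ x, φ₀ (-x) = φ₀ x) :
    ∀ t ∈ Ico 0 T, (∫ x in (0 : ℝ)..(1 / 2), φ t x) = ∫ x in (0 : ℝ)..(1 / 2), φ₀ x := by
  have hcl := h.isClassicalOn
  have hc := continuousOn_integral_of_continuousOn h.continuousOn 0 (1 / 2)
  have hd : ∀ t ∈ Ioo 0 T, HasDerivAt (fun s => ∫ x in (0 : ℝ)..(1 / 2), φ s x) 0 t := by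
    intro t ht
    exact (hasDerivAt_integral_of_continuousOn_deriv isOpen_Ioo
      (fun s hs => hcl.continuous_density hs) (fun s hs x => hcl.hasDerivAt_time hs x)
      hcl.continuousOn_deriv_time 0 (1 / 2) ht).congr_deriv
        (hcl.integral_deriv_time_of_even ht (h.even heven t (Ioo_subset_Ico_self ht)))
  intro t ht
  have h1 := le_of_deriv_le_const hc hd (fun _ _ => le_rfl) t ht
  have h2 := le_of_deriv_le_const hc.neg (fun s hs => (hd s hs).neg) (fun _ _ => le_rfl) t ht
  simp only [Pi.neg_apply, h.initial, zero_mul, neg_zero, add_zero] at h1 h2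
  linarith

/-- The second moment of a concentrated symmetric profile decreases at a definite rate, which
bounds the lifespan of the solution. -/
theorem lifespan_le (h : IsSolution φ₀ T φ u) (heven : ∀ x, φ₀ (-x) = φ₀ x)
    (hnn : ∀ x, 0 ≤ φ₀ x) (hanti : AntitoneOn φ₀ (Icc 0 (1 / 2)))
    (hm4 : 4 ≤ ∫ x in (0 : ℝ)..(1 / 2), φ₀ x)
    (hmh : 72 * (∫ x in (0 : ℝ)..(1 / 2), x ^ 2 * φ₀ x) ≤ ∫ x in (0 : ℝ)..(1 / 2), φ₀ x) :
    T ≤ ∫ x in (0 : ℝ)..(1 / 2), x ^ 2 * φ₀ x := by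
  set m := ∫ x in (0 : ℝ)..(1 / 2), φ₀ x with hm
  set h₀ := ∫ x in (0 : ℝ)..(1 / 2), x ^ 2 * φ₀ x with hh₀
  have hcl := h.isClassicalOn
  have h₀nn : 0 ≤ h₀ := intervalIntegral.integral_nonneg (by norm_num) fun x _ =>
    mul_nonneg (sq_nonneg _) (hnn x)
  set V : ℝ → ℝ := fun t => ∫ x in (0 : ℝ)..(1 / 2), x ^ 2 * φ t x with hV
  have hV0 : V 0 = h₀ := by simp only [hV, h.initial, hh₀]
  have hVc : ContinuousOn V (Ico 0 T) :=
    continuousOn_integral_of_continuousOn (F := fun t x => x ^ 2 * φ t x)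
      (ContinuousOn.mul (by fun_prop) h.continuousOn) _ _
  set V' : ℝ → ℝ := fun t => ∫ x in (0 : ℝ)..(1 / 2), x ^ 2 * deriv (fun s => φ s x) t with hV'
  have hVd : ∀ t ∈ Ioo 0 T, HasDerivAt V (V' t) t := fun t ht =>
    hasDerivAt_integral_of_continuousOn_deriv isOpen_Ioo (F := fun t x => x ^ 2 * φ t x)
      (F' := fun t x => x ^ 2 * deriv (fun s => φ s x) t)
      (fun s hs => (by fun_prop : Continuous fun x : ℝ => x ^ 2).mul (hcl.continuous_density hs))
      (fun s hs x => (hcl.hasDerivAt_time hs x).const_mul _)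
      (ContinuousOn.mul (by fun_prop) hcl.continuousOn_deriv_time) _ _ ht
  have hV'le : ∀ t ∈ Ioo 0 T, V' t ≤ 2 * m - m ^ 3 / 3 + 12 * m ^ 2 * V t := by
    intro t ht
    have ht' := Ioo_subset_Ico_self ht
    have hev := h.even heven t ht'
    have hu := integral_mul_velocity_le (hcl.continuous_density ht) (h.nonneg hnn t ht')
      (h.antitoneOn heven hanti t ht')
    rw [← hcl.integral_sq_eq_of_even ht hev, h.half_mass_eq heven t ht'] at hu
    simp only [← hcl.velocity_eq_integral ht] at hu
    simp only [hV', hV]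
    rw [hcl.integral_sq_mul_deriv_time_of_even ht hev, h.half_mass_eq heven t ht']
    linarith [h.nonneg hnn t ht' (1 / 2)]
  have hrate : 2 * m - m ^ 3 / 3 + 12 * m ^ 2 * h₀ ≤ -1 := by
    have h1 := mul_le_mul_of_nonneg_left hmh (sq_nonneg m)
    have h2 : 16 ≤ m ^ 2 := by nlinarith
    nlinarith
  -- `V` cannot rise above its initial value, since `V - h₀` satisfies a homogeneous
  -- linear differential inequality.
  have hVle : ∀ t ∈ Ico 0 T, V t ≤ h₀ := by
    intro t ht
    have := le_mul_exp_of_deriv_le (g := fun s => V s - h₀) (κ := 12 * m ^ 2)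
      (hVc.sub continuousOn_const) (fun s hs => (hVd s hs).sub_const h₀)
      (fun s hs => by linarith [hV'le s hs]) t ht
    simp only [hV0, sub_self, zero_mul] at this
    linarith
  have hdecay := le_of_deriv_le_const (c := -1) hVc hVd (fun s hs => by
    have h1 := hV'le s hs
    have h2 := mul_le_mul_of_nonneg_left (hVle s (Ioo_subset_Ico_self hs))
      (by positivity : 0 ≤ 12 * m ^ 2)
    linarith)
  refine le_of_forall_lt_imp_le_of_dense fun t ht => ?_
  rcases le_total t 0 with h0 | h0
  · exact h0.trans h₀nn
  · have h1 := hdecay t ⟨h0, ht⟩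
    have h2 : 0 ≤ V t := intervalIntegral.integral_nonneg (by norm_num) fun x _ =>
      mul_nonneg (sq_nonneg _) (h.nonneg hnn t ⟨h0, ht⟩ x)
    rw [hV0] at h1
    linarith

end IsSolution

/-! ### Convolution of summable sequences on `ℤ` -/

/-- The convolution of two sequences indexed by `ℤ`; it describes the Fourier coefficients of a
product. -/
noncomputable def conv {E : Type*} [NormedRing E] (a b : ℤ → E) (k : ℤ) : E :=
  ∑' j, a j * b (k - j)

/-- The shear `(k, j) ↦ (j, k - j)`, along which a convolution is a double sum. -/
def convEquiv : ℤ × ℤ ≃ ℤ × ℤ where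
  toFun p := (p.2, p.1 - p.2)
  invFun p := (p.1 + p.2, p.1)
  left_inv p := by ext <;> simp
  right_inv p := by ext <;> simp

section conv

variable {E : Type*} [NormedRing E] {a b c : ℤ → E}

theorem summable_norm_mul_shear (ha : Summable fun k => ‖a k‖) (hb : Summable fun k => ‖b k‖) :
    Summable fun p : ℤ × ℤ => ‖a p.2 * b (p.1 - p.2)‖ :=
  (convEquiv.summable_iff (f := fun p : ℤ × ℤ => ‖a p.1 * b p.2‖)).2 (ha.mul_norm hb)

theorem summable_norm_conv_term (ha : Summable fun k => ‖a k‖) (hb : Summable fun k => ‖b k‖)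
    (k : ℤ) : Summable fun j => ‖a j * b (k - j)‖ :=
  (summable_norm_mul_shear ha hb).prod_factor k

theorem norm_conv_le_tsum (ha : Summable fun k => ‖a k‖) (hb : Summable fun k => ‖b k‖) (k : ℤ) :
    ‖conv a b k‖ ≤ ∑' j, ‖a j * b (k - j)‖ :=
  norm_tsum_le_tsum_norm (summable_norm_conv_term ha hb k)

theorem summable_norm_conv (ha : Summable fun k => ‖a k‖) (hb : Summable fun k => ‖b k‖) :
    Summable fun k => ‖conv a b k‖ :=
  Summable.of_nonneg_of_le (fun _ => norm_nonneg _) (norm_conv_le_tsum ha hb)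
    (summable_norm_mul_shear ha hb).prod

theorem tsum_norm_conv_le (ha : Summable fun k => ‖a k‖) (hb : Summable fun k => ‖b k‖) :
    ∑' k, ‖conv a b k‖ ≤ (∑' k, ‖a k‖) * ∑' k, ‖b k‖ := by
  have hs := summable_norm_mul_shear ha hb
  calc ∑' k, ‖conv a b k‖ ≤ ∑' k, ∑' j, ‖a j * b (k - j)‖ :=
        (summable_norm_conv ha hb).tsum_le_tsum (norm_conv_le_tsum ha hb) hs.prod
    _ = ∑' p : ℤ × ℤ, ‖a p.2 * b (p.1 - p.2)‖ := (hs.tsum_prod).symm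
    _ = ∑' p : ℤ × ℤ, ‖a p.1 * b p.2‖ :=
        convEquiv.tsum_eq (fun p : ℤ × ℤ => ‖a p.1 * b p.2‖)
    _ ≤ ∑' p : ℤ × ℤ, ‖a p.1‖ * ‖b p.2‖ :=
        (ha.mul_norm hb).tsum_le_tsum (fun p => norm_mul_le _ _)
          (ha.mul_of_nonneg hb (fun _ => norm_nonneg _) fun _ => norm_nonneg _)
    _ = (∑' k, ‖a k‖) * ∑' k, ‖b k‖ :=
        (ha.tsum_mul_tsum hb (ha.mul_of_nonneg hb (fun _ => norm_nonneg _)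
          fun _ => norm_nonneg _)).symm

theorem tsum_mul_tsum_eq_tsum_conv [CompleteSpace E] (ha : Summable fun k => ‖a k‖)
    (hb : Summable fun k => ‖b k‖) : (∑' k, a k) * ∑' k, b k = ∑' k, conv a b k := by
  have hs := summable_norm_mul_shear ha hb
  rw [tsum_mul_tsum_of_summable_norm ha hb,
    ← convEquiv.tsum_eq (fun p : ℤ × ℤ => a p.1 * b p.2)]
  exact hs.of_norm.tsum_prod

theorem conv_sub_left [CompleteSpace E] (ha : Summable fun k => ‖a k‖)
    (hb : Summable fun k => ‖b k‖) (hc : Summable fun k => ‖c k‖) (k : ℤ) :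
    conv (fun j => a j - b j) c k = conv a c k - conv b c k := by
  simp only [conv, sub_mul]
  exact (summable_norm_conv_term ha hc k).of_norm.tsum_sub (summable_norm_conv_term hb hc k).of_norm

theorem conv_sub_right [CompleteSpace E] (ha : Summable fun k => ‖a k‖)
    (hb : Summable fun k => ‖b k‖) (hc : Summable fun k => ‖c k‖) (k : ℤ) :
    conv a (fun j => b j - c j) k = conv a b k - conv a c k := by
  simp only [conv, mul_sub]
  exact (summable_norm_conv_term ha hb k).of_norm.tsum_sub (summable_norm_conv_term ha hc k).of_norm

theorem conv_neg_index (a b : ℤ → E) (k : ℤ) :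
    conv a b (-k) = conv (fun j => a (-j)) (fun j => b (-j)) k := by
  simp only [conv]
  rw [← (Equiv.neg ℤ).tsum_eq]
  refine tsum_congr fun j => ?_
  simp only [Equiv.neg_apply]
  congr 2
  ring

theorem conv_neg_left (a b : ℤ → E) (k : ℤ) : conv (fun j => -a j) b k = -conv a b k := by
  simp only [conv, neg_mul, tsum_neg]

end conv

theorem conv_nonneg {a b : ℤ → ℝ} (ha : ∀ k, 0 ≤ a k) (hb : ∀ k, 0 ≤ b k) (k : ℤ) :
    0 ≤ conv a b k :=
  tsum_nonneg fun _ => mul_nonneg (ha _) (hb _)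

theorem summable_conv {a b : ℤ → ℝ} (ha : Summable a) (hb : Summable b) : Summable (conv a b) :=
  (summable_norm_conv ha.norm hb.norm).of_norm

/-- Convolution is monotone in majorants. -/
theorem abs_conv_le {a b A B : ℤ → ℝ} (ha : ∀ k, |a k| ≤ A k) (hb : ∀ k, |b k| ≤ B k)
    (hA : Summable A) (hB : Summable B) (k : ℤ) : |conv a b k| ≤ conv A B k := by
  have hs : Summable fun j => A j * B (k - j) :=
    (summable_norm_conv_term hA.norm hB.norm k).of_norm
  have hle : ∀ j, ‖a j * b (k - j)‖ ≤ A j * B (k - j) := fun j => by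
    rw [norm_mul]
    exact mul_le_mul (ha j) (hb _) (norm_nonneg _) ((abs_nonneg _).trans (ha j))
  exact tsum_of_norm_bounded hs.hasSum hle

/-- The wave number `2πk` of the `k`-th Fourier mode on `ℝ / ℤ`. -/
noncomputable def wave (k : ℤ) : ℝ := 2 * Real.pi * k

theorem wave_zero : wave 0 = 0 := by simp [wave]

theorem wave_neg (k : ℤ) : wave (-k) = -wave k := by simp [wave]

theorem wave_add (j k : ℤ) : wave (j + k) = wave j + wave k := by simp [wave]; ring

theorem one_le_abs_wave {k : ℤ} (hk : k ≠ 0) : 1 ≤ |wave k| := by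
  rw [wave, abs_mul, abs_of_pos Real.two_pi_pos]
  have h1 : (1 : ℝ) ≤ |(k : ℝ)| := by
    rw [← Int.cast_abs]
    exact_mod_cast Int.one_le_abs hk
  nlinarith [Real.two_le_pi, abs_nonneg (k : ℝ)]

theorem wave_ne_zero {k : ℤ} (hk : k ≠ 0) : wave k ≠ 0 := fun h => by
  have := one_le_abs_wave hk
  rw [h, abs_zero] at this
  linarith

theorem abs_wave_inv_le (k : ℤ) : |(wave k)⁻¹| ≤ 1 := by
  rcases eq_or_ne k 0 with rfl | hk
  · simp [wave_zero]
  · rw [abs_inv]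
    exact inv_le_one_of_one_le₀ (one_le_abs_wave hk)

/-! ### Products of trigonometric series -/

section trig

variable {a b : ℤ → ℝ}

theorem summable_mul_cos (ha : Summable fun k => |a k|) (x : ℝ) :
    Summable fun k => a k * Real.cos (wave k * x) :=
  Summable.of_norm_bounded ha fun k => by
    rw [norm_mul]
    exact mul_le_of_le_one_right (norm_nonneg _) (Real.abs_cos_le_one _)

theorem summable_mul_sin (ha : Summable fun k => |a k|) (x : ℝ) :
    Summable fun k => a k * Real.sin (wave k * x) :=
  Summable.of_norm_bounded ha fun k => by
    rw [norm_mul]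
    exact mul_le_of_le_one_right (norm_nonneg _) (Real.abs_sin_le_one _)

theorem tsum_eq_zero_of_odd {f : ℤ → ℝ} (hf : ∀ k, f (-k) = -f k) : ∑' k, f k = 0 := by
  have h := (Equiv.neg ℤ).tsum_eq f
  simp only [Equiv.neg_apply, hf, tsum_neg] at h
  linarith

theorem tsum_mul_exp (ha : Summable fun k => |a k|) (x : ℝ) :
    ∑' k, (a k : ℂ) * Complex.exp ((wave k * x : ℝ) * Complex.I) =
      ((∑' k, a k * Real.cos (wave k * x) : ℝ) : ℂ) +
        ((∑' k, a k * Real.sin (wave k * x) : ℝ) : ℂ) * Complex.I := by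
  have e : ∀ k, (a k : ℂ) * Complex.exp ((wave k * x : ℝ) * Complex.I) =
      ((a k * Real.cos (wave k * x) : ℝ) : ℂ) +
        ((a k * Real.sin (wave k * x) : ℝ) : ℂ) * Complex.I := by
    intro k
    rw [Complex.exp_mul_I]
    push_cast
    ring
  simp only [e]
  have h1 := (summable_mul_cos ha x)
  have h2 := (summable_mul_sin ha x)
  rw [Summable.tsum_add (Complex.summable_ofReal.2 h1)
    ((Complex.summable_ofReal.2 h2).mul_right _), tsum_mul_right, Complex.ofReal_tsum,
    Complex.ofReal_tsum]

theorem re_im_of_mul_eq {A B C D P Q : ℝ}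
    (h : ((A : ℂ) + B * Complex.I) * (C + D * Complex.I) = P + Q * Complex.I) :
    A * C - B * D = P ∧ A * D + B * C = Q := by
  have hre := congrArg Complex.re h
  have him := congrArg Complex.im h
  simp at hre him
  exact ⟨hre, him⟩

theorem trig_mul_trig (ha : Summable fun k => |a k|) (hb : Summable fun k => |b k|) (x : ℝ) :
    ((∑' k, a k * Real.cos (wave k * x)) * ∑' k, b k * Real.cos (wave k * x)) -
      ((∑' k, a k * Real.sin (wave k * x)) * ∑' k, b k * Real.sin (wave k * x)) =
        ∑' k, conv a b k * Real.cos (wave k * x) ∧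
    ((∑' k, a k * Real.cos (wave k * x)) * ∑' k, b k * Real.sin (wave k * x)) +
      ((∑' k, a k * Real.sin (wave k * x)) * ∑' k, b k * Real.cos (wave k * x)) =
        ∑' k, conv a b k * Real.sin (wave k * x) := by
  have hn : ∀ c : ℤ → ℝ, (Summable fun k => |c k|) →
      Summable fun k => ‖(c k : ℂ) * Complex.exp ((wave k * x : ℝ) * Complex.I)‖ := by
    intro c hc
    simpa only [norm_mul, Complex.norm_exp_ofReal_mul_I, mul_one, Complex.norm_real,
      Real.norm_eq_abs] using hc
  have key := tsum_mul_tsum_eq_tsum_conv (hn a ha) (hn b hb)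
  have hconv : ∀ k, conv (fun k => (a k : ℂ) * Complex.exp ((wave k * x : ℝ) * Complex.I))
      (fun k => (b k : ℂ) * Complex.exp ((wave k * x : ℝ) * Complex.I)) k =
      ((conv a b k : ℝ) : ℂ) * Complex.exp ((wave k * x : ℝ) * Complex.I) := by
    intro k
    rw [conv, conv, Complex.ofReal_tsum, ← tsum_mul_right]
    refine tsum_congr fun j => ?_
    have hk : wave k = wave j + wave (k - j) := by rw [← wave_add]; congr 1; ring
    rw [hk, add_mul]
    push_cast
    rw [add_mul, Complex.exp_add]
    ring
  have hc : Summable fun k => |conv a b k| := summable_norm_conv (E := ℝ) ha hb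
  rw [tsum_congr hconv, tsum_mul_exp ha x, tsum_mul_exp hb x,
    tsum_mul_exp (a := conv a b) hc x] at key
  exact re_im_of_mul_eq key

theorem tsum_cos_sq (ha : Summable fun k => |a k|) (hsymm : ∀ k, a (-k) = a k) (x : ℝ) :
    (∑' k, a k * Real.cos (wave k * x)) ^ 2 = ∑' k, conv a a k * Real.cos (wave k * x) := by
  have h := (trig_mul_trig ha ha x).1
  have h0 : ∑' k, a k * Real.sin (wave k * x) = 0 :=
    tsum_eq_zero_of_odd fun k => by rw [hsymm, wave_neg, neg_mul, Real.sin_neg, mul_neg]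
  rw [h0] at h
  rw [← h]
  ring

theorem tsum_sin_mul_tsum_cos (hb : Summable fun k => |b k|) (ha : Summable fun k => |a k|)
    (hsymm : ∀ k, a (-k) = a k) (x : ℝ) :
    (∑' k, b k * Real.sin (wave k * x)) * (∑' k, a k * Real.cos (wave k * x)) =
      ∑' k, conv b a k * Real.sin (wave k * x) := by
  have h := (trig_mul_trig hb ha x).2
  have h0 : ∑' k, a k * Real.sin (wave k * x) = 0 :=
    tsum_eq_zero_of_odd fun k => by rw [hsymm, wave_neg, neg_mul, Real.sin_neg, mul_neg]
  rw [h0] at h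
  rw [← h]
  ring

end trig

/-! ### The Banach space of summable mode sequences -/

/-- The Banach space of absolutely summable sequences `ℤ → E`. With `E = C([0, τ])` it holds the
Fourier modes of a function of time and space, in the norm `∑ₖ sup_t |aₖ(t)|`. -/
abbrev ModeSpace (E : Type*) [NormedRing E] := lp (fun _ : ℤ => E) 1

namespace ModeSpace

variable {E : Type*} [NormedRing E]

theorem summable (x : ModeSpace E) : Summable fun k => ‖x k‖ := by
  have := (lp.memℓp x).summable (by norm_num)
  simpa using this

theorem norm_eq (x : ModeSpace E) : ‖x‖ = ∑' k, ‖x k‖ := by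
  rw [lp.norm_eq_tsum_rpow (by norm_num)]
  simp

/-- The element of `ModeSpace E` with the given modes. -/
def mk (f : ℤ → E) (hf : Summable fun k => ‖f k‖) : ModeSpace E :=
  ⟨f, memℓp_gen (by simpa using hf)⟩

theorem mk_apply (f : ℤ → E) (hf : Summable fun k => ‖f k‖) (k : ℤ) : mk f hf k = f k := rfl

/-- Convolution on `ModeSpace E`. -/
noncomputable def mul (x y : ModeSpace E) : ModeSpace E :=
  mk (conv x y) (summable_norm_conv (summable x) (summable y))

theorem mul_apply (x y : ModeSpace E) (k : ℤ) : mul x y k = conv x y k := rfl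

theorem norm_mul_le (x y : ModeSpace E) : ‖mul x y‖ ≤ ‖x‖ * ‖y‖ := by
  rw [norm_eq, norm_eq, norm_eq]
  exact tsum_norm_conv_le (summable x) (summable y)

theorem mul_sub_left [CompleteSpace E] (x y z : ModeSpace E) :
    mul (x - y) z = mul x z - mul y z := by
  ext k
  exact conv_sub_left (summable x) (summable y) (summable z) k

theorem mul_sub_right [CompleteSpace E] (x y z : ModeSpace E) :
    mul x (y - z) = mul x y - mul x z := by
  ext k
  exact conv_sub_right (summable x) (summable y) (summable z) k

/-- The abstract fixed-point problem behind local existence. The unknown `x` solves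
`x = z + G ((S (x * x)) * x)` with `S` of norm at most one and `G` small; the symmetric
sequences in a ball are preserved when `z` is symmetric and `S`, `G` exchange symmetric and
antisymmetric sequences. -/
theorem exists_cubic_fixedPoint [CompleteSpace E]
    {S G : ModeSpace E → ModeSpace E} {g R : ℝ} (hR : 0 ≤ R) (hg0 : 0 ≤ g)
    (hS : ∀ x, ‖S x‖ ≤ ‖x‖) (hSsub : ∀ x y, S (x - y) = S x - S y)
    (hG : ∀ x, ‖G x‖ ≤ g * ‖x‖) (hGsub : ∀ x y, G (x - y) = G x - G y)
    (hSodd : ∀ x : ModeSpace E, (∀ k, x (-k) = x k) → ∀ k, S x (-k) = -S x k)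
    (hGodd : ∀ x : ModeSpace E, (∀ k, x (-k) = -x k) → ∀ k, G x (-k) = G x k)
    {z : ModeSpace E} (hz : ‖z‖ ≤ R) (hzsymm : ∀ k, z (-k) = z k)
    (hgR : g * (3 * (2 * R) ^ 2) ≤ 1 / 2) :
    ∃ x : ModeSpace E, (∀ k, x (-k) = x k) ∧ x = z + G (mul (S (mul x x)) x) := by
  set Φ : ModeSpace E → ModeSpace E := fun x => z + G (mul (S (mul x x)) x) with hΦ
  set s : Set (ModeSpace E) := Metric.closedBall 0 (2 * R) ∩ {x | ∀ k, x (-k) = x k} with hs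
  have hclosed : IsClosed {x : ModeSpace E | ∀ k, x (-k) = x k} := by
    have hev : ∀ k, Continuous fun x : ModeSpace E => x k := fun k =>
      (continuous_apply k).comp lp.uniformContinuous_coe.continuous
    simp only [ofPred_forall]
    exact isClosed_iInter fun k => isClosed_eq (hev _) (hev _)
  have hcomplete : IsComplete s := (Metric.isClosed_closedBall.inter hclosed).isComplete
  have hnorm : ∀ x ∈ s, ‖x‖ ≤ 2 * R := fun x hx => by simpa using hx.1
  have hcube : ∀ x ∈ s, ‖mul (S (mul x x)) x‖ ≤ (2 * R) ^ 2 * (2 * R) := fun x hx =>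
    calc ‖mul (S (mul x x)) x‖ ≤ ‖S (mul x x)‖ * ‖x‖ := norm_mul_le _ _
      _ ≤ (‖x‖ * ‖x‖) * ‖x‖ :=
          mul_le_mul_of_nonneg_right ((hS _).trans (norm_mul_le _ _)) (norm_nonneg _)
      _ ≤ (2 * R) ^ 2 * (2 * R) := by
          rw [← sq]
          exact mul_le_mul (pow_le_pow_left₀ (norm_nonneg _) (hnorm x hx) 2) (hnorm x hx)
            (norm_nonneg _) (by positivity)
  have hmaps : MapsTo Φ s s := by
    intro x hx
    constructor
    · rw [mem_closedBall_zero_iff]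
      have h1 := (hG (mul (S (mul x x)) x)).trans (mul_le_mul_of_nonneg_left (hcube x hx) hg0)
      have h2 := norm_add_le z (G (mul (S (mul x x)) x))
      have h3 := mul_le_mul_of_nonneg_right hgR hR
      change ‖z + G (mul (S (mul x x)) x)‖ ≤ _
      nlinarith
    · intro k
      have hxs : ∀ k, x (-k) = x k := hx.2
      have hxx : ∀ k, mul x x (-k) = mul x x k := fun k => by
        rw [mul_apply, mul_apply, conv_neg_index]
        simp only [hxs]
      have hSx := hSodd _ hxx
      have hprod : ∀ k, mul (S (mul x x)) x (-k) = -mul (S (mul x x)) x k := fun k => by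
        rw [mul_apply, mul_apply, conv_neg_index]
        simp only [hxs, hSx, conv_neg_left]
      change z (-k) + G _ (-k) = z k + G _ k
      rw [hzsymm, hGodd _ hprod]
  have hdiff : ∀ x ∈ s, ∀ y ∈ s, ‖Φ x - Φ y‖ ≤ 1 / 2 * ‖x - y‖ := by
    intro x hx y hy
    have nx := hnorm x hx
    have ny := hnorm y hy
    have hd := norm_nonneg (x - y)
    have e : Φ x - Φ y = G (mul (S (mul x x)) (x - y) +
        mul (S (mul x (x - y) + mul (x - y) y)) y) := by
      have e1 : mul x (x - y) + mul (x - y) y = mul x x - mul y y := by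
        rw [mul_sub_right, mul_sub_left]; abel
      have e2 : mul (S (mul x x)) (x - y) + mul (S (mul x x - mul y y)) y =
          mul (S (mul x x)) x - mul (S (mul y y)) y := by
        rw [mul_sub_right, hSsub, mul_sub_left]; abel
      rw [e1, e2, hGsub]
      simp only [hΦ]
      abel
    have b1 : ‖mul (S (mul x x)) (x - y)‖ ≤ (2 * R) ^ 2 * ‖x - y‖ := by
      refine (norm_mul_le _ _).trans (mul_le_mul_of_nonneg_right ?_ hd)
      refine (hS _).trans ((norm_mul_le _ _).trans ?_)
      rw [sq]
      exact mul_le_mul nx nx (norm_nonneg _) (by positivity)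
    have b2 : ‖mul (S (mul x (x - y) + mul (x - y) y)) y‖ ≤ 2 * (2 * R) ^ 2 * ‖x - y‖ := by
      have h1 : ‖mul x (x - y) + mul (x - y) y‖ ≤ 2 * (2 * R) * ‖x - y‖ := by
        refine (norm_add_le _ _).trans ?_
        have h2 := (norm_mul_le x (x - y)).trans (mul_le_mul_of_nonneg_right nx hd)
        have h3 := (norm_mul_le (x - y) y).trans (mul_le_mul_of_nonneg_left ny hd)
        linarith
      calc _ ≤ ‖S (mul x (x - y) + mul (x - y) y)‖ * ‖y‖ := norm_mul_le _ _
        _ ≤ (2 * (2 * R) * ‖x - y‖) * (2 * R) :=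
            mul_le_mul ((hS _).trans h1) ny (norm_nonneg _) (by positivity)
        _ = 2 * (2 * R) ^ 2 * ‖x - y‖ := by ring
    rw [e]
    calc _ ≤ g * ‖mul (S (mul x x)) (x - y) + mul (S (mul x (x - y) + mul (x - y) y)) y‖ := hG _
      _ ≤ g * ((2 * R) ^ 2 * ‖x - y‖ + 2 * (2 * R) ^ 2 * ‖x - y‖) :=
          mul_le_mul_of_nonneg_left ((norm_add_le _ _).trans (add_le_add b1 b2)) hg0
      _ = g * (3 * (2 * R) ^ 2) * ‖x - y‖ := by ring
      _ ≤ 1 / 2 * ‖x - y‖ := mul_le_mul_of_nonneg_right hgR hd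
  have hcontr : ContractingWith (1 / 2) (hmaps.restrict Φ s s) := by
    refine ⟨by norm_num [← NNReal.coe_lt_coe], LipschitzWith.of_dist_le_mul fun x y => ?_⟩
    rw [Subtype.dist_eq, Subtype.dist_eq, dist_eq_norm, dist_eq_norm]
    simpa using hdiff x x.2 y y.2
  have h0 : (0 : ModeSpace E) ∈ s := ⟨by simp [hR], fun k => rfl⟩
  obtain ⟨x, hxs, hfix, -⟩ := hcontr.exists_fixedPoint' hcomplete hmaps h0 (edist_ne_top _ _)
  exact ⟨x, hxs.2, hfix.symm⟩

variable [NormedSpace ℝ E]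

/-- A family of linear maps with a common bound acts diagonally on `ModeSpace E`. -/
def diag (L : ℤ → E →ₗ[ℝ] E) {c : ℝ} (hL : ∀ k x, ‖L k x‖ ≤ c * ‖x‖) (x : ModeSpace E) :
    ModeSpace E :=
  mk (fun k => L k (x k)) (Summable.of_nonneg_of_le (fun _ => norm_nonneg _)
    (fun k => hL k (x k)) ((summable x).mul_left c))

variable {L : ℤ → E →ₗ[ℝ] E} {c : ℝ} (hL : ∀ k x, ‖L k x‖ ≤ c * ‖x‖)

theorem diag_apply (x : ModeSpace E) (k : ℤ) : diag L hL x k = L k (x k) := rfl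

theorem norm_diag_le (x : ModeSpace E) : ‖diag L hL x‖ ≤ c * ‖x‖ := by
  rw [norm_eq, norm_eq, ← tsum_mul_left]
  exact (summable (diag L hL x)).tsum_le_tsum (fun k => hL k (x k)) ((summable x).mul_left c)

theorem diag_sub (x y : ModeSpace E) : diag L hL (x - y) = diag L hL x - diag L hL y := by
  ext k
  exact map_sub (L k) (x k) (y k)

end ModeSpace

/-! ### The damped linear equation for a single mode -/

/-- The solution `∫₀ᵗ exp(-λ(t - s)) f(s) ds` of `y' = -λ y + f`, `y 0 = 0`. -/
noncomputable def damped (lam : ℝ) (f : ℝ → ℝ) (t : ℝ) : ℝ :=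
  Real.exp (-lam * t) * ∫ s in (0 : ℝ)..t, Real.exp (lam * s) * f s

theorem damped_zero (lam : ℝ) (f : ℝ → ℝ) : damped lam f 0 = 0 := by simp [damped]

theorem hasDerivAt_damped (lam : ℝ) {f : ℝ → ℝ} (hf : Continuous f) (t : ℝ) :
    HasDerivAt (damped lam f) (-lam * damped lam f t + f t) t := by
  have hc : Continuous fun s => Real.exp (lam * s) * f s := by fun_prop
  have h1 := (hc.integral_hasStrictDerivAt 0 t).hasDerivAt
  have h2 : HasDerivAt (fun s => Real.exp (-lam * s)) (Real.exp (-lam * t) * (-lam * 1)) t :=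
    ((hasDerivAt_id t).const_mul (-lam)).exp
  refine (h2.mul h1).congr_deriv ?_
  have he : Real.exp (-lam * t) * Real.exp (lam * t) = 1 := by
    rw [← Real.exp_add]; simp
  simp only [damped]
  linear_combination f t * he

theorem continuous_damped (lam : ℝ) {f : ℝ → ℝ} (hf : Continuous f) : Continuous (damped lam f) :=
  continuous_iff_continuousAt.2 fun t => (hasDerivAt_damped lam hf t).continuousAt

theorem abs_damped_le_mul {lam : ℝ} (hlam : 0 ≤ lam) {f : ℝ → ℝ} {F t : ℝ}
    (hF : ∀ s, |f s| ≤ F) (ht : 0 ≤ t) : |damped lam f t| ≤ t * F := by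
  have hb := intervalIntegral.norm_integral_le_of_norm_le_const (a := 0) (b := t)
    (C := Real.exp (lam * t) * F) (f := fun s => Real.exp (lam * s) * f s) fun s hs => by
      rw [uIoc_of_le ht] at hs
      rw [norm_mul, Real.norm_eq_abs, Real.abs_exp]
      exact mul_le_mul (Real.exp_le_exp.2 (mul_le_mul_of_nonneg_left hs.2 hlam)) (hF s)
        (norm_nonneg _) (Real.exp_pos _).le
  rw [sub_zero, abs_of_nonneg ht, Real.norm_eq_abs] at hb
  rw [damped, abs_mul, Real.abs_exp]
  calc _ ≤ Real.exp (-lam * t) * (Real.exp (lam * t) * F * t) :=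
        mul_le_mul_of_nonneg_left hb (Real.exp_pos _).le
    _ = (Real.exp (-lam * t) * Real.exp (lam * t)) * (t * F) := by ring
    _ = t * F := by rw [← Real.exp_add]; simp

/-- Parabolic smoothing in one mode: a force `w f` with the wave number `w` in front produces a
response of size `√τ`, uniformly in `w`. -/
theorem abs_wave_mul_damped_le {w τ : ℝ} {f : ℝ → ℝ} (hf : Continuous f) {F t : ℝ}
    (hF : ∀ s, |f s| ≤ F) (ht : t ∈ Icc 0 τ) : |w * damped (w ^ 2) f t| ≤ Real.sqrt τ * F := by
  have hF0 : 0 ≤ F := (abs_nonneg _).trans (hF 0)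
  rcases eq_or_ne w 0 with rfl | hw
  · simp only [zero_mul, abs_zero]
    positivity
  have hw2 : 0 < w ^ 2 := by positivity
  have h1 := (abs_damped_le_mul hw2.le hF ht.1).trans
    (mul_le_mul_of_nonneg_right ht.2 hF0)
  have h2 := abs_le_of_deriv_eq_neg_mul_add (a := 0) (b := t + 1) hw2
    (continuous_damped (w ^ 2) hf).continuousOn (fun s _ => hasDerivAt_damped (w ^ 2) hf s)
    (fun s _ => hF s) t ⟨ht.1, by linarith⟩
  rw [damped_zero, abs_zero, zero_add, le_div_iff₀ hw2] at h2
  refine abs_le_of_sq_le_sq ?_ (by positivity)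
  rw [mul_pow, mul_pow, Real.sq_sqrt (ht.1.trans ht.2), ← sq_abs (damped (w ^ 2) f t)]
  calc w ^ 2 * |damped (w ^ 2) f t| ^ 2
      = (|damped (w ^ 2) f t| * w ^ 2) * |damped (w ^ 2) f t| := by ring
    _ ≤ F * (τ * F) := mul_le_mul h2 h1 (abs_nonneg _) hF0
    _ = τ * F ^ 2 := by ring

theorem damped_add (lam : ℝ) {f g : ℝ → ℝ} (hf : Continuous f) (hg : Continuous g) (t : ℝ) :
    damped lam (fun s => f s + g s) t = damped lam f t + damped lam g t := by
  simp only [damped, mul_add]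
  rw [intervalIntegral.integral_add (Continuous.intervalIntegrable (by fun_prop) _ _)
    (Continuous.intervalIntegrable (by fun_prop) _ _), mul_add]

theorem damped_const_mul (lam c : ℝ) (f : ℝ → ℝ) (t : ℝ) :
    damped lam (fun s => c * f s) t = c * damped lam f t := by
  simp only [damped]
  rw [← intervalIntegral.integral_const_mul, ← intervalIntegral.integral_const_mul,
    ← intervalIntegral.integral_const_mul]
  congr 1
  funext s
  ring

/-! ### Local existence of the Fourier modes -/

section modes

variable {τ : ℝ}

theorem conv_continuousMap_apply {X : Type*} [TopologicalSpace X] [CompactSpace X]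
    {a b : ℤ → C(X, ℝ)} (ha : Summable fun k => ‖a k‖) (hb : Summable fun k => ‖b k‖) (k : ℤ)
    (s : X) : conv a b k s = conv (fun j => a j s) (fun j => b j s) k := by
  exact (ContinuousMap.tsum_apply (summable_norm_conv_term ha hb k).of_norm s).symm

/-- The Duhamel operator `f ↦ -w ∫₀ᵗ exp(-w²(t - s)) f(s) ds` of a mode of wave number `w`. -/
noncomputable def duhamel (hτ : 0 ≤ τ) (w : ℝ) : C(Icc 0 τ, ℝ) →ₗ[ℝ] C(Icc 0 τ, ℝ) where
  toFun f := ⟨fun t => -(w * damped (w ^ 2) (fun s => f (projIcc 0 τ hτ s)) t),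
    ((continuous_const.mul ((continuous_damped (w ^ 2) (by fun_prop)).comp
      continuous_subtype_val))).neg⟩
  map_add' f g := by
    ext t
    have := damped_add (w ^ 2) (f := fun s => f (projIcc 0 τ hτ s))
      (g := fun s => g (projIcc 0 τ hτ s)) (by fun_prop) (by fun_prop) t
    simp only [ContinuousMap.coe_mk, ContinuousMap.add_apply, this]
    ring
  map_smul' c f := by
    ext t
    have := damped_const_mul (w ^ 2) c (fun s => f (projIcc 0 τ hτ s)) t
    simp only [ContinuousMap.coe_mk, ContinuousMap.smul_apply, smul_eq_mul, RingHom.id_apply,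
      this]
    ring

theorem duhamel_apply (hτ : 0 ≤ τ) (w : ℝ) (f : C(Icc 0 τ, ℝ)) (t : Icc 0 τ) :
    duhamel hτ w f t = -(w * damped (w ^ 2) (fun s => f (projIcc 0 τ hτ s)) t) := rfl

theorem norm_duhamel_le (hτ : 0 ≤ τ) (w : ℝ) (f : C(Icc 0 τ, ℝ)) :
    ‖duhamel hτ w f‖ ≤ Real.sqrt τ * ‖f‖ := by
  rw [ContinuousMap.norm_le _ (by positivity)]
  intro t
  rw [duhamel_apply, norm_neg, Real.norm_eq_abs]
  exact abs_wave_mul_damped_le (by fun_prop) (fun s => f.norm_coe_le_norm _) t.2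

theorem duhamel_neg_wave (hτ : 0 ≤ τ) (w : ℝ) (f : C(Icc 0 τ, ℝ)) :
    duhamel hτ (-w) (-f) = duhamel hτ w f := by
  have h : duhamel hτ (-w) f = -duhamel hτ w f := by
    ext t
    simp only [duhamel_apply, ContinuousMap.neg_apply]
    ring_nf
  rw [map_neg, h, neg_neg]

/-- Local existence for the infinite system of ordinary differential equations satisfied by the
cosine coefficients of the density, on a time interval depending only on the `ℓ¹` norm of the
data. The coefficients come with a summable majorant that does not depend on time. -/
theorem exists_modes {R : ℝ} (hR : 0 ≤ R) : ∃ τ : ℝ, 0 < τ ∧ ∀ a₀ : ℤ → ℝ,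
    (Summable fun k => |a₀ k|) → (∑' k, |a₀ k|) ≤ R → (∀ k, a₀ (-k) = a₀ k) →
    ∃ (a N : ℤ → ℝ → ℝ) (M : ℤ → ℝ), Summable M ∧ (∀ k, Continuous (a k)) ∧
      (∀ k, Continuous (N k)) ∧ (∀ k t, a (-k) t = a k t) ∧ (∀ k t, |a k t| ≤ M k) ∧
      (∀ k, a k 0 = a₀ k) ∧
      (∀ k t, N k t = conv (fun j => -(wave j)⁻¹ * conv (fun i => a i t) (fun i => a i t) j)
        (fun j => a j t) k) ∧
      ∀ k, ∀ t ∈ Ioo 0 τ, HasDerivAt (a k) (-(wave k) ^ 2 * a k t - wave k * N k t) t := by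
  set g : ℝ := 1 / (2 * (12 * R ^ 2 + 1)) with hg
  have hgpos : 0 < g := by positivity
  have hτ : (0 : ℝ) ≤ g ^ 2 := by positivity
  have hsqrt : Real.sqrt (g ^ 2) = g := Real.sqrt_sq hgpos.le
  have hgR : g * (3 * (2 * R) ^ 2) ≤ 1 / 2 := by
    rw [hg, div_mul_eq_mul_div, div_le_div_iff₀ (by positivity) (by norm_num)]
    nlinarith
  refine ⟨g ^ 2, by positivity, fun a₀ hsum hle hsymm => ?_⟩
  set τ := g ^ 2
  have hz : ∀ k, ‖(⟨fun t => Real.exp (-(wave k) ^ 2 * t) * a₀ k, by fun_prop⟩ :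
      C(Icc 0 τ, ℝ))‖ ≤ |a₀ k| := by
    intro k
    rw [ContinuousMap.norm_le _ (abs_nonneg _)]
    intro t
    rw [ContinuousMap.coe_mk, norm_mul, Real.norm_eq_abs, Real.abs_exp, Real.norm_eq_abs]
    refine mul_le_of_le_one_left (abs_nonneg _) (Real.exp_le_one_iff.2 ?_)
    nlinarith [sq_nonneg (wave k), t.2.1]
  have hzsum := Summable.of_nonneg_of_le (fun k => norm_nonneg _) hz hsum
  set z : ModeSpace C(Icc 0 τ, ℝ) := ModeSpace.mk (fun k =>
    ⟨fun t => Real.exp (-(wave k) ^ 2 * t) * a₀ k, by fun_prop⟩) hzsum with hzdef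
  have hS1 : ∀ (k : ℤ) (f : C(Icc 0 τ, ℝ)),
      ‖((-(wave k)⁻¹) • (LinearMap.id : C(Icc 0 τ, ℝ) →ₗ[ℝ] C(Icc 0 τ, ℝ))) f‖ ≤ 1 * ‖f‖ := by
    intro k f
    rw [LinearMap.smul_apply, LinearMap.id_apply, norm_smul, norm_neg]
    exact mul_le_mul_of_nonneg_right (abs_wave_inv_le k) (norm_nonneg _)
  have hG1 : ∀ (k : ℤ) (f : C(Icc 0 τ, ℝ)), ‖duhamel hτ (wave k) f‖ ≤ g * ‖f‖ := by
    intro k f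
    have := norm_duhamel_le hτ (wave k) f
    rwa [hsqrt] at this
  obtain ⟨x, hxsymm, hx⟩ := ModeSpace.exists_cubic_fixedPoint (S := ModeSpace.diag _ hS1)
    (G := ModeSpace.diag _ hG1) (z := z) hR hgpos.le
    (fun x => by simpa using ModeSpace.norm_diag_le hS1 x) (ModeSpace.diag_sub hS1)
    (ModeSpace.norm_diag_le hG1) (ModeSpace.diag_sub hG1)
    (fun x hx k => by
      simp only [ModeSpace.diag_apply, hx, wave_neg, LinearMap.smul_apply, LinearMap.id_apply,
        inv_neg, neg_neg, neg_smul])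
    (fun x hx k => by
      simp only [ModeSpace.diag_apply, hx, wave_neg, duhamel_neg_wave])
    (by
      rw [ModeSpace.norm_eq]
      exact (hzsum.tsum_le_tsum hz hsum).trans hle)
    (fun k => by
      ext t
      simp only [hzdef, ModeSpace.mk_apply, ContinuousMap.coe_mk, hsymm, wave_neg, neg_sq])
    hgR
  set Nx := ModeSpace.mul (ModeSpace.diag _ hS1 (ModeSpace.mul x x)) x with hNx
  have hmode : ∀ k (t : Icc (0 : ℝ) τ), x k t = Real.exp (-(wave k) ^ 2 * t) * a₀ k -
      wave k * damped (wave k ^ 2) (fun s => Nx k (projIcc 0 τ hτ s)) t := by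
    intro k t
    have h1 : x k = z k + duhamel hτ (wave k) (Nx k) := congrArg (fun y => y k) hx
    rw [h1, ContinuousMap.add_apply, duhamel_apply, ← sub_eq_add_neg]
    rfl
  have hconv : ∀ k (t : Icc (0 : ℝ) τ), Nx k t =
      conv (fun j => -(wave j)⁻¹ * conv (fun i => x i t) (fun i => x i t) j)
        (fun j => x j t) k := by
    intro k t
    have h1 := conv_continuousMap_apply
      (ModeSpace.summable (ModeSpace.diag _ hS1 (ModeSpace.mul x x))) (ModeSpace.summable x) k t
    have h2 : ∀ j, ModeSpace.diag _ hS1 (ModeSpace.mul x x) j t =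
        -(wave j)⁻¹ * conv (fun i => x i t) (fun i => x i t) j := fun j =>
      congrArg (fun r => -(wave j)⁻¹ * r)
        (conv_continuousMap_apply (ModeSpace.summable x) (ModeSpace.summable x) j t)
    exact h1.trans (congrArg (fun f => conv f (fun j => x j t) k) (funext h2))
  -- From here on only the sequences of continuous functions matter.
  obtain ⟨y, hy⟩ : ∃ y : ℤ → C(Icc (0 : ℝ) τ, ℝ), y = fun k => x k := ⟨_, rfl⟩
  obtain ⟨n, hn⟩ : ∃ n : ℤ → C(Icc (0 : ℝ) τ, ℝ), n = fun k => Nx k := ⟨_, rfl⟩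
  have ysum : Summable fun k => ‖y k‖ := by subst hy; exact ModeSpace.summable x
  have ysymm : ∀ k, y (-k) = y k := by subst hy; exact hxsymm
  have ymode : ∀ k (t : Icc (0 : ℝ) τ), y k t = Real.exp (-(wave k) ^ 2 * t) * a₀ k -
      wave k * damped (wave k ^ 2) (fun s => n k (projIcc 0 τ hτ s)) t := by
    subst hy hn; exact hmode
  have nconv : ∀ k (t : Icc (0 : ℝ) τ), n k t =
      conv (fun j => -(wave j)⁻¹ * conv (fun i => y i t) (fun i => y i t) j)
        (fun j => y j t) k := by
    subst hy hn; exact hconv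
  refine ⟨fun k t => y k (projIcc 0 τ hτ t), fun k t => n k (projIcc 0 τ hτ t),
    fun k => ‖y k‖, ysum, fun k => by fun_prop, fun k => by fun_prop,
    fun k t => by simp only [ysymm], fun k t => (y k).norm_coe_le_norm _, fun k => ?_,
    fun k t => nconv k _, fun k t ht => ?_⟩
  · simp only [ymode, projIcc_of_mem hτ (left_mem_Icc.2 hτ), damped_zero]
    simp
  · have hN : Continuous fun s => n k (projIcc 0 τ hτ s) := by fun_prop
    have hE : HasDerivAt (fun s => Real.exp (-(wave k) ^ 2 * s))
        (Real.exp (-(wave k) ^ 2 * t) * (-(wave k) ^ 2 * 1)) t :=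
      ((hasDerivAt_id t).const_mul (-(wave k) ^ 2)).exp
    have hd := (hE.mul_const (a₀ k)).sub ((hasDerivAt_damped (wave k ^ 2) hN t).const_mul (wave k))
    have hev : (fun s => y k (projIcc 0 τ hτ s)) =ᶠ[𝓝 t]
        fun s => Real.exp (-(wave k) ^ 2 * s) * a₀ k -
          wave k * damped (wave k ^ 2) (fun s => n k (projIcc 0 τ hτ s)) s := by
      filter_upwards [Icc_mem_nhds ht.1 ht.2] with s hs
      rw [ymode, projIcc_of_mem hτ hs]
    refine (hd.congr_of_eventuallyEq hev).congr_deriv ?_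
    have := hev.self_of_nhds
    simp only at this ⊢
    rw [this]
    ring

end modes

/-! ### Parabolic smoothing of the modes -/

/-- The wave number of a convolution is at most the sum of the wave numbers of its factors. -/
theorem abs_wave_mul_conv_le {a b A B A₁ B₁ : ℤ → ℝ} (ha : ∀ k, |a k| ≤ A k)
    (hb : ∀ k, |b k| ≤ B k) (ha₁ : ∀ k, |wave k * a k| ≤ A₁ k) (hb₁ : ∀ k, |wave k * b k| ≤ B₁ k)
    (hA : Summable A) (hB : Summable B) (hA₁ : Summable A₁) (hB₁ : Summable B₁) (k : ℤ) :
    |wave k * conv a b k| ≤ conv A₁ B k + conv A B₁ k := by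
  have sa : Summable fun k => ‖a k‖ := Summable.of_nonneg_of_le (fun _ => norm_nonneg _) ha hA
  have sb : Summable fun k => ‖b k‖ := Summable.of_nonneg_of_le (fun _ => norm_nonneg _) hb hB
  have sa₁ : Summable fun k => ‖wave k * a k‖ :=
    Summable.of_nonneg_of_le (fun _ => norm_nonneg _) ha₁ hA₁
  have sb₁ : Summable fun k => ‖wave k * b k‖ :=
    Summable.of_nonneg_of_le (fun _ => norm_nonneg _) hb₁ hB₁
  have e : wave k * conv a b k =
      conv (fun j => wave j * a j) b k + conv a (fun j => wave j * b j) k := by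
    simp only [conv]
    rw [← tsum_mul_left, ← (summable_norm_conv_term sa₁ sb k).of_norm.tsum_add
      (summable_norm_conv_term sa sb₁ k).of_norm]
    refine tsum_congr fun j => ?_
    have hk : wave k = wave j + wave (k - j) := by rw [← wave_add]; congr 1; ring
    rw [hk]
    ring
  rw [e]
  exact (abs_add_le _ _).trans (add_le_add (abs_conv_le ha₁ hb hA₁ hB k)
    (abs_conv_le ha hb₁ hA hB₁ k))

/-- For positive times the modes and their time derivatives decay fast enough for the series to
be differentiated term by term. Each multiplication by `t` trades the unknown initial value for a
lower-order force in the damped equation, and gains one power of the wave number. -/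
theorem exists_smooth_majorant {τ δ : ℝ} (hδ : 0 < δ) {a N : ℤ → ℝ → ℝ} {M : ℤ → ℝ}
    (hM : Summable M) (ha : ∀ k, Continuous (a k)) (hle : ∀ k t, |a k t| ≤ M k)
    (hN : ∀ k t, N k t = conv (fun j => -(wave j)⁻¹ *
      conv (fun i => a i t) (fun i => a i t) j) (fun j => a j t) k)
    (hd : ∀ k, ∀ t ∈ Ioo 0 τ, HasDerivAt (a k) (-(wave k) ^ 2 * a k t - wave k * N k t) t) :
    ∃ B : ℤ → ℝ, Summable B ∧ ∀ k, ∀ t ∈ Ioo δ τ, |wave k ^ 2 * a k t| ≤ B k ∧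
      |wave k * N k t| ≤ B k := by
  have hM0 : ∀ k, 0 ≤ M k := fun k => (abs_nonneg _).trans (hle k 0)
  rcases le_or_gt τ 0 with hτ | hτ
  · exact ⟨M, hM, fun k t ht => absurd (ht.1.trans ht.2) (by linarith)⟩
  set V := conv M M with hV
  have hVs : Summable V := summable_conv hM hM
  have hV0 : ∀ k, 0 ≤ V k := conv_nonneg hM0 hM0
  set NM := conv V M with hNM
  have hNMs : Summable NM := summable_conv hVs hM
  have hNM0 : ∀ k, 0 ≤ NM k := conv_nonneg hV0 hM0
  have haa : ∀ k t, |conv (fun i => a i t) (fun i => a i t) k| ≤ V k := fun k t =>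
    abs_conv_le (fun i => hle i t) (fun i => hle i t) hM hM k
  have hv : ∀ k t, |-(wave k)⁻¹ * conv (fun i => a i t) (fun i => a i t) k| ≤ V k := by
    intro k t
    rw [abs_mul, abs_neg]
    exact (mul_le_of_le_one_left (abs_nonneg _) (abs_wave_inv_le k)).trans (haa k t)
  have hwv : ∀ k t, |wave k * (-(wave k)⁻¹ * conv (fun i => a i t) (fun i => a i t) k)| ≤ V k := by
    intro k t
    rcases eq_or_ne k 0 with rfl | hk
    · simpa [wave_zero] using hV0 0
    · rw [← mul_assoc, mul_neg, mul_inv_cancel₀ (wave_ne_zero hk), neg_one_mul, abs_neg]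
      exact haa k t
  have hNle : ∀ k t, |N k t| ≤ NM k := fun k t => by
    rw [hN]
    exact abs_conv_le (fun i => hv i t) (fun i => hle i t) hVs hM k
  have habs : ∀ {t}, t ∈ Ioo 0 τ → |t| = t := fun ht => abs_of_pos ht.1
  -- One power of the wave number, from the equation for `t a`.
  set M₁ : ℤ → ℝ := fun k => M k + τ * NM k with hM₁
  have hM₁s : Summable M₁ := hM.add (hNMs.mul_left τ)
  have hM₁0 : ∀ k, 0 ≤ M₁ k := fun k => add_nonneg (hM0 k) (mul_nonneg hτ.le (hNM0 k))
  have step₁ : ∀ k, ∀ t ∈ Ioo 0 τ, |wave k * (t * a k t)| ≤ M₁ k := by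
    intro k t ht
    rcases eq_or_ne k 0 with rfl | hk
    · simpa [wave_zero] using hM₁0 0
    have hw := one_le_abs_wave hk
    have hw2 : 0 < wave k ^ 2 := by have := wave_ne_zero hk; positivity
    have h := abs_le_of_deriv_eq_neg_mul_add (a := 0) (b := τ) (y := fun s => s * a k s)
      (f := fun s => a k s - s * (wave k * N k s)) (F := M k + τ * (|wave k| * NM k)) hw2
      (by have := ha k; fun_prop)
      (fun s hs => ((hasDerivAt_id s).mul (hd k s hs)).congr_deriv (by simp; ring))
      (fun s hs => by
        refine (abs_sub _ _).trans (add_le_add (hle k s) ?_)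
        rw [abs_mul, abs_mul, habs hs]
        exact mul_le_mul hs.2.le (mul_le_mul_of_nonneg_left (hNle k s) (abs_nonneg _))
          (by positivity) hτ.le) t (Ioo_subset_Ico_self ht)
    simp only [zero_mul, abs_zero, zero_add] at h
    rw [le_div_iff₀ hw2, ← sq_abs] at h
    rw [abs_mul]
    have hwpos : 0 < |wave k| := by linarith
    have h2 : |wave k| * (|wave k| * |t * a k t|) ≤ |wave k| * M₁ k := by
      calc _ = |t * a k t| * |wave k| ^ 2 := by ring
        _ ≤ M k + τ * (|wave k| * NM k) := h
        _ ≤ |wave k| * M k + τ * (|wave k| * NM k) := by nlinarith [hM0 k]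
        _ = |wave k| * M₁ k := by rw [hM₁]; ring
    exact le_of_mul_le_mul_left h2 hwpos
  -- The same gain for the nonlinearity.
  set N₁ : ℤ → ℝ := fun k => conv (fun j => τ * V j) M k + conv V M₁ k with hN₁
  have hN₁s : Summable N₁ := (summable_conv (hVs.mul_left τ) hM).add (summable_conv hVs hM₁s)
  have step₂ : ∀ k, ∀ t ∈ Ioo 0 τ, |wave k * (t * N k t)| ≤ N₁ k := by
    intro k t ht
    have h := abs_wave_mul_conv_le (a := fun j => -(wave j)⁻¹ *
      conv (fun i => a i t) (fun i => a i t) j) (b := fun j => a j t) (A := V) (B := M)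
      (A₁ := V) (B₁ := fun j => t⁻¹ * M₁ j) (fun j => hv j t) (fun j => hle j t)
      (fun j => hwv j t) (fun j => by
        have := step₁ j t ht
        rw [le_inv_mul_iff₀ ht.1, ← habs ht, ← abs_mul, abs_of_pos ht.1]
        calc |t * (wave j * a j t)| = |wave j * (t * a j t)| := by ring_nf
          _ ≤ _ := this) hVs hM hVs (hM₁s.mul_left _) k
    rw [← hN] at h
    have hc1 : conv (fun j => τ * V j) M k = τ * conv V M k := by
      simp only [conv, mul_assoc, tsum_mul_left]
    have hc2 : conv V (fun j => t⁻¹ * M₁ j) k = t⁻¹ * conv V M₁ k := by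
      simp only [conv, mul_left_comm _ t⁻¹, tsum_mul_left]
    rw [hc2] at h
    calc |wave k * (t * N k t)| = t * |wave k * N k t| := by
          rw [mul_left_comm, abs_mul, habs ht]
      _ ≤ t * (conv V M k + t⁻¹ * conv V M₁ k) := mul_le_mul_of_nonneg_left h ht.1.le
      _ = t * conv V M k + conv V M₁ k := by
          have := ht.1.ne'
          field_simp
      _ ≤ N₁ k := by
          simp only [hN₁, hc1]
          have := mul_le_mul_of_nonneg_right ht.2.le (hNM0 k)
          linarith
  have hN₁0 : ∀ k, 0 ≤ N₁ k := fun k => (abs_nonneg _).trans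
    (step₂ k (τ / 2) ⟨by linarith, by linarith⟩)
  -- Two powers of the wave number, from the equation for `t² a`.
  set M₂ : ℤ → ℝ := fun k => 2 * τ * M k + τ * N₁ k with hM₂
  have hM₂s : Summable M₂ := (hM.mul_left _).add (hN₁s.mul_left τ)
  have hM₂0 : ∀ k, 0 ≤ M₂ k := fun k =>
    add_nonneg (mul_nonneg (by linarith) (hM0 k)) (mul_nonneg hτ.le (hN₁0 k))
  have step₃ : ∀ k, ∀ t ∈ Ioo 0 τ, |wave k ^ 2 * (t ^ 2 * a k t)| ≤ M₂ k := by
    intro k t ht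
    rcases eq_or_ne k 0 with rfl | hk
    · simpa [wave_zero] using hM₂0 0
    have hw2 : 0 < wave k ^ 2 := by have := wave_ne_zero hk; positivity
    have h := abs_le_of_deriv_eq_neg_mul_add (a := 0) (b := τ) (y := fun s => s ^ 2 * a k s)
      (f := fun s => 2 * s * a k s - s * (wave k * (s * N k s))) (F := M₂ k) hw2
      (by have := ha k; fun_prop)
      (fun s hs => ((hasDerivAt_pow 2 s).mul (hd k s hs)).congr_deriv (by simp; ring))
      (fun s hs => by
        refine (abs_sub _ _).trans (add_le_add ?_ ?_)
        · rw [abs_mul, abs_mul, habs hs, abs_two]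
          exact mul_le_mul (by linarith [hs.2]) (hle k s) (abs_nonneg _) (by linarith)
        · rw [abs_mul, habs hs]
          exact mul_le_mul hs.2.le (step₂ k s hs) (abs_nonneg _) hτ.le)
      t (Ioo_subset_Ico_self ht)
    simp only [ne_eq, OfNat.ofNat_ne_zero, not_false_eq_true, zero_pow, zero_mul, abs_zero,
      zero_add] at h
    rw [le_div_iff₀ hw2] at h
    rw [abs_mul, abs_of_pos hw2]
    linarith
  refine ⟨fun k => (δ ^ 2)⁻¹ * M₂ k + δ⁻¹ * N₁ k,
    (hM₂s.mul_left _).add (hN₁s.mul_left _), fun k t ht => ?_⟩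
  have ht' : t ∈ Ioo 0 τ := ⟨hδ.trans ht.1, ht.2⟩
  have p1 : 0 ≤ (δ ^ 2)⁻¹ * M₂ k := mul_nonneg (by positivity) (hM₂0 k)
  have p2 : 0 ≤ δ⁻¹ * N₁ k := mul_nonneg (by positivity) (hN₁0 k)
  constructor
  · have h := step₃ k t ht'
    rw [mul_left_comm, abs_mul, abs_of_pos (by have := ht'.1; positivity : 0 < t ^ 2)] at h
    have h2 : δ ^ 2 * |wave k ^ 2 * a k t| ≤ M₂ k :=
      (mul_le_mul_of_nonneg_right (pow_le_pow_left₀ hδ.le ht.1.le 2) (abs_nonneg _)).trans h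
    have := (le_inv_mul_iff₀ (by positivity)).2 h2
    linarith
  · have h := step₂ k t ht'
    rw [mul_left_comm, abs_mul, habs ht'] at h
    have h2 : δ * |wave k * N k t| ≤ N₁ k :=
      (mul_le_mul_of_nonneg_right ht.1.le (abs_nonneg _)).trans h
    have := (le_inv_mul_iff₀ hδ).2 h2
    linarith

/-! ### Trigonometric series solve the system -/

theorem hasDerivAt_tsum_cos {c A : ℤ → ℝ} (hA : Summable A) (hc : ∀ k, |c k| ≤ A k)
    (hwc : ∀ k, |wave k * c k| ≤ A k) (x : ℝ) :
    HasDerivAt (fun y => ∑' k, c k * Real.cos (wave k * y))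
      (∑' k, -(wave k * c k) * Real.sin (wave k * x)) x := by
  refine hasDerivAt_tsum (g := fun k y => c k * Real.cos (wave k * y))
    (g' := fun k y => -(wave k * c k) * Real.sin (wave k * y)) (y₀ := 0) hA (fun k y => ?_)
    (fun k y => ?_) ?_ x
  · have := (((hasDerivAt_id y).const_mul (wave k)).cos).const_mul (c k)
    exact this.congr_deriv (by simp; ring)
  · rw [norm_mul, norm_neg]
    exact (mul_le_of_le_one_right (norm_nonneg _) (Real.abs_sin_le_one _)).trans (hwc k)
  · exact summable_mul_cos (Summable.of_nonneg_of_le (fun _ => abs_nonneg _) hc hA) 0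

theorem hasDerivAt_tsum_sin {c A : ℤ → ℝ} (hA : Summable A) (hc : ∀ k, |c k| ≤ A k)
    (hwc : ∀ k, |wave k * c k| ≤ A k) (x : ℝ) :
    HasDerivAt (fun y => ∑' k, c k * Real.sin (wave k * y))
      (∑' k, wave k * c k * Real.cos (wave k * x)) x := by
  refine hasDerivAt_tsum (g := fun k y => c k * Real.sin (wave k * y))
    (g' := fun k y => wave k * c k * Real.cos (wave k * y)) (y₀ := 0) hA (fun k y => ?_)
    (fun k y => ?_) ?_ x
  · have := (((hasDerivAt_id y).const_mul (wave k)).sin).const_mul (c k)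
    exact this.congr_deriv (by simp; ring)
  · rw [norm_mul]
    exact (mul_le_of_le_one_right (norm_nonneg _) (Real.abs_cos_le_one _)).trans (hwc k)
  · exact summable_mul_sin (Summable.of_nonneg_of_le (fun _ => abs_nonneg _) hc hA) 0

theorem cos_wave_add_one (k : ℤ) (x : ℝ) :
    Real.cos (wave k * (x + 1)) = Real.cos (wave k * x) := by
  have e : wave k * (x + 1) = wave k * x + k * (2 * Real.pi) := by rw [wave]; ring
  rw [e, Real.cos_add_int_mul_two_pi]

theorem sin_wave_add_one (k : ℤ) (x : ℝ) :
    Real.sin (wave k * (x + 1)) = Real.sin (wave k * x) := by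
  have e : wave k * (x + 1) = wave k * x + k * (2 * Real.pi) := by rw [wave]; ring
  rw [e, Real.sin_add_int_mul_two_pi]

theorem continuousOn_tsum_cos {c : ℤ → ℝ → ℝ} {A : ℤ → ℝ} {S : Set ℝ} (hA : Summable A)
    (hc : ∀ k, Continuous (c k)) (hle : ∀ k, ∀ t ∈ S, |c k t| ≤ A k) :
    ContinuousOn (fun p : ℝ × ℝ => ∑' k, c k p.1 * Real.cos (wave k * p.2)) (S ×ˢ univ) := by
  refine continuousOn_tsum (fun k => ?_) hA fun k p hp => ?_
  · have := hc k
    fun_prop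
  · rw [norm_mul]
    exact (mul_le_of_le_one_right (norm_nonneg _) (Real.abs_cos_le_one _)).trans (hle k _ hp.1)

theorem continuousOn_tsum_sin {c : ℤ → ℝ → ℝ} {A : ℤ → ℝ} {S : Set ℝ} (hA : Summable A)
    (hc : ∀ k, Continuous (c k)) (hle : ∀ k, ∀ t ∈ S, |c k t| ≤ A k) :
    ContinuousOn (fun p : ℝ × ℝ => ∑' k, c k p.1 * Real.sin (wave k * p.2)) (S ×ˢ univ) := by
  refine continuousOn_tsum (fun k => ?_) hA fun k p hp => ?_
  · have := hc k
    fun_prop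
  · rw [norm_mul]
    exact (mul_le_of_le_one_right (norm_nonneg _) (Real.abs_sin_le_one _)).trans (hle k _ hp.1)

theorem contDiff_two_of_hasDerivAt {f f' f'' : ℝ → ℝ} (h1 : ∀ x, HasDerivAt f (f' x) x)
    (h2 : ∀ x, HasDerivAt f' (f'' x) x) (h3 : Continuous f'') : ContDiff ℝ 2 f := by
  have e1 : deriv f = f' := funext fun x => (h1 x).deriv
  have e2 : deriv f' = f'' := funext fun x => (h2 x).deriv
  have c1 : ContDiff ℝ 1 f' :=
    contDiff_one_iff_deriv.2 ⟨fun x => (h2 x).differentiableAt, by rwa [e2]⟩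
  have : ContDiff ℝ (1 + 1) f :=
    contDiff_succ_iff_deriv.2 ⟨fun x => (h1 x).differentiableAt, by simp, by rwa [e1]⟩
  norm_num at this
  exact this

/-- Symmetric coefficients solving the mode equations, with summable majorants for the terms of
highest order, sum to a classical solution. The nonlocal constant `‖φ‖²` in the velocity is the
mean of `φ²`, which equals the zeroth coefficient because the velocity is periodic. -/
theorem isClassicalOn_tsum {S : Set ℝ} (hS : IsOpen S) (hSc : IsPreconnected S)
    {a N : ℤ → ℝ → ℝ} {A : ℤ → ℝ} (hA : Summable A) (hac : ∀ k, Continuous (a k))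
    (hNc : ∀ k, Continuous (N k)) (hsymm : ∀ k t, a (-k) t = a k t)
    (ha : ∀ k, ∀ t ∈ S, |a k t| ≤ A k) (ha2 : ∀ k, ∀ t ∈ S, |wave k ^ 2 * a k t| ≤ A k)
    (hN1 : ∀ k, ∀ t ∈ S, |wave k * N k t| ≤ A k)
    (hN : ∀ k t, N k t = conv (fun j => -(wave j)⁻¹ * conv (fun i => a i t) (fun i => a i t) j)
        (fun j => a j t) k)
    (hd : ∀ k, ∀ t ∈ S, HasDerivAt (a k) (-(wave k) ^ 2 * a k t - wave k * N k t) t) :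
    IsClassicalOn S (fun t x => ∑' k, a k t * Real.cos (wave k * x))
      (fun t x => ∑' k, -(wave k)⁻¹ * conv (fun i => a i t) (fun i => a i t) k *
        Real.sin (wave k * x)) := by
  have hAA := hA.add hA
  have hA0 : ∀ {t}, t ∈ S → ∀ k, 0 ≤ A k := fun ht k => (abs_nonneg _).trans (ha k _ ht)
  have ha1 : ∀ k, ∀ t ∈ S, |wave k * a k t| ≤ A k + A k := by
    intro k t ht
    have h1 := ha k t ht
    have h2 := ha2 k t ht
    rw [abs_mul] at h2 ⊢
    rw [abs_of_nonneg (sq_nonneg _)] at h2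
    have h3 : |wave k| ≤ 1 + wave k ^ 2 := by
      rw [← sq_abs]
      nlinarith [sq_nonneg (|wave k| - 1)]
    nlinarith [mul_le_mul_of_nonneg_right h3 (abs_nonneg (a k t))]
  have hd1 : ∀ k, ∀ t ∈ S, |-(wave k) ^ 2 * a k t - wave k * N k t| ≤ A k + A k := by
    intro k t ht
    refine (abs_sub _ _).trans (add_le_add ?_ (hN1 k t ht))
    rw [neg_mul, abs_neg]
    exact ha2 k t ht
  have hAle : ∀ {t}, t ∈ S → ∀ k, A k ≤ A k + A k := fun ht k => by linarith [hA0 ht k]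
  have asum : ∀ {t}, t ∈ S → Summable fun k => |a k t| := fun ht =>
    Summable.of_nonneg_of_le (fun _ => abs_nonneg _) (fun k => ha k _ ht) hA
  have dt : ∀ t ∈ S, ∀ x, HasDerivAt (fun s => ∑' k, a k s * Real.cos (wave k * x))
      (∑' k, (-(wave k) ^ 2 * a k t - wave k * N k t) * Real.cos (wave k * x)) t := by
    intro t ht x
    refine hasDerivAt_tsum_of_isPreconnected (g := fun k s => a k s * Real.cos (wave k * x))
      (g' := fun k s => (-(wave k) ^ 2 * a k s - wave k * N k s) * Real.cos (wave k * x))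
      hAA hS hSc (fun k s hs => (hd k s hs).mul_const _) (fun k s hs => ?_) ht
      (summable_mul_cos (asum ht) x) ht
    rw [norm_mul]
    exact (mul_le_of_le_one_right (norm_nonneg _) (Real.abs_cos_le_one _)).trans (hd1 k s hs)
  have dx : ∀ t ∈ S, ∀ x, HasDerivAt (fun y => ∑' k, a k t * Real.cos (wave k * y))
      (∑' k, -(wave k * a k t) * Real.sin (wave k * x)) x := fun t ht x =>
    hasDerivAt_tsum_cos hAA (fun k => (ha k t ht).trans (hAle ht k)) (fun k => ha1 k t ht) x
  have dxx : ∀ t ∈ S, ∀ x, HasDerivAt (fun y => ∑' k, -(wave k * a k t) * Real.sin (wave k * y))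
      (∑' k, -(wave k ^ 2 * a k t) * Real.cos (wave k * x)) x := by
    intro t ht x
    have e : ∀ k, wave k * -(wave k * a k t) = -(wave k ^ 2 * a k t) := fun k => by ring
    have := hasDerivAt_tsum_sin (c := fun k => -(wave k * a k t)) hAA
      (fun k => by rw [abs_neg]; exact ha1 k t ht)
      (fun k => by rw [e, abs_neg]; exact (ha2 k t ht).trans (hAle ht k)) x
    simpa only [e] using this
  have cxx : ContinuousOn (fun p : ℝ × ℝ => ∑' k, -(wave k ^ 2 * a k p.1) *
      Real.cos (wave k * p.2)) (S ×ˢ univ) :=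
    continuousOn_tsum_cos (c := fun k t => -(wave k ^ 2 * a k t)) hA
      (fun k => by have := hac k; fun_prop) fun k t ht => by rw [abs_neg]; exact ha2 k t ht
  have e1 : ∀ t ∈ S, deriv (fun y => ∑' k, a k t * Real.cos (wave k * y)) =
      fun x => ∑' k, -(wave k * a k t) * Real.sin (wave k * x) := fun t ht =>
    funext fun x => (dx t ht x).deriv
  have e2 : ∀ t ∈ S, ∀ x, iteratedDeriv 2 (fun y => ∑' k, a k t * Real.cos (wave k * y)) x =
      ∑' k, -(wave k ^ 2 * a k t) * Real.cos (wave k * x) := fun t ht x => by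
    rw [iteratedDeriv_succ, iteratedDeriv_one, e1 t ht]
    exact (dxx t ht x).deriv
  -- `q t` are the coefficients of `φ²`; the mode `k = 0` drops out of `∂ₓu` since `0⁻¹ = 0`.
  set q : ℝ → ℤ → ℝ := fun t k => conv (fun i => a i t) (fun i => a i t) k with hq
  have qle : ∀ t ∈ S, ∀ k, |q t k| ≤ conv A A k := fun t ht k =>
    abs_conv_le (fun i => ha i t ht) (fun i => ha i t ht) hA hA k
  have qs : Summable (conv A A) := summable_conv hA hA
  have vle : ∀ t ∈ S, ∀ k, |-(wave k)⁻¹ * q t k| ≤ conv A A k := fun t ht k => by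
    rw [abs_mul, abs_neg]
    exact (mul_le_of_le_one_left (abs_nonneg _) (abs_wave_inv_le k)).trans (qle t ht k)
  have wv : ∀ t k, wave k * (-(wave k)⁻¹ * q t k) = if k = 0 then 0 else -q t k := by
    intro t k
    split_ifs with hk
    · rw [hk, wave_zero, zero_mul]
    · have := wave_ne_zero hk
      field_simp
  have wvle : ∀ t ∈ S, ∀ k, |wave k * (-(wave k)⁻¹ * q t k)| ≤ conv A A k := fun t ht k => by
    rw [wv]
    split_ifs
    · rw [abs_zero]
      exact (abs_nonneg _).trans (qle t ht k)
    · rw [abs_neg]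
      exact qle t ht k
  have qsum : ∀ t ∈ S, Summable fun k => |q t k| := fun t ht =>
    Summable.of_nonneg_of_le (fun _ => abs_nonneg _) (qle t ht) qs
  have du : ∀ t ∈ S, ∀ x, HasDerivAt (fun y => ∑' k, -(wave k)⁻¹ * q t k * Real.sin (wave k * y))
      (q t 0 - (∑' k, a k t * Real.cos (wave k * x)) ^ 2) x := by
    intro t ht x
    refine (hasDerivAt_tsum_sin qs (vle t ht) (wvle t ht) x).congr_deriv ?_
    rw [tsum_cos_sq (asum ht) (fun k => hsymm k t) x]
    have e : ∀ k, wave k * (-(wave k)⁻¹ * q t k) * Real.cos (wave k * x) =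
        (if k = 0 then q t 0 else 0) - q t k * Real.cos (wave k * x) := by
      intro k
      rw [wv]
      split_ifs with hk
      · rw [hk, wave_zero]; simp
      · ring
    rw [tsum_congr e, Summable.tsum_sub (summable_of_ne_finset_zero (s := {0}) fun k hk => by
      simp only [Finset.mem_singleton] at hk; simp [hk]) (summable_mul_cos (qsum t ht) x),
      tsum_ite_eq]
  have uper : ∀ t, Function.Periodic
      (fun y => ∑' k, -(wave k)⁻¹ * q t k * Real.sin (wave k * y)) 1 := fun t x => by
    simp only [sin_wave_add_one]
  have hmean : ∀ t ∈ S, (∫ y in (-1 / 2 : ℝ)..(1 / 2),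
      (∑' k, a k t * Real.cos (wave k * y)) ^ 2) = q t 0 := by
    intro t ht
    have hcont : Continuous fun y => ∑' k, a k t * Real.cos (wave k * y) :=
      continuous_iff_continuousAt.2 fun x => (dx t ht x).continuousAt
    have h := intervalIntegral.integral_eq_sub_of_hasDerivAt (a := -1 / 2) (b := 1 / 2)
      (fun x _ => du t ht x) (Continuous.intervalIntegrable (by fun_prop) _ _)
    have hp := uper t (-1 / 2)
    norm_num only at hp h ⊢
    rw [hp, sub_self, intervalIntegral.integral_sub intervalIntegrable_const
      (Continuous.intervalIntegrable (by fun_prop) _ _), intervalIntegral.integral_const] at h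
    norm_num only [one_smul] at h
    linarith
  have dflux : ∀ t ∈ S, ∀ x, HasDerivAt
      (fun y => (∑' k, -(wave k)⁻¹ * q t k * Real.sin (wave k * y)) *
        ∑' k, a k t * Real.cos (wave k * y))
      (∑' k, wave k * N k t * Real.cos (wave k * x)) x := by
    intro t ht x
    have vsum : Summable fun k => |-(wave k)⁻¹ * q t k| :=
      Summable.of_nonneg_of_le (fun _ => abs_nonneg _) (vle t ht) qs
    have e : (fun y => (∑' k, -(wave k)⁻¹ * q t k * Real.sin (wave k * y)) *
        ∑' k, a k t * Real.cos (wave k * y)) = fun y => ∑' k, N k t * Real.sin (wave k * y) := by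
      funext y
      rw [tsum_sin_mul_tsum_cos vsum (asum ht) (fun k => hsymm k t) y]
      simp only [hN, hq]
    have nle : ∀ k, |N k t| ≤ conv (conv A A) A k := fun k => by
      rw [hN]
      exact abs_conv_le (vle t ht) (fun i => ha i t ht) qs hA k
    have nles := summable_conv qs hA
    rw [e]
    refine hasDerivAt_tsum_sin (A := fun k => conv (conv A A) A k + A k) (nles.add hA)
      (fun k => (nle k).trans ?_) (fun k => (hN1 k t ht).trans ?_) x
    · linarith [hA0 ht k]
    · linarith [(abs_nonneg _).trans (nle k)]
  refine ⟨fun t _ x => ?_, fun t _ => uper t, ?_, fun t ht x => (dt t ht x).differentiableAt,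
    fun t ht => ?_, ?_, ?_, ?_, fun t _ => ?_, fun t ht x => ?_, fun t ht x => ?_⟩
  · simp only [cos_wave_add_one]
  · exact continuousOn_tsum_cos hA hac ha
  · refine contDiff_two_of_hasDerivAt (dx t ht) (dxx t ht) ?_
    exact cxx.comp_continuous (f := fun x : ℝ => (t, x)) (by fun_prop) fun _ => ⟨ht, mem_univ _⟩
  · refine (continuousOn_tsum_cos (c := fun k t => -(wave k) ^ 2 * a k t - wave k * N k t) hAA
      (fun k => by have := hac k; have := hNc k; fun_prop) hd1).congr fun p hp => ?_
    exact (dt p.1 hp.1 p.2).deriv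
  · refine (continuousOn_tsum_sin (c := fun k t => -(wave k * a k t)) hAA
      (fun k => by have := hac k; fun_prop)
      (fun k t ht => by rw [abs_neg]; exact ha1 k t ht)).congr fun p hp => ?_
    exact (dx p.1 hp.1 p.2).deriv
  · exact cxx.congr fun p hp => e2 p.1 hp.1 p.2
  · simp
  · rw [hmean t ht]
    exact du t ht x
  · rw [(dt t ht x).deriv, (dflux t ht x).deriv, e2 t ht x]
    have s1 : Summable fun k => (-(wave k) ^ 2 * a k t - wave k * N k t) * Real.cos (wave k * x) :=
      summable_mul_cos (Summable.of_nonneg_of_le (fun _ => abs_nonneg _)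
        (fun k => hd1 k t ht) hAA) x
    have s2 : Summable fun k => wave k * N k t * Real.cos (wave k * x) :=
      summable_mul_cos (Summable.of_nonneg_of_le (fun _ => abs_nonneg _)
        (fun k => hN1 k t ht) hA) x
    rw [← s1.tsum_add s2]
    refine tsum_congr fun k => ?_
    ring

/-- Local existence for symmetric data given by an absolutely convergent cosine series; the time
of existence depends only on the `ℓ¹` norm of the coefficients. -/
theorem exists_solution_of_modes {R : ℝ} (hR : 0 ≤ R) : ∃ τ : ℝ, 0 < τ ∧ ∀ a₀ : ℤ → ℝ,
    (Summable fun k => |a₀ k|) → (∑' k, |a₀ k|) ≤ R → (∀ k, a₀ (-k) = a₀ k) →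
    ∃ φ u : ℝ → ℝ → ℝ, IsSolution (fun x => ∑' k, a₀ k * Real.cos (wave k * x)) τ φ u := by
  obtain ⟨τ, hτ, h⟩ := exists_modes hR
  refine ⟨τ, hτ, fun a₀ hs hle hsymm => ?_⟩
  obtain ⟨a, N, M, hM, hac, hNc, hasymm, haM, ha0, hN, hd⟩ := h a₀ hs hle hsymm
  refine ⟨fun t x => ∑' k, a k t * Real.cos (wave k * x),
    fun t x => ∑' k, -(wave k)⁻¹ * conv (fun i => a i t) (fun i => a i t) k *
      Real.sin (wave k * x), IsSolution.of_isClassicalOn (IsClassicalOn.of_local fun t ht => ?_)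
    (fun x => by simp only [ha0]) (fun x => by simp only [cos_wave_add_one])
    (continuousOn_tsum_cos hM hac fun k t _ => haM k t)⟩
  have hδ : 0 < t / 2 := by linarith [ht.1]
  obtain ⟨B, hB, hBle⟩ := exists_smooth_majorant hδ hM hac haM hN hd
  have hsub : Ioo (t / 2) τ ⊆ Ioo 0 τ := Ioo_subset_Ioo_left hδ.le
  have hM0 : ∀ k, 0 ≤ M k := fun k => (abs_nonneg _).trans (haM k 0)
  have hB0 : ∀ k, 0 ≤ B k := fun k =>
    (abs_nonneg _).trans (hBle k t ⟨by linarith [ht.1], ht.2⟩).1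
  refine ⟨Ioo (t / 2) τ, isOpen_Ioo, ⟨by linarith [ht.1], ht.2⟩, ?_⟩
  refine isClassicalOn_tsum isOpen_Ioo isPreconnected_Ioo (A := fun k => M k + B k) (hM.add hB)
    hac hNc hasymm (fun k s _ => ?_) (fun k s hs => ?_) (fun k s hs => ?_) hN
    fun k s hs => hd k s (hsub hs)
  · linarith [haM k s, hB0 k]
  · linarith [(hBle k s hs).1, hM0 k]
  · linarith [(hBle k s hs).2, hM0 k]

/-! ### Cosine coefficients -/

theorem integral_eq_two_mul_of_even {f : ℝ → ℝ} (hf : Continuous f) (heven : ∀ x, f (-x) = f x) :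
    (∫ x in (-1 / 2 : ℝ)..(1 / 2), f x) = 2 * ∫ x in (0 : ℝ)..(1 / 2), f x := by
  rw [← intervalIntegral.integral_add_adjacent_intervals (hf.intervalIntegrable (-1 / 2) 0)
    (hf.intervalIntegrable 0 (1 / 2))]
  have h := intervalIntegral.integral_comp_neg (a := 0) (b := 1 / 2) f
  simp only [heven, neg_zero] at h
  rw [neg_div, ← h]
  ring

theorem integral_eq_zero_of_odd {f : ℝ → ℝ} (hodd : ∀ x, f (-x) = -f x) :
    (∫ x in (-1 / 2 : ℝ)..(1 / 2), f x) = 0 := by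
  have h := intervalIntegral.integral_comp_neg (a := -1 / 2) (b := 1 / 2) f
  simp only [hodd, intervalIntegral.integral_neg] at h
  norm_num at h ⊢
  linarith

/-- The Fourier coefficients of an even function of period one, as integrals over the half
period. -/
noncomputable def cosCoeff (f : ℝ → ℝ) (k : ℤ) : ℝ :=
  2 * ∫ x in (0 : ℝ)..(1 / 2), f x * Real.cos (wave k * x)

theorem cosCoeff_neg (f : ℝ → ℝ) (k : ℤ) : cosCoeff f (-k) = cosCoeff f k := by
  simp only [cosCoeff, wave_neg, neg_mul, Real.cos_neg]

theorem abs_cosCoeff_le {f : ℝ → ℝ} {K : ℝ} (hK : ∀ x, |f x| ≤ K) (k : ℤ) :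
    |cosCoeff f k| ≤ K := by
  have := intervalIntegral.norm_integral_le_of_norm_le_const (a := 0) (b := 1 / 2) (C := K)
    (f := fun x => f x * Real.cos (wave k * x)) fun x _ => by
      rw [norm_mul]
      exact (mul_le_of_le_one_right (norm_nonneg _) (Real.abs_cos_le_one _)).trans (hK x)
  rw [Real.norm_eq_abs] at this
  rw [cosCoeff, abs_mul, abs_two]
  norm_num at this ⊢
  linarith

/-- Fourier inversion for even functions with summable coefficients. -/
theorem tsum_cosCoeff_mul_cos {f : ℝ → ℝ} (hf : Continuous f) (hper : Function.Periodic f 1)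
    (heven : ∀ x, f (-x) = f x) (hs : Summable fun k => |cosCoeff f k|) (x : ℝ) :
    ∑' k, cosCoeff f k * Real.cos (wave k * x) = f x := by
  have hper' : Function.Periodic (fun x => (f x : ℂ)) 1 := fun x => by simp only [hper x]
  let F : C(AddCircle (1 : ℝ), ℂ) := ⟨hper'.lift,
    continuous_coinduced_dom.2 (Complex.continuous_ofReal.comp hf)⟩
  have hF : ∀ y : ℝ, F (y : AddCircle (1 : ℝ)) = (f y : ℂ) := fun y => hper'.lift_coe y
  have hfour : ∀ (k : ℤ) (y : ℝ), fourier k (y : AddCircle (1 : ℝ)) =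
      ((Real.cos (wave k * y) : ℝ) : ℂ) + ((Real.sin (wave k * y) : ℝ) : ℂ) * Complex.I := by
    intro k y
    rw [fourier_coe_apply, Complex.ofReal_cos, Complex.ofReal_sin, ← Complex.exp_mul_I]
    congr 1
    simp only [wave]
    push_cast
    ring
  have hcoef : ∀ k, fourierCoeff F k = ((cosCoeff f k : ℝ) : ℂ) := by
    intro k
    rw [fourierCoeff_eq_intervalIntegral F k (-1 / 2)]
    have e : ∀ y : ℝ, fourier (-k) (y : AddCircle (1 : ℝ)) • F (y : AddCircle (1 : ℝ)) =
        ((f y * Real.cos (wave k * y) : ℝ) : ℂ) -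
          ((f y * Real.sin (wave k * y) : ℝ) : ℂ) * Complex.I := by
      intro y
      rw [hfour, hF, wave_neg, neg_mul, Real.cos_neg, Real.sin_neg, smul_eq_mul]
      push_cast
      ring
    simp only [e]
    have hb : (-1 / 2 + 1 : ℝ) = 1 / 2 := by norm_num
    rw [hb, intervalIntegral.integral_sub (Continuous.intervalIntegrable (by fun_prop) _ _)
      (Continuous.intervalIntegrable (by fun_prop) _ _), intervalIntegral.integral_mul_const,
      intervalIntegral.integral_ofReal, intervalIntegral.integral_ofReal,
      integral_eq_zero_of_odd (f := fun y => f y * Real.sin (wave k * y)) (fun y => by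
        rw [heven, mul_neg, Real.sin_neg, mul_neg]),
      integral_eq_two_mul_of_even (f := fun y => f y * Real.cos (wave k * y)) (by fun_prop)
        (fun y => by rw [heven, mul_neg, Real.cos_neg])]
    simp [cosCoeff]
  have hsum : Summable (fourierCoeff F) := by
    refine Summable.of_norm ?_
    simp only [hcoef, Complex.norm_real]
    exact hs
  have h := (Complex.hasSum_re (has_pointwise_sum_fourier_series_of_summable hsum
    (x : AddCircle (1 : ℝ)))).tsum_eq
  simp only [hcoef, hfour, hF, Complex.ofReal_re] at h
  rw [← h]
  refine tsum_congr fun k => ?_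
  simp [-Complex.ofReal_cos, -Complex.ofReal_sin]

theorem sin_wave_half (k : ℤ) : Real.sin (wave k * (1 / 2)) = 0 := by
  have : wave k * (1 / 2) = k * Real.pi := by rw [wave]; ring
  rw [this, Real.sin_int_mul_pi]

theorem cosCoeff_of_hasDerivAt {f f' f'' : ℝ → ℝ} (h1 : ∀ x, HasDerivAt f (f' x) x)
    (h2 : ∀ x, HasDerivAt f' (f'' x) x) (hc : Continuous f'') (h0 : f' 0 = 0)
    (hh : f' (1 / 2) = 0) (k : ℤ) : cosCoeff f'' k = -(wave k) ^ 2 * cosCoeff f k := by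
  have c0 : Continuous f := continuous_iff_continuousAt.2 fun x => (h1 x).continuousAt
  have c1 : Continuous f' := continuous_iff_continuousAt.2 fun x => (h2 x).continuousAt
  have dcos : ∀ x, HasDerivAt (fun x => Real.cos (wave k * x))
      (-(wave k * Real.sin (wave k * x))) x := fun x =>
    (((hasDerivAt_id x).const_mul (wave k)).cos).congr_deriv (by simp; ring)
  have dsin : ∀ x, HasDerivAt (fun x => Real.sin (wave k * x))
      (wave k * Real.cos (wave k * x)) x := fun x =>
    (((hasDerivAt_id x).const_mul (wave k)).sin).congr_deriv (by simp; ring)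
  -- `f' cos + w f sin` is an antiderivative of `f'' cos + w² f cos` vanishing at both ends.
  have h := intervalIntegral.integral_eq_sub_of_hasDerivAt (a := 0) (b := 1 / 2)
    (f := fun x => f' x * Real.cos (wave k * x) + wave k * (f x * Real.sin (wave k * x)))
    (f' := fun x => f'' x * Real.cos (wave k * x) +
      wave k ^ 2 * (f x * Real.cos (wave k * x)))
    (fun x _ => (((h2 x).mul (dcos x)).add (((h1 x).mul (dsin x)).const_mul (wave k))).congr_deriv
      (by ring))
    (Continuous.intervalIntegrable (by fun_prop) _ _)
  rw [intervalIntegral.integral_add (Continuous.intervalIntegrable (by fun_prop) _ _)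
    (Continuous.intervalIntegrable (by fun_prop) _ _), intervalIntegral.integral_const_mul,
    h0, hh, sin_wave_half] at h
  simp only [mul_zero, zero_mul, Real.sin_zero, add_zero, sub_zero] at h
  simp only [cosCoeff]
  linarith

theorem exists_abs_cosCoeff_le {f : ℝ → ℝ} (hf : ContDiff ℝ 2 f) (hper : Function.Periodic f 1)
    (heven : ∀ x, f (-x) = f x) : ∃ B : ℝ, ∀ k, |wave k ^ 2 * cosCoeff f k| ≤ B := by
  have h2 : ContDiff ℝ (1 + 1) f := by norm_num; exact hf
  have hd : ContDiff ℝ 1 (deriv f) := (contDiff_succ_iff_deriv.1 h2).2.2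
  have hc : Continuous (deriv (deriv f)) := hd.continuous_deriv le_rfl
  have hp2 : Function.Periodic (deriv (deriv f)) 1 := by
    intro x
    have : deriv f = fun y => deriv f (y + 1) := by
      funext y
      rw [← deriv_comp_add_const]
      congr 1
      funext z
      exact (hper z).symm
    conv_rhs => rw [this]
    rw [deriv_comp_add_const]
  obtain ⟨B, hB⟩ := (isCompact_Icc (a := (0 : ℝ)) (b := 1)).exists_bound_of_continuousOn
    hc.continuousOn
  refine ⟨B, fun k => ?_⟩
  have h := cosCoeff_of_hasDerivAt
    (fun x => (h2.differentiable (by norm_num) x).hasDerivAt)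
    (fun x => (hd.differentiable (by norm_num) x).hasDerivAt) hc (deriv_zero_of_even heven)
    (deriv_half_of_even heven hper) k
  have h3 := abs_cosCoeff_le (f := deriv (deriv f)) (K := B) (fun x => by
    obtain ⟨y, hy, hxy⟩ := hp2.exists_mem_Ico₀ one_pos x
    rw [hxy]
    exact hB y ⟨hy.1, hy.2.le⟩) k
  rwa [h, neg_mul, abs_neg] at h3

theorem summable_inv_wave_sq : Summable fun k => (wave k ^ 2)⁻¹ := by
  have h : Summable fun k : ℤ => 1 / (k : ℝ) ^ 2 := Real.summable_one_div_int_pow.2 (by norm_num)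
  refine (h.mul_left ((2 * Real.pi) ^ 2)⁻¹).congr fun k => ?_
  rw [wave, mul_pow (2 * Real.pi), mul_inv, one_div]

/-- The time-independent majorant `B / (2πk)² + K δ_{k0}`, where the first term is zero for
`k = 0`. -/
theorem summable_majorant (B K : ℝ) :
    Summable fun k : ℤ => B * (wave k ^ 2)⁻¹ + if k = 0 then K else 0 :=
  (summable_inv_wave_sq.mul_left B).add (summable_of_ne_finset_zero (s := {0}) fun k hk => by
    simp only [Finset.mem_singleton] at hk; simp [hk])

theorem abs_le_majorant {c : ℤ → ℝ} {B K : ℝ} (hB : ∀ k, |wave k ^ 2 * c k| ≤ B)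
    (hK : |c 0| ≤ K) (k : ℤ) : |c k| ≤ B * (wave k ^ 2)⁻¹ + if k = 0 then K else 0 := by
  split_ifs with hk
  · rw [hk, wave_zero]
    simpa using hK
  · have hw : 0 < wave k ^ 2 := by have := wave_ne_zero hk; positivity
    have h := hB k
    rw [abs_mul, abs_of_pos hw] at h
    rw [add_zero, ← div_eq_mul_inv, le_div_iff₀ hw]
    linarith

/-! ### Continuation of bounded solutions -/

namespace IsClassicalOn

variable {S : Set ℝ} {φ u : ℝ → ℝ → ℝ} {t : ℝ}

theorem cosCoeff_deriv_time (h : IsClassicalOn S φ u) (ht : t ∈ S)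
    (heven : ∀ x, φ t (-x) = φ t x) (k : ℤ) :
    cosCoeff (fun x => deriv (fun s => φ s x) t) k = -(wave k) ^ 2 * cosCoeff (φ t) k +
      -cosCoeff (fun x => ((∫ y in (-1 / 2 : ℝ)..(1 / 2), φ t y ^ 2) - φ t x ^ 2) * φ t x
        + u t x * deriv (φ t) x) k := by
  have c := h.continuous_density ht
  have cd := h.continuous_deriv_space ht
  have cdd := h.continuous_deriv_space_two ht
  have cu := h.continuous_velocity ht
  rw [← cosCoeff_of_hasDerivAt (h.hasDerivAt_space ht) (h.hasDerivAt_deriv_space ht) cdd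
    (deriv_zero_of_even heven) (deriv_half_of_even heven (h.periodic t ht)) k]
  simp only [cosCoeff, h.deriv_time_eq ht]
  rw [← sub_eq_add_neg, ← mul_sub, ← intervalIntegral.integral_sub
    (Continuous.intervalIntegrable (by fun_prop) _ _)
    (Continuous.intervalIntegrable (by fun_prop) _ _)]
  simp only [sub_mul]

/-- For a density that is monotone on the half period, `‖∂ₓφ‖_{L¹}` is controlled by `‖φ‖_∞`, so
the Fourier coefficients of the transport term `∂ₓ(uφ)` are bounded in terms of `‖φ‖_∞`. -/
theorem abs_cosCoeff_transport_le (h : IsClassicalOn S φ u) (ht : t ∈ S)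
    (heven : ∀ x, φ t (-x) = φ t x) (hanti : AntitoneOn (φ t) (Icc 0 (1 / 2))) {K : ℝ}
    (hK : ∀ x, |φ t x| ≤ K) (k : ℤ) :
    |cosCoeff (fun x => ((∫ y in (-1 / 2 : ℝ)..(1 / 2), φ t y ^ 2) - φ t x ^ 2) * φ t x
        + u t x * deriv (φ t) x) k| ≤ 5 * K ^ 3 := by
  have hK0 : 0 ≤ K := (abs_nonneg _).trans (hK 0)
  have cd := h.continuous_deriv_space ht
  have hneg : ∀ x ∈ Icc (0 : ℝ) (1 / 2), deriv (φ t) x ≤ 0 := by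
    intro x hx
    rcases hx.1.eq_or_lt with rfl | h0
    · rw [deriv_zero_of_even heven]
    rcases hx.2.eq_or_lt with rfl | h1
    · rw [deriv_half_of_even heven (h.periodic t ht)]
    · rw [← derivWithin_of_mem_nhds (Icc_mem_nhds h0 h1)]
      exact hanti.derivWithin_nonpos
  have hint : (∫ x in (0 : ℝ)..(1 / 2), (K ^ 3 + K ^ 2 * -deriv (φ t) x)) ≤ 5 * K ^ 3 / 2 := by
    rw [intervalIntegral.integral_add intervalIntegrable_const
      (Continuous.intervalIntegrable (by fun_prop) _ _), intervalIntegral.integral_const,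
      intervalIntegral.integral_const_mul, intervalIntegral.integral_neg,
      intervalIntegral.integral_eq_sub_of_hasDerivAt (fun x _ => h.hasDerivAt_space ht x)
      (cd.intervalIntegrable _ _), smul_eq_mul]
    have h1 := (abs_le.1 (hK 0)).2
    have h2 := (abs_le.1 (hK (1 / 2))).1
    have h3 : -(φ t (1 / 2) - φ t 0) ≤ 2 * K := by linarith
    have h4 := mul_le_mul_of_nonneg_left h3 (sq_nonneg K)
    linarith
  have hb := intervalIntegral.norm_integral_le_of_norm_le (a := 0) (b := 1 / 2) (by norm_num)
    (μ := volume) (f := fun x => (((∫ y in (-1 / 2 : ℝ)..(1 / 2), φ t y ^ 2) - φ t x ^ 2) * φ t x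
        + u t x * deriv (φ t) x) * Real.cos (wave k * x))
    (g := fun x => K ^ 3 + K ^ 2 * -deriv (φ t) x)
    (Eventually.of_forall fun x hx => by
      have hx' : x ∈ Icc (0 : ℝ) (1 / 2) := Ioc_subset_Icc_self hx
      rw [norm_mul]
      refine (mul_le_of_le_one_right (norm_nonneg _) (Real.abs_cos_le_one _)).trans ?_
      refine (norm_add_le _ _).trans (add_le_add ?_ ?_)
      · rw [norm_mul]
        calc _ ≤ K ^ 2 * K := mul_le_mul (h.abs_deriv_velocity_le ht hK x) (hK x)
              (abs_nonneg _) (by positivity)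
          _ = K ^ 3 := by ring
      · rw [norm_mul, Real.norm_eq_abs (deriv (φ t) x), abs_of_nonpos (hneg x hx')]
        exact mul_le_mul_of_nonneg_right (h.abs_velocity_le ht hK
          (abs_le.2 ⟨by linarith [hx'.1], by linarith [hx'.2]⟩)) (by linarith [hneg x hx']))
    (Continuous.intervalIntegrable (by fun_prop) _ _)
  rw [Real.norm_eq_abs] at hb
  rw [cosCoeff, abs_mul, abs_two]
  linarith

end IsClassicalOn

namespace IsSolution

variable {φ₀ : ℝ → ℝ} {T : ℝ} {φ u : ℝ → ℝ → ℝ}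

theorem of_local (hT : 0 < T) (h : ∀ t ∈ Ico 0 T, ∃ T₁ φ₁ u₁, t < T₁ ∧ IsSolution φ₀ T₁ φ₁ u₁ ∧
    (∀ s ∈ Ico 0 T₁, φ s = φ₁ s) ∧ ∀ s ∈ Ioo 0 T₁, u s = u₁ s) : IsSolution φ₀ T φ u := by
  have hcl : IsClassicalOn (Ioo 0 T) φ u := by
    refine IsClassicalOn.of_local fun t ht => ?_
    obtain ⟨T₁, φ₁, u₁, htT, hsol, hφ, hu⟩ := h t (Ioo_subset_Ico_self ht)
    exact ⟨Ioo 0 T₁, isOpen_Ioo, ⟨ht.1, htT⟩, hsol.isClassicalOn.congr isOpen_Ioo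
      (fun s hs => hφ s (Ioo_subset_Ico_self hs)) hu⟩
  obtain ⟨T₁, φ₁, u₁, hT₁, hsol, hφ, -⟩ := h 0 ⟨le_rfl, hT⟩
  have h0 : φ 0 = φ₁ 0 := hφ 0 ⟨le_rfl, hT₁⟩
  refine of_isClassicalOn hcl (fun x => by rw [h0, hsol.initial])
    (by rw [h0]; exact hsol.periodic 0 ⟨le_rfl, hT₁⟩) fun p hp => ?_
  obtain ⟨T₂, φ₂, u₂, hT₂, hsol₂, hφ₂, -⟩ := h p.1 hp.1
  refine ((hsol₂.continuousOn.congr (fun q hq => by rw [hφ₂ q.1 hq.1])) p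
    ⟨⟨hp.1.1, hT₂⟩, mem_univ _⟩).mono_of_mem_nhdsWithin ?_
  have hU : Iio T₂ ×ˢ (univ : Set ℝ) ∈ 𝓝 p :=
    (isOpen_Iio.prod isOpen_univ).mem_nhds ⟨hT₂, mem_univ _⟩
  filter_upwards [mem_nhdsWithin_of_mem_nhds hU, self_mem_nhdsWithin] with q h1 h2
  exact ⟨⟨h2.1.1, h1.1⟩, mem_univ _⟩

/-- A solution can be prolonged by a solution started from its value at an intermediate time. -/
theorem prolong {t₁ τ : ℝ} {ψ v : ℝ → ℝ → ℝ} (h : IsSolution φ₀ T φ u) (ht₁ : t₁ ∈ Ico 0 T)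
    (hψ : IsSolution (φ t₁) τ ψ v) (hτ : T < t₁ + τ) :
    ∃ φ' u' : ℝ → ℝ → ℝ, IsSolution φ₀ (t₁ + τ) φ' u' := by
  have hshift := h.comp_add ht₁.1 ht₁.2
  have hψ' := hψ.mono (T' := T - t₁) (by linarith)
  have hagree : ∀ t ∈ Ico t₁ T, φ t = ψ (t - t₁) := fun t ht => by
    have := hshift.density_unique hψ' (t - t₁) ⟨by linarith [ht.1], by linarith [ht.2]⟩
    simpa using this
  have hagree' : ∀ t ∈ Ioo t₁ T, u t = v (t - t₁) := fun t ht => by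
    have := hshift.velocity_unique hψ' (t - t₁) ⟨by linarith [ht.1], by linarith [ht.2]⟩
    simpa using this
  set φ' : ℝ → ℝ → ℝ := fun t => if t < T then φ t else ψ (t - t₁) with hφ'
  set u' : ℝ → ℝ → ℝ := fun t => if t < T then u t else v (t - t₁) with hu'
  have e1 : ∀ t, t < T → φ' t = φ t := fun t ht => if_pos ht
  have e2 : ∀ t, t < T → u' t = u t := fun t ht => if_pos ht
  have hcl : IsClassicalOn (Ioo 0 (t₁ + τ)) φ' u' := by
    refine IsClassicalOn.of_local fun t ht => ?_
    rcases lt_or_ge t T with htT | htT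
    · exact ⟨Ioo 0 T, isOpen_Ioo, ⟨ht.1, htT⟩, h.isClassicalOn.congr isOpen_Ioo
        (fun s hs => e1 s hs.2) fun s hs => e2 s hs.2⟩
    · have hc := hψ.isClassicalOn.comp_add (-t₁)
      refine ⟨Ioo t₁ (t₁ + τ), isOpen_Ioo, ⟨ht₁.2.trans_le htT, ht.2⟩,
        (hc.mono fun s hs => ?_).congr isOpen_Ioo (fun s hs => ?_) fun s hs => ?_⟩
      · exact ⟨by linarith [hs.1], by linarith [hs.2]⟩
      · rw [neg_add_eq_sub]
        rcases lt_or_ge s T with hsT | hsT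
        · rw [e1 s hsT, hagree s ⟨hs.1.le, hsT⟩]
        · exact if_neg (not_lt.2 hsT)
      · rw [neg_add_eq_sub]
        rcases lt_or_ge s T with hsT | hsT
        · rw [e2 s hsT, hagree' s ⟨hs.1, hsT⟩]
        · exact if_neg (not_lt.2 hsT)
  have hT : 0 < T := ht₁.1.trans_lt ht₁.2
  refine ⟨φ', u', of_isClassicalOn hcl (fun x => by rw [e1 0 hT, h.initial])
    (by rw [e1 0 hT]; exact h.periodic 0 ⟨le_rfl, hT⟩) fun p hp => ?_⟩
  rcases hp.1.1.eq_or_lt with h0 | h0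
  · have hc : ContinuousOn (fun p : ℝ × ℝ => φ' p.1 p.2) (Ico 0 T ×ˢ univ) :=
      h.continuousOn.congr fun q hq => by simp only [e1 q.1 hq.1.2]
    refine (hc p ⟨⟨hp.1.1, by rw [← h0]; exact hT⟩, mem_univ _⟩).mono_of_mem_nhdsWithin ?_
    have hU : Iio T ×ˢ (univ : Set ℝ) ∈ 𝓝 p :=
      (isOpen_Iio.prod isOpen_univ).mem_nhds ⟨by rw [mem_Iio, ← h0]; exact hT, mem_univ _⟩
    filter_upwards [mem_nhdsWithin_of_mem_nhds hU, self_mem_nhdsWithin] with q h1 h2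
    exact ⟨⟨h2.1.1, h1.1⟩, mem_univ _⟩
  · exact (hcl.continuousOn.continuousAt ((isOpen_Ioo.prod isOpen_univ).mem_nhds
      ⟨⟨h0, hp.1.2⟩, mem_univ _⟩)).continuousWithinAt

/-- A bounded solution with symmetric decreasing data can be continued. Monotonicity turns the
sup bound into an `ℓ¹` bound on the Fourier coefficients that is uniform in time, hence into a
uniform time of existence. -/
theorem exists_extension (h : IsSolution φ₀ T φ u) (hT : 0 < T) (heven : ∀ x, φ₀ (-x) = φ₀ x)
    (hanti : AntitoneOn φ₀ (Icc 0 (1 / 2))) {K : ℝ} (hK : ∀ t ∈ Ico 0 T, ∀ x, |φ t x| ≤ K) :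
    ∃ T', T < T' ∧ ∃ φ' u' : ℝ → ℝ → ℝ, IsSolution φ₀ T' φ' u' := by
  have hcl := h.isClassicalOn
  have hev := h.even heven
  have hmono := h.antitoneOn heven hanti
  have ht₀ : T / 2 ∈ Ioo 0 T := ⟨by linarith, by linarith⟩
  have hK0 : 0 ≤ K := (abs_nonneg _).trans (hK 0 ⟨le_rfl, hT⟩ 0)
  obtain ⟨B, hB⟩ := exists_abs_cosCoeff_le (hcl.contDiff_space _ ht₀) (hcl.periodic _ ht₀)
    (hev _ (Ioo_subset_Ico_self ht₀))
  have hcoef : ∀ k, ∀ t ∈ Ico (T / 2) T, |wave k ^ 2 * cosCoeff (φ t) k| ≤ B + 5 * K ^ 3 := by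
    intro k t ht
    rcases eq_or_ne k 0 with rfl | hk
    · have := (abs_nonneg _).trans (hB 0)
      rw [wave_zero]
      simp only [ne_eq, OfNat.ofNat_ne_zero, not_false_eq_true, zero_pow, zero_mul, abs_zero]
      positivity
    have hw : 0 < wave k ^ 2 := by have := wave_ne_zero hk; positivity
    have hcc : ContinuousOn (fun s => cosCoeff (φ s) k) (Ico 0 T) :=
      continuousOn_const.mul (continuousOn_integral_of_continuousOn
        (F := fun s x => φ s x * Real.cos (wave k * x))
        (h.continuousOn.mul (by fun_prop)) _ _)
    have hdc : ∀ s ∈ Ioo 0 T, HasDerivAt (fun s => cosCoeff (φ s) k)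
        (cosCoeff (fun x => deriv (fun r => φ r x) s) k) s := fun s hs =>
      (hasDerivAt_integral_of_continuousOn_deriv isOpen_Ioo
        (F := fun s x => φ s x * Real.cos (wave k * x))
        (F' := fun s x => deriv (fun r => φ r x) s * Real.cos (wave k * x))
        (fun r hr => (hcl.continuous_density hr).mul (by fun_prop))
        (fun r hr x => (hcl.hasDerivAt_time hr x).mul_const _)
        (hcl.continuousOn_deriv_time.mul (by fun_prop)) _ _ hs).const_mul 2
    have hsub : Ioo (T / 2) T ⊆ Ioo 0 T := Ioo_subset_Ioo_left (by linarith)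
    have hb := abs_le_of_deriv_eq_neg_mul_add (a := T / 2) (b := T)
      (y := fun s => cosCoeff (φ s) k) hw (hcc.mono (Ico_subset_Ico_left (by linarith)))
      (fun s hs => by
        have := hdc s (hsub hs)
        rwa [hcl.cosCoeff_deriv_time (hsub hs) (hev s (Ioo_subset_Ico_self (hsub hs)))] at this)
      (fun s hs => by
        have hs' := Ioo_subset_Ico_self (hsub hs)
        rw [abs_neg]
        exact hcl.abs_cosCoeff_transport_le (hsub hs) (hev s hs') (hmono s hs') (hK s hs') k) t ht
    have hB' := hB k
    rw [abs_mul, abs_of_pos hw] at hB' ⊢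
    calc wave k ^ 2 * |cosCoeff (φ t) k|
        ≤ wave k ^ 2 * (|cosCoeff (φ (T / 2)) k| + 5 * K ^ 3 / wave k ^ 2) :=
          mul_le_mul_of_nonneg_left hb hw.le
      _ = wave k ^ 2 * |cosCoeff (φ (T / 2)) k| + 5 * K ^ 3 := by
          rw [mul_add, ← mul_div_assoc, mul_div_cancel_left₀ _ hw.ne']
      _ ≤ B + 5 * K ^ 3 := by linarith
  have hmaj := summable_majorant (B + 5 * K ^ 3) K
  have hle : ∀ t ∈ Ico (T / 2) T, ∀ k, |cosCoeff (φ t) k| ≤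
      (B + 5 * K ^ 3) * (wave k ^ 2)⁻¹ + if k = 0 then K else 0 := fun t ht =>
    abs_le_majorant (fun k => hcoef k t ht)
      (abs_cosCoeff_le (hK t ⟨by linarith [ht.1], ht.2⟩) 0)
  have hR : 0 ≤ ∑' k : ℤ, ((B + 5 * K ^ 3) * (wave k ^ 2)⁻¹ + if k = 0 then K else 0) :=
    tsum_nonneg fun k => (abs_nonneg _).trans (hle (T / 2) ⟨le_rfl, ht₀.2⟩ k)
  obtain ⟨τ, hτ, hex⟩ := exists_solution_of_modes hR
  have ht₁ : max (T / 2) (T - τ / 2) ∈ Ico (T / 2) T :=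
    ⟨le_max_left _ _, max_lt ht₀.2 (by linarith)⟩
  set t₁ := max (T / 2) (T - τ / 2) with ht₁def
  have ht₁' : t₁ ∈ Ico 0 T := ⟨by linarith [ht₁.1], ht₁.2⟩
  have hτT : T < t₁ + τ := by linarith [le_max_right (T / 2) (T - τ / 2)]
  have hs := Summable.of_nonneg_of_le (fun k => abs_nonneg _) (hle t₁ ht₁) hmaj
  obtain ⟨ψ, v, hψ⟩ := hex (cosCoeff (φ t₁)) hs (hs.tsum_le_tsum (hle t₁ ht₁) hmaj)
    (cosCoeff_neg _)
  have hinit : (fun x => ∑' k, cosCoeff (φ t₁) k * Real.cos (wave k * x)) = φ t₁ :=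
    funext fun x => tsum_cosCoeff_mul_cos (h.continuous_density ht₁') (h.periodic t₁ ht₁')
      (hev t₁ ht₁') hs x
  rw [hinit] at hψ
  exact ⟨t₁ + τ, hτT, h.prolong ht₁' hψ hτT⟩

end IsSolution

/-- Local existence for even data of class `C²`. -/
theorem exists_isSolution {φ₀ : ℝ → ℝ} (hf : ContDiff ℝ 2 φ₀) (hper : Function.Periodic φ₀ 1)
    (heven : ∀ x, φ₀ (-x) = φ₀ x) :
    ∃ τ : ℝ, 0 < τ ∧ ∃ φ u : ℝ → ℝ → ℝ, IsSolution φ₀ τ φ u := by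
  obtain ⟨B, hB⟩ := exists_abs_cosCoeff_le hf hper heven
  have hs := Summable.of_nonneg_of_le (fun k => abs_nonneg _)
    (abs_le_majorant hB le_rfl) (summable_majorant B |cosCoeff φ₀ 0|)
  obtain ⟨τ, hτ, hex⟩ := exists_solution_of_modes (tsum_nonneg fun k => abs_nonneg (cosCoeff φ₀ k))
  obtain ⟨φ, u, h⟩ := hex (cosCoeff φ₀) hs le_rfl (cosCoeff_neg _)
  have hinit : (fun x => ∑' k, cosCoeff φ₀ k * Real.cos (wave k * x)) = φ₀ :=
    funext fun x => tsum_cosCoeff_mul_cos hf.continuous hper heven hs x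
  rw [hinit] at h
  exact ⟨τ, hτ, φ, u, h⟩

/-! ### The maximal solution -/

/-- If all solutions with the given data have lifespan at most `L`, they glue to a maximal
solution. -/
theorem exists_isMaximalSolution {φ₀ : ℝ → ℝ} {L τ : ℝ} {φτ uτ : ℝ → ℝ → ℝ} (hτ : 0 < τ)
    (hloc : IsSolution φ₀ τ φτ uτ) (hL : ∀ T φ u, IsSolution φ₀ T φ u → T ≤ L) :
    ∃ T, 0 < T ∧ ∃ φ u, IsMaximalSolution φ₀ T φ u := by
  set I : Set ℝ := {T | ∃ φ u, IsSolution φ₀ T φ u} with hI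
  have hbdd : BddAbove I := ⟨L, fun T ⟨φ, u, h⟩ => hL T φ u h⟩
  have hτI : τ ∈ I := ⟨φτ, uτ, hloc⟩
  have hex : ∀ t, ∃ T φ u, t < sSup I → t < T ∧ IsSolution φ₀ T φ u := by
    intro t
    by_cases ht : t < sSup I
    · obtain ⟨T, ⟨φ, u, h⟩, htT⟩ := exists_lt_of_lt_csSup ⟨τ, hτI⟩ ht
      exact ⟨T, φ, u, fun _ => ⟨htT, h⟩⟩
    · exact ⟨0, φτ, uτ, fun h => absurd h ht⟩
  choose Tc φc uc hc using hex
  have hpos : 0 < sSup I := hτ.trans_le (le_csSup hbdd hτI)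
  -- The glued functions agree with every solution on its whole interval.
  have hφ : ∀ T φ u, IsSolution φ₀ T φ u → ∀ t ∈ Ico 0 T, φc t t = φ t := by
    intro T φ u h t ht
    obtain ⟨h1, h2⟩ := hc t (ht.2.trans_le (le_csSup hbdd ⟨φ, u, h⟩))
    exact (h2.mono (min_le_left _ T)).density_unique (h.mono (min_le_right _ _)) t
      ⟨ht.1, lt_min h1 ht.2⟩
  have hu : ∀ T φ u, IsSolution φ₀ T φ u → ∀ t ∈ Ioo 0 T, uc t t = u t := by
    intro T φ u h t ht
    obtain ⟨h1, h2⟩ := hc t (ht.2.trans_le (le_csSup hbdd ⟨φ, u, h⟩))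
    exact (h2.mono (min_le_left _ T)).velocity_unique (h.mono (min_le_right _ _)) t
      ⟨ht.1, lt_min h1 ht.2⟩
  refine ⟨sSup I, hpos, fun t => φc t t, fun t => uc t t,
    IsSolution.of_local hpos fun t ht => ?_, fun T' φ' u' h => ⟨le_csSup hbdd ⟨φ', u', h⟩,
      fun t ht x => ?_, fun t ht x => ?_⟩⟩
  · obtain ⟨h1, h2⟩ := hc t ht.2
    exact ⟨Tc t, φc t, uc t, h1, h2, hφ _ _ _ h2, hu _ _ _ h2⟩
  · rw [hφ _ _ _ h t ht]
  · rw [hu _ _ _ h t ht]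

theorem theorem5p5 (V₀ : ℝ) (hV₀ : 0 < V₀) :
    ∃ C : ℝ, 0 < C ∧ ∀ φ₀ : ℝ → ℝ,
      ContDiff ℝ 2 φ₀ → Function.Periodic φ₀ 1 → (∀ x, 0 ≤ φ₀ x) → (∀ x, φ₀ (-x) = φ₀ x) →
      AntitoneOn φ₀ (Set.Icc 0 (1 / 2)) → φ₀ ≠ 0 →
      secondMoment φ₀ = V₀ → mass φ₀ > C * secondMoment φ₀ →
      BlowsUpInFiniteTime φ₀ := by
  -- With `m = M / 2` and `h = V₀ / 2`, this `C` gives `m ≥ 72 h` and `m ≥ 4`.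
  refine ⟨72 + 8 / V₀, by positivity, fun φ₀ hf hper hnn heven hanti _ hV hM => ?_⟩
  have hc := hf.continuous
  have hM2 : mass φ₀ = 2 * ∫ x in (0 : ℝ)..(1 / 2), φ₀ x := integral_eq_two_mul_of_even hc heven
  have hV2 : secondMoment φ₀ = 2 * ∫ x in (0 : ℝ)..(1 / 2), x ^ 2 * φ₀ x :=
    integral_eq_two_mul_of_even (f := fun x => x ^ 2 * φ₀ x) (by fun_prop)
      fun x => by rw [heven, neg_sq]
  have hCV : (72 + 8 / V₀) * V₀ = 72 * V₀ + 8 := by field_simp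
  rw [hV, hCV] at hM
  have hlife : ∀ T φ u, IsSolution φ₀ T φ u → T ≤ ∫ x in (0 : ℝ)..(1 / 2), x ^ 2 * φ₀ x :=
    fun T φ u h => h.lifespan_le heven hnn hanti (by linarith) (by linarith)
  obtain ⟨τ, hτ, φτ, uτ, hloc⟩ := exists_isSolution hf hper heven
  obtain ⟨T, hT, φ, u, hmax⟩ := exists_isMaximalSolution hτ hloc hlife
  refine ⟨T, hT, φ, u, hmax, ?_⟩
  by_contra! hbdd
  obtain ⟨K, hK⟩ := hbdd
  obtain ⟨T', hTT', φ', u', h'⟩ := hmax.isSolution.exists_extension hT heven hanti hK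
  exact absurd (hmax.maximal T' φ' u' h').1 (not_le.2 hTT')
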